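/- Let $k\ge 3$ and $d\ge 0$ be integers and let $a\in\mathbb{R}\setminus\{0\}$ satisfy $$a^2\;\ge\;\frac{4d(d+k-2)}{(k-2)^2}.$$ Let $E_a=\{(a\cos\psi,\ \sin\psi\, z)\;:\;\psi\in[0,\pi],\ z\in\mathbb{S}^{k-1}\}\subset\mathbb{R}\times\mathbb{R}^{k}$ be the $k$-dimensional ellipsoid with the induced metric. Then $E_a$ does not admit an infinite family of harmonic self-maps of the form $(\psi,z)\mapsto(f(\psi),\chi(z))$. More precisely: (i) For every eigenmap $\chi:\mathbb{S}^{k-1}\to\mathbb{S}^{k-1}$ with eigenvalue $d(d+k-2)$ (that is, a harmonic map with $|d\chi|^2=d(d+k-2)$) there are only finitely many smooth harmonic maps $\varphi:E_a\to E_a$ of the form $$\varphi(a\cos\psi,\ \sin\psi\, z)=(a\cos f(\psi),\ \sin f(\psi)\,\chi(z)),\qquad \psi\in[0,\pi],\ z\in\mathbb{S}^{k-1},$$ with $f:[0,\pi]\to\mathbb{R}$ continuous, $f(0)=0$ and $f(\pi)=\ell\pi$ for some $\ell\in\mathbb{Z}$. (ii) The Euler-Lagrange equation of the energy for maps of this form,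 $$f''=\frac{d(d+k-2)}{2}\,\frac{a^2\sin^2\psi+\cos^2\psi}{a^2\sin^2 f+\cos^2 f}\,\frac{\sin 2f}{\sin^2\psi}-(k-1)\cot\psi\, f'-\frac{a^2-1}{2}\,\frac{\sin 2f}{a^2\sin^2 f+\cos^2 f}\,f'^2+\frac{a^2-1}{2}\,\frac{\sin 2\psi}{a^2\sin^2\psi+\cos^2\psi}\,f',$$ has only finitely many $C^2$ solutions $f:(0,\pi)\to\mathbb{R}$ with $\lim_{\psi\to0}f(\psi)=0$ and $\lim_{\psi\to\pi}f(\psi)=\ell\pi$ for some $\ell\in\mathbb{Z}$. -/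

import Mathlib

open Set Filter Topology
open scoped ContDiff

/-! ### Harmonic maps between compact submanifolds of Euclidean spaces

`M ⊆ V` and `N ⊆ W` are compact smooth submanifolds of real inner product spaces, with the induced
metrics. A map from `M` to `N` is represented by a function `V → W` whose values off `M` play no
role. -/

/-- `γ` is a smooth curve in `M` that starts at `p`. -/
def IsCurveFrom {V : Type*} [NormedAddCommGroup V] [InnerProductSpace ℝ V]
    (M : Set V) (p : V) (γ : ℝ → V) : Prop :=
  ContDiff ℝ ∞ γ ∧ (∀ t, γ t ∈ M) ∧ γ 0 = p

/-- `w` is orthogonal to the tangent space of `M` at `p`, which consists of the initial velocities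
of the smooth curves in `M` that start at `p`. -/
def IsNormalTo {V : Type*} [NormedAddCommGroup V] [InnerProductSpace ℝ V]
    (M : Set V) (p w : V) : Prop :=
  ∀ γ : ℝ → V, IsCurveFrom M p γ → inner ℝ (deriv γ 0) w = 0

/-- The curves `γ i` in the `m`-dimensional submanifold `M` start at `p`, their initial velocities
form an orthonormal basis of the tangent space at `p`, and their covariant accelerations (the
tangential parts of the second derivatives) vanish at time `0`. -/
def IsGeodesicFrame {V : Type*} [NormedAddCommGroup V] [InnerProductSpace ℝ V]
    (m : ℕ) (M : Set V) (p : V) (γ : Fin m → ℝ → V) : Prop :=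
  (∀ i, IsCurveFrom M p (γ i)) ∧
  Orthonormal ℝ (fun i => deriv (γ i) 0) ∧
  ∀ i, IsNormalTo M p (deriv (deriv (γ i)) 0)

/-- `φ` is a smooth harmonic map from the `m`-dimensional submanifold `M` to the submanifold `N`:
its tension field `Tr ∇dφ` vanishes. If the covariant acceleration of `γ` vanishes at time `0`, then
`∇dφ (γ' 0, γ' 0)` is the covariant acceleration of `φ ∘ γ` at time `0`, that is, the part of
`(φ ∘ γ)'' 0` tangential to `N`; the tension field is the sum of these vectors over an orthonormal
basis. -/
def IsHarmonicMap {V W : Type*} [NormedAddCommGroup V] [InnerProductSpace ℝ V]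
    [NormedAddCommGroup W] [InnerProductSpace ℝ W]
    (m : ℕ) (M : Set V) (N : Set W) (φ : V → W) : Prop :=
  MapsTo φ M N ∧ ContDiffOn ℝ ∞ φ M ∧
  ∀ p ∈ M, ∀ γ : Fin m → ℝ → V, IsGeodesicFrame m M p γ →
    IsNormalTo N (φ p) (∑ i, deriv (deriv (fun t => φ (γ i t))) 0)

/-- `|dφ|² = c` on all of `M`. -/
def HasConstantEnergyDensity {V W : Type*} [NormedAddCommGroup V] [InnerProductSpace ℝ V]
    [NormedAddCommGroup W] [InnerProductSpace ℝ W]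
    (m : ℕ) (M : Set V) (φ : V → W) (c : ℝ) : Prop :=
  ∀ p ∈ M, ∀ γ : Fin m → ℝ → V, IsGeodesicFrame m M p γ →
    ∑ i, ‖deriv (fun t => φ (γ i t)) 0‖ ^ 2 = c

/-! ### Eigenmaps, ellipsoids and the self-maps `(ψ, θ) ↦ (f ψ, χ θ)` -/

/-- `χ` is an eigenmap of the unit sphere of `ℝ^k` (of dimension `k - 1`) with eigenvalue
`d (d + k - 2)`: a harmonic self-map with `|dχ|² = d (d + k - 2)`. -/
def IsEigenmap (k d : ℕ) (χ : EuclideanSpace ℝ (Fin k) → EuclideanSpace ℝ (Fin k)) : Prop :=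
  IsHarmonicMap (k - 1) (Metric.sphere 0 1) (Metric.sphere 0 1) χ ∧
  HasConstantEnergyDensity (k - 1) (Metric.sphere (0 : EuclideanSpace ℝ (Fin k)) 1) χ
    ((d : ℝ) * ((d : ℝ) + (k : ℝ) - 2))

/-- The Euclidean space `ℝ × ℝ^k`. -/
abbrev AmbientSpace (k : ℕ) : Type := WithLp 2 (ℝ × EuclideanSpace ℝ (Fin k))

/-- The point `(a cos ψ, (sin ψ) z)`. -/
noncomputable def ellipsoidPoint {k : ℕ} (a ψ : ℝ) (z : EuclideanSpace ℝ (Fin k)) :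
    AmbientSpace k :=
  WithLp.toLp 2 (a * Real.cos ψ, Real.sin ψ • z)

/-- The `k`-dimensional ellipsoid `E_a`: the points `(a cos ψ, (sin ψ) z)` with `ψ ∈ [0, π]` and
`|z| = 1`. -/
def ellipsoid (k : ℕ) (a : ℝ) : Set (AmbientSpace k) :=
  {x | ∃ ψ ∈ Icc 0 Real.pi, ∃ z ∈ Metric.sphere (0 : EuclideanSpace ℝ (Fin k)) 1,
    x = ellipsoidPoint a ψ z}

/-- On `E_a` the map `φ` has the form `(ψ, θ) ↦ (f ψ, χ θ)`, where `f : [0, π] → ℝ` is continuous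
with `f 0 = 0` and `f π = ℓ π` for some integer `ℓ`. -/
def HasProfileForm {k : ℕ} (a : ℝ) (χ : EuclideanSpace ℝ (Fin k) → EuclideanSpace ℝ (Fin k))
    (φ : AmbientSpace k → AmbientSpace k) : Prop :=
  ∃ f : ℝ → ℝ, ContinuousOn f (Icc 0 Real.pi) ∧ f 0 = 0 ∧ (∃ l : ℤ, f Real.pi = l * Real.pi) ∧
    ∀ ψ ∈ Icc 0 Real.pi, ∀ z ∈ Metric.sphere (0 : EuclideanSpace ℝ (Fin k)) 1,
      φ (ellipsoidPoint a ψ z) = ellipsoidPoint a (f ψ) (χ z)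

/-! ### The boundary value problem for `f` -/

/-- `a² sin² t + cos² t`. -/
noncomputable def metricCoeff (a t : ℝ) : ℝ :=
  a ^ 2 * Real.sin t ^ 2 + Real.cos t ^ 2

/-- `f` is a solution on `(0, π)` of the Euler-Lagrange equation of the energy, restricted to the
maps of the form `(ψ, θ) ↦ (f ψ, χ θ)`, with limits `0` at `0` and `ℓ π` at `π` for some
integer `ℓ`. -/
def IsProfileSolution (k d : ℕ) (a : ℝ) (f : ℝ → ℝ) : Prop :=
  ContDiffOn ℝ 2 f (Ioo 0 Real.pi) ∧
  (∀ ψ ∈ Ioo 0 Real.pi,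
    deriv (deriv f) ψ =
      (d : ℝ) * ((d : ℝ) + (k : ℝ) - 2) / 2 * (metricCoeff a ψ / metricCoeff a (f ψ))
          * (Real.sin (2 * f ψ) / Real.sin ψ ^ 2)
        - ((k : ℝ) - 1) * Real.cot ψ * deriv f ψ
        - (a ^ 2 - 1) / 2 * (Real.sin (2 * f ψ) / metricCoeff a (f ψ)) * deriv f ψ ^ 2
        + (a ^ 2 - 1) / 2 * (Real.sin (2 * ψ) / metricCoeff a ψ) * deriv f ψ) ∧
  Tendsto f (𝓝[>] 0) (𝓝 0) ∧
  ∃ l : ℤ, Tendsto f (𝓝[<] Real.pi) (𝓝 (l * Real.pi))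

/-!
In the logarithmic colatitude `x = log (tan (ψ / 2))` the Euler-Lagrange equation is a damped
pendulum equation on the line whose damping changes sign at the equator `x = 0`, and the boundary
value problem asks for the solutions `y` that run from `0` at `-∞` to `l π` at `+∞`
(`IsConnection`). They are finitely many because they form a compact space that is, locally, the intersection of two
analytic curves.

*A priori bounds.* The energy `momentum ^ 2 - lam * sin y ^ 2` is monotone on each hemisphere and
vanishes at both ends, so it is nonpositive; hence a nontrivial solution stays in `(0, π)` or in
`(-π, 0)` (`IsConnection.trichotomy`), and `l` is `-1`, `0` or `1`.

*Uniform decay.* The hypothesis on `a` says that the equation linearized at the equator of the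
target does not oscillate at the poles of the domain (`exists_barrier`). If a solution came too
close to the equator of the target at `x = 0`, its polar angle there, in the coordinates momentum
and height, would be slightly larger than a limit angle `I` of the linearized equation. The same is true
for the solution seen from the other pole; but the two angles add up to a multiple of `π`, and an
interval slightly to the right of `2 I` contains none (`exists_equatorEnergy_ge`). Since solutions
thus keep a distance from the equator, they decay at the poles uniformly (`exists_uniform_small`),
and therefore `y = c exp (d x)` to leading order, with a uniform remainder
(`exists_uniform_asymptotics`). So the set of pairs of leading coefficients at the two poles is
compact (`IsAdmissible.isCompact_leadingPairs`).

*Analyticity.* With `y = ρ ^ d * G` and `ρ = exp x` the singular initial value problem at a pole is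
a Volterra equation that depends holomorphically on `c = G 0`. Its solutions form an analytic
one-parameter family whose data at the equator of the domain trace a curve with a Lipschitz inverse
(`IsAdmissible.exists_analytic_family`). A connection is an intersection of the two curves that come from
the two poles; where intersections accumulate, one curve is locally contained in the other
(`eventually_exists_eq_of_frequently`). An infinite set of leading coefficients would have a largest
accumulation point, and that point would be interior to the set, which is absurd
(`IsAdmissible.finite_leadingCoeffs`, `finite_connections`).

*Harmonic maps.* The meridian through a point and the parallels, corrected to second order, form a
geodesic frame. The component of the tension field along the meridian of the target, computed in
this frame with the help of the energy density of the eigenmap, is the Euler-Lagrange equation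
(`IsHarmonicMap.isProfileSolution`); so the first claim follows from the second.
-/

/-! ### The equation in the logarithmic colatitude -/

/-- The sine of the colatitude `2 arctan (exp x)`. -/
noncomputable def colatSin (x : ℝ) : ℝ := (Real.cosh x)⁻¹

/-- The cosine of the colatitude `2 arctan (exp x)`. -/
noncomputable def colatCos (x : ℝ) : ℝ := -(Real.sinh x / Real.cosh x)

lemma colatSin_pos (x : ℝ) : 0 < colatSin x := inv_pos.2 (Real.cosh_pos x)

lemma colatSin_sq_add_colatCos_sq (x : ℝ) : colatSin x ^ 2 + colatCos x ^ 2 = 1 := by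
  have h := Real.cosh_sq x
  have h0 := (Real.cosh_pos x).ne'
  unfold colatSin colatCos
  field_simp
  linarith

lemma colatSin_neg (x : ℝ) : colatSin (-x) = colatSin x := by simp [colatSin]

lemma colatCos_neg (x : ℝ) : colatCos (-x) = -colatCos x := by
  simp [colatCos, neg_div]

lemma hasDerivAt_colatSin (x : ℝ) : HasDerivAt colatSin (colatSin x * colatCos x) x := by
  have h0 := (Real.cosh_pos x).ne'
  refine ((Real.hasDerivAt_cosh x).inv h0).congr_deriv ?_
  unfold colatSin colatCos
  field_simp

lemma hasDerivAt_colatCos (x : ℝ) : HasDerivAt colatCos (-colatSin x ^ 2) x := by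
  have h0 := (Real.cosh_pos x).ne'
  refine ((Real.hasDerivAt_sinh x).div (Real.hasDerivAt_cosh x) h0).neg.congr_deriv ?_
  have h := Real.cosh_sq x
  unfold colatSin
  field_simp
  linarith

lemma contDiff_colatSin {n : WithTop ℕ∞} : ContDiff ℝ n colatSin :=
  Real.contDiff_cosh.inv fun x => (Real.cosh_pos x).ne'

lemma contDiff_colatCos {n : WithTop ℕ∞} : ContDiff ℝ n colatCos :=
  (Real.contDiff_sinh.div Real.contDiff_cosh fun x => (Real.cosh_pos x).ne').neg

lemma continuous_colatCos : Continuous colatCos := contDiff_colatCos (n := 0).continuous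

lemma colatSin_le_one (x : ℝ) : colatSin x ≤ 1 := inv_le_one_of_one_le₀ (Real.one_le_cosh x)

lemma abs_colatCos_le_one (x : ℝ) : |colatCos x| ≤ 1 := by
  rw [← sq_le_one_iff_abs_le_one]
  nlinarith [colatSin_sq_add_colatCos_sq x, sq_nonneg (colatSin x)]

lemma colatCos_nonneg {x : ℝ} (hx : x ≤ 0) : 0 ≤ colatCos x := by
  unfold colatCos
  have := Real.sinh_nonpos_iff.2 hx
  have := div_nonpos_of_nonpos_of_nonneg this (Real.cosh_pos x).le
  linarith

lemma tendsto_colatSin_atBot : Tendsto colatSin atBot (𝓝 0) := by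
  have h : Tendsto Real.cosh atBot atTop := by
    refine tendsto_atTop_mono (f := fun x => Real.exp (-x) / 2) (fun x => ?_) ?_
    · rw [Real.cosh_eq]
      linarith [Real.exp_pos x]
    · exact (Real.tendsto_exp_atTop.comp tendsto_neg_atBot_atTop).atTop_div_const two_pos
  exact h.inv_tendsto_atTop

/-- The coefficient `a² sin² ψ + cos² ψ` at the colatitude `ψ = 2 arctan (exp x)`. -/
noncomputable def baseCoeff (a x : ℝ) : ℝ := a ^ 2 * colatSin x ^ 2 + colatCos x ^ 2

lemma baseCoeff_pos {a : ℝ} (ha : a ≠ 0) (x : ℝ) : 0 < baseCoeff a x := by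
  have : 0 < a ^ 2 * colatSin x ^ 2 := by have := colatSin_pos x; positivity
  unfold baseCoeff
  nlinarith [sq_nonneg (colatCos x)]

lemma baseCoeff_neg (a x : ℝ) : baseCoeff a (-x) = baseCoeff a x := by
  simp [baseCoeff, colatSin_neg, colatCos_neg]

lemma contDiff_baseCoeff {n : WithTop ℕ∞} (a : ℝ) : ContDiff ℝ n (baseCoeff a) :=
  (contDiff_const.mul (contDiff_colatSin.pow 2)).add (contDiff_colatCos.pow 2)

lemma baseCoeff_le (a x : ℝ) : baseCoeff a x ≤ a ^ 2 + 1 := by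
  have h := colatSin_sq_add_colatCos_sq x
  unfold baseCoeff
  nlinarith [sq_nonneg (colatSin x), sq_nonneg (colatCos x), sq_nonneg a,
    mul_nonneg (sq_nonneg a) (sq_nonneg (colatCos x))]

lemma min_le_baseCoeff (a x : ℝ) : min (a ^ 2) 1 ≤ baseCoeff a x := by
  have h := colatSin_sq_add_colatCos_sq x
  unfold baseCoeff
  nlinarith [sq_nonneg (colatSin x), sq_nonneg (colatCos x), min_le_left (a ^ 2) 1,
    min_le_right (a ^ 2) 1,
    mul_nonneg (sub_nonneg.2 (min_le_left (a ^ 2) 1)) (sq_nonneg (colatSin x)),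
    mul_nonneg (sub_nonneg.2 (min_le_right (a ^ 2) 1)) (sq_nonneg (colatCos x))]

lemma metricCoeff_pos {a : ℝ} (ha : a ≠ 0) (t : ℝ) : 0 < metricCoeff a t := by
  have h := Real.sin_sq_add_cos_sq t
  have h2 : 0 < a ^ 2 := by positivity
  unfold metricCoeff
  rcases eq_or_ne (Real.sin t) 0 with h0 | h0
  · rw [h0] at h ⊢
    nlinarith
  · have : 0 < Real.sin t ^ 2 := by positivity
    nlinarith [sq_nonneg (Real.cos t), mul_pos h2 this]

lemma metricCoeff_le (a t : ℝ) : metricCoeff a t ≤ a ^ 2 + 1 := by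
  have h := Real.sin_sq_add_cos_sq t
  unfold metricCoeff
  nlinarith [sq_nonneg (Real.sin t), sq_nonneg (Real.cos t), sq_nonneg a,
    mul_nonneg (sq_nonneg a) (sq_nonneg (Real.cos t))]

lemma min_le_metricCoeff (a t : ℝ) : min (a ^ 2) 1 ≤ metricCoeff a t := by
  have h := Real.sin_sq_add_cos_sq t
  unfold metricCoeff
  nlinarith [sq_nonneg (Real.sin t), sq_nonneg (Real.cos t), min_le_left (a ^ 2) 1,
    min_le_right (a ^ 2) 1,
    mul_nonneg (sub_nonneg.2 (min_le_left (a ^ 2) 1)) (sq_nonneg (Real.sin t)),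
    mul_nonneg (sub_nonneg.2 (min_le_right (a ^ 2) 1)) (sq_nonneg (Real.cos t))]

lemma contDiff_metricCoeff {n : WithTop ℕ∞} (a : ℝ) : ContDiff ℝ n (metricCoeff a) :=
  (contDiff_const.mul (Real.contDiff_sin.pow 2)).add (Real.contDiff_cos.pow 2)

/-- The second derivative prescribed by the Euler-Lagrange equation, with the colatitude
`2 arctan (exp x)` of the domain as a function of `x`; here `y` is the profile and `p` its
derivative with respect to `x`, `s = k - 2` and `lam = d (d + k - 2)`. -/
noncomputable def profileAccel (s lam a x y p : ℝ) : ℝ :=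
  baseCoeff a x * lam * (Real.sin y * Real.cos y) / metricCoeff a y - s * colatCos x * p
    + (a ^ 2 - 1) * colatSin x ^ 2 * colatCos x / baseCoeff a x * p
    - (a ^ 2 - 1) * (Real.sin y * Real.cos y) / metricCoeff a y * p ^ 2

/-- `y` solves the Euler-Lagrange equation on the whole line, and `p` is its derivative. -/
structure IsTrajectory (s lam a : ℝ) (y p : ℝ → ℝ) : Prop where
  hasDerivAt_fst : ∀ x, HasDerivAt y (p x) x
  hasDerivAt_snd : ∀ x, HasDerivAt p (profileAccel s lam a x (y x) (p x)) x

/-- A solution of the Euler-Lagrange equation that tends to `0` at `-∞` and to `l π` at `+∞`. -/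
structure IsConnection (s lam a : ℝ) (l : ℤ) (y p : ℝ → ℝ) : Prop
    extends IsTrajectory s lam a y p where
  tendsto_atBot : Tendsto y atBot (𝓝 0)
  tendsto_atTop : Tendsto y atTop (𝓝 (l * Real.pi))

/-- The first order system equivalent to the Euler-Lagrange equation. -/
noncomputable def profileField (s lam a x : ℝ) (z : ℝ × ℝ) : ℝ × ℝ :=
  (z.2, profileAccel s lam a x z.1 z.2)

lemma contDiff_profileField {n : WithTop ℕ∞} (s lam : ℝ) {a : ℝ} (ha : a ≠ 0) :
    ContDiff ℝ n fun w : ℝ × ℝ × ℝ => profileField s lam a w.1 w.2 := by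
  unfold profileField profileAccel
  have h1 : ContDiff ℝ n fun w : ℝ × ℝ × ℝ => baseCoeff a w.1 :=
    (contDiff_baseCoeff a).comp contDiff_fst
  have h2 : ContDiff ℝ n fun w : ℝ × ℝ × ℝ => metricCoeff a w.2.1 :=
    (contDiff_metricCoeff a).comp (contDiff_fst.comp contDiff_snd)
  have h3 : ContDiff ℝ n fun w : ℝ × ℝ × ℝ => colatSin w.1 := contDiff_colatSin.comp contDiff_fst
  have h4 : ContDiff ℝ n fun w : ℝ × ℝ × ℝ => colatCos w.1 := contDiff_colatCos.comp contDiff_fst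
  have h5 : ∀ w : ℝ × ℝ × ℝ, baseCoeff a w.1 ≠ 0 := fun w => (baseCoeff_pos ha _).ne'
  have h6 : ∀ w : ℝ × ℝ × ℝ, metricCoeff a w.2.1 ≠ 0 := fun w => (metricCoeff_pos ha _).ne'
  refine (contDiff_snd.comp contDiff_snd).prodMk ?_
  fun_prop (disch := assumption)

/-- Two solutions on a compact interval with the same value at an interior point coincide. -/
lemma profileField_unique {s lam a : ℝ} (ha : a ≠ 0) {f g : ℝ → ℝ × ℝ} {b c t : ℝ}
    (ht : t ∈ Icc b c)
    (hf : ∀ x ∈ Icc b c, HasDerivWithinAt f (profileField s lam a x (f x)) (Icc b c) x)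
    (hg : ∀ x ∈ Icc b c, HasDerivWithinAt g (profileField s lam a x (g x)) (Icc b c) x)
    (h : f t = g t) : EqOn f g (Icc b c) := by
  have hfc : ContinuousOn f (Icc b c) := fun x hx => (hf x hx).continuousWithinAt
  have hgc : ContinuousOn g (Icc b c) := fun x hx => (hg x hx).continuousWithinAt
  obtain ⟨R, hR⟩ := (isCompact_Icc.image_of_continuousOn hfc).isBounded.union
    (isCompact_Icc.image_of_continuousOn hgc).isBounded |>.subset_closedBall 0
  have hconv : Convex ℝ (Icc b c ×ˢ Metric.closedBall (0 : ℝ × ℝ) R) :=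
    (convex_Icc b c).prod (convex_closedBall 0 R)
  obtain ⟨K, hK⟩ := ((contDiff_profileField (n := 1) s lam ha).contDiffOn
    (s := Icc b c ×ˢ Metric.closedBall (0 : ℝ × ℝ) R)).exists_lipschitzOnWith (by simp) hconv
    (isCompact_Icc.prod (isCompact_closedBall _ _))
  have hL : ∀ x ∈ Icc b c, LipschitzOnWith K (profileField s lam a x)
      (Metric.closedBall (0 : ℝ × ℝ) R) := by
    intro x hx u hu v hv
    have := hK (show (x, u) ∈ _ from ⟨hx, hu⟩) (show (x, v) ∈ _ from ⟨hx, hv⟩)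
    simpa [Prod.edist_eq] using this
  have hfs : ∀ x ∈ Icc b c, f x ∈ Metric.closedBall (0 : ℝ × ℝ) R :=
    fun x hx => hR (Or.inl ⟨x, hx, rfl⟩)
  have hgs : ∀ x ∈ Icc b c, g x ∈ Metric.closedBall (0 : ℝ × ℝ) R :=
    fun x hx => hR (Or.inr ⟨x, hx, rfl⟩)
  have hr : EqOn f g (Icc t c) := by
    have hsub : Icc t c ⊆ Icc b c := Icc_subset_Icc_left ht.1
    refine ODE_solution_unique_of_mem_Icc_right (v := profileField s lam a)
      (s := fun _ => Metric.closedBall (0 : ℝ × ℝ) R) (K := K)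
      (fun x hx => hL x (hsub (Ico_subset_Icc_self hx))) (hfc.mono hsub) ?_
      (fun x hx => hfs x (hsub (Ico_subset_Icc_self hx))) (hgc.mono hsub) ?_
      (fun x hx => hgs x (hsub (Ico_subset_Icc_self hx))) h
    · exact fun x hx => (hf x (hsub (Ico_subset_Icc_self hx))).mono_of_mem_nhdsWithin
        (Icc_mem_nhdsGE_of_mem ⟨ht.1.trans hx.1, hx.2⟩)
    · exact fun x hx => (hg x (hsub (Ico_subset_Icc_self hx))).mono_of_mem_nhdsWithin
        (Icc_mem_nhdsGE_of_mem ⟨ht.1.trans hx.1, hx.2⟩)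
  have hl : EqOn f g (Icc b t) := by
    have hsub : Icc b t ⊆ Icc b c := Icc_subset_Icc_right ht.2
    refine ODE_solution_unique_of_mem_Icc_left (v := profileField s lam a)
      (s := fun _ => Metric.closedBall (0 : ℝ × ℝ) R) (K := K)
      (fun x hx => hL x (hsub (Ioc_subset_Icc_self hx))) (hfc.mono hsub) ?_
      (fun x hx => hfs x (hsub (Ioc_subset_Icc_self hx))) (hgc.mono hsub) ?_
      (fun x hx => hgs x (hsub (Ioc_subset_Icc_self hx))) h
    · exact fun x hx => (hf x (hsub (Ioc_subset_Icc_self hx))).mono_of_mem_nhdsWithin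
        (Icc_mem_nhdsLE_of_mem ⟨hx.1, hx.2.trans ht.2⟩)
    · exact fun x hx => (hg x (hsub (Ioc_subset_Icc_self hx))).mono_of_mem_nhdsWithin
        (Icc_mem_nhdsLE_of_mem ⟨hx.1, hx.2.trans ht.2⟩)
  rw [← Icc_union_Icc_eq_Icc ht.1 ht.2]
  exact hl.union hr

namespace IsTrajectory

variable {s lam a : ℝ} {y p y₁ p₁ : ℝ → ℝ}

lemma hasDerivAt_prod (h : IsTrajectory s lam a y p) (x : ℝ) :
    HasDerivAt (fun x => (y x, p x)) (profileField s lam a x (y x, p x)) x :=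
  (h.hasDerivAt_fst x).prodMk (h.hasDerivAt_snd x)

lemma of_hasDerivAt_prod {z : ℝ → ℝ × ℝ} (h : ∀ x, HasDerivAt z (profileField s lam a x (z x)) x) :
    IsTrajectory s lam a (fun x => (z x).1) (fun x => (z x).2) :=
  ⟨fun x => (hasFDerivAt_fst.comp_hasDerivAt x (h x) :),
    fun x => (hasFDerivAt_snd.comp_hasDerivAt x (h x) :)⟩

lemma continuous_fst (h : IsTrajectory s lam a y p) : Continuous y :=
  continuous_iff_continuousAt.2 fun x => (h.hasDerivAt_fst x).continuousAt

lemma continuous_snd (h : IsTrajectory s lam a y p) : Continuous p :=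
  continuous_iff_continuousAt.2 fun x => (h.hasDerivAt_snd x).continuousAt

lemma eq_of_eq_at (ha : a ≠ 0) (h : IsTrajectory s lam a y p) (h₁ : IsTrajectory s lam a y₁ p₁)
    {t : ℝ} (hy : y t = y₁ t) (hp : p t = p₁ t) : y = y₁ := by
  ext x
  have := profileField_unique ha (f := fun x => (y x, p x)) (g := fun x => (y₁ x, p₁ x))
    (b := min t x) (c := max t x) (t := t) ⟨min_le_left _ _, le_max_left _ _⟩
    (fun u _ => (h.hasDerivAt_prod u).hasDerivWithinAt)
    (fun u _ => (h₁.hasDerivAt_prod u).hasDerivWithinAt) (by simp [hy, hp])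
    ⟨min_le_right t x, le_max_right t x⟩
  exact congrArg Prod.fst this

end IsTrajectory

lemma sin_mul_cos_sub_int_mul_pi (t : ℝ) (l : ℤ) :
    Real.sin (t - l * Real.pi) * Real.cos (t - l * Real.pi) = Real.sin t * Real.cos t := by
  have h1 := Real.sin_two_mul (t - l * Real.pi)
  have h2 := Real.sin_two_mul t
  have h3 : Real.sin (2 * (t - l * Real.pi)) = Real.sin (2 * t) := by
    rw [show 2 * (t - l * Real.pi) = 2 * t - l * (2 * Real.pi) by ring,
      Real.sin_sub_int_mul_two_pi]
  linarith

lemma sin_sq_sub_int_mul_pi (t : ℝ) (l : ℤ) :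
    Real.sin (t - l * Real.pi) ^ 2 = Real.sin t ^ 2 := by
  rw [Real.sin_sq_eq_half_sub, Real.sin_sq_eq_half_sub,
    show 2 * (t - l * Real.pi) = 2 * t - l * (2 * Real.pi) by ring, Real.cos_sub_int_mul_two_pi]

lemma metricCoeff_sub_int_mul_pi (a t : ℝ) (l : ℤ) :
    metricCoeff a (t - l * Real.pi) = metricCoeff a t := by
  unfold metricCoeff
  rw [Real.cos_sq', Real.cos_sq', sin_sq_sub_int_mul_pi]

lemma profileAccel_reflect (s lam a x y p : ℝ) (l : ℤ) :
    profileAccel s lam a (-x) (y - l * Real.pi) (-p) = profileAccel s lam a x y p := by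
  unfold profileAccel
  rw [baseCoeff_neg, colatSin_neg, colatCos_neg, metricCoeff_sub_int_mul_pi,
    sin_mul_cos_sub_int_mul_pi]
  ring

lemma metricCoeff_neg (a t : ℝ) : metricCoeff a (-t) = metricCoeff a t := by simp [metricCoeff]

namespace IsConnection

variable {s lam a : ℝ} {l : ℤ} {y p : ℝ → ℝ}

/-- Reflection in the equator of the domain and a deck transformation of the target. -/
lemma reflect (h : IsConnection s lam a l y p) :
    IsConnection s lam a (-l) (fun x => y (-x) - l * Real.pi) (fun x => -p (-x)) where
  hasDerivAt_fst x := by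
    simpa using ((h.hasDerivAt_fst (-x)).comp x (hasDerivAt_neg x)).sub_const (l * Real.pi)
  hasDerivAt_snd x := by
    have := ((h.hasDerivAt_snd (-x)).comp x (hasDerivAt_neg x)).neg
    refine this.congr_deriv ?_
    rw [← profileAccel_reflect s lam a (-x) (y (-x)) (p (-x)) l]
    simp
  tendsto_atBot := by
    simpa using (h.tendsto_atTop.comp tendsto_neg_atBot_atTop).sub_const (l * Real.pi)
  tendsto_atTop := by
    simpa using (h.tendsto_atBot.comp tendsto_neg_atTop_atBot).sub_const (l * Real.pi)

lemma neg (h : IsConnection s lam a l y p) :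
    IsConnection s lam a (-l) (fun x => -y x) (fun x => -p x) where
  hasDerivAt_fst x := (h.hasDerivAt_fst x).neg
  hasDerivAt_snd x := by
    refine (h.hasDerivAt_snd x).neg.congr_deriv ?_
    simp only [profileAccel, metricCoeff_neg, Real.sin_neg, Real.cos_neg]
    ring
  tendsto_atBot := by simpa using h.tendsto_atBot.neg
  tendsto_atTop := by simpa using h.tendsto_atTop.neg

end IsConnection

/-! ### The momentum and the energy of a solution -/

/-- The derivative of the arc length of the target along the profile, divided by the arc length
element of the domain at colatitude `2 arctan (exp x)` relative to `dx`. -/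
noncomputable def momentum (a : ℝ) (y p : ℝ → ℝ) (x : ℝ) : ℝ :=
  √(metricCoeff a (y x)) * p x / √(baseCoeff a x)

lemma hasDerivAt_sqrt_baseCoeff {a : ℝ} (ha : a ≠ 0) (x : ℝ) :
    HasDerivAt (fun x => √(baseCoeff a x))
      ((a ^ 2 - 1) * colatSin x ^ 2 * colatCos x / √(baseCoeff a x)) x := by
  have hm := baseCoeff_pos ha x
  have h : HasDerivAt (baseCoeff a) (2 * ((a ^ 2 - 1) * colatSin x ^ 2 * colatCos x)) x := by
    refine ((((hasDerivAt_colatSin x).pow 2).const_mul (a ^ 2)).add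
      ((hasDerivAt_colatCos x).pow 2)).congr_deriv ?_
    push_cast
    ring
  refine (h.sqrt hm.ne').congr_deriv ?_
  field_simp

lemma hasDerivAt_metricCoeff (a t : ℝ) :
    HasDerivAt (metricCoeff a) (2 * ((a ^ 2 - 1) * (Real.sin t * Real.cos t))) t := by
  refine ((((Real.hasDerivAt_sin t).pow 2).const_mul (a ^ 2)).add
    ((Real.hasDerivAt_cos t).pow 2)).congr_deriv ?_
  push_cast
  ring

lemma hasDerivAt_sqrt_metricCoeff {a : ℝ} (ha : a ≠ 0) (t : ℝ) :
    HasDerivAt (fun t => √(metricCoeff a t))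
      ((a ^ 2 - 1) * (Real.sin t * Real.cos t) / √(metricCoeff a t)) t := by
  refine ((hasDerivAt_metricCoeff a t).sqrt (metricCoeff_pos ha t).ne').congr_deriv ?_
  field_simp

lemma momentum_sq {a : ℝ} (ha : a ≠ 0) (y p : ℝ → ℝ) (x : ℝ) :
    momentum a y p x ^ 2 = metricCoeff a (y x) * p x ^ 2 / baseCoeff a x := by
  rw [momentum, div_pow, mul_pow, Real.sq_sqrt (metricCoeff_pos ha _).le,
    Real.sq_sqrt (baseCoeff_pos ha _).le]

lemma vel_eq_momentum {a : ℝ} (ha : a ≠ 0) (y p : ℝ → ℝ) (x : ℝ) :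
    p x = √(baseCoeff a x) * momentum a y p x / √(metricCoeff a (y x)) := by
  have h1 := (Real.sqrt_pos.2 (baseCoeff_pos ha x)).ne'
  have h2 := (Real.sqrt_pos.2 (metricCoeff_pos ha (y x))).ne'
  unfold momentum
  field_simp

namespace IsTrajectory

variable {s lam a : ℝ} {y p : ℝ → ℝ}

lemma hasDerivAt_momentum (ha : a ≠ 0) (h : IsTrajectory s lam a y p) (x : ℝ) :
    HasDerivAt (momentum a y p)
      (-(s * colatCos x) * momentum a y p x + √(baseCoeff a x) *
        (lam * (Real.sin (y x) * Real.cos (y x)) / √(metricCoeff a (y x)))) x := by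
  have h1 := Real.sqrt_pos.2 (baseCoeff_pos ha x)
  have h2 := Real.sqrt_pos.2 (metricCoeff_pos ha (y x))
  have h3 := Real.sq_sqrt (baseCoeff_pos ha x).le
  have h4 := Real.sq_sqrt (metricCoeff_pos ha (y x)).le
  have hM := (hasDerivAt_sqrt_metricCoeff ha (y x)).comp x (h.hasDerivAt_fst x)
  refine ((hM.mul (h.hasDerivAt_snd x)).div (hasDerivAt_sqrt_baseCoeff ha x) h1.ne').congr_deriv ?_
  simp only [momentum, profileAccel, Function.comp_apply, Pi.mul_apply]
  rw [← h3, ← h4]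
  generalize √(baseCoeff a x) = n at *
  generalize √(metricCoeff a (y x)) = g at *
  rw [Real.sqrt_sq h1.le, Real.sqrt_sq h2.le]
  field_simp
  ring

lemma hasDerivAt_energy (ha : a ≠ 0) (h : IsTrajectory s lam a y p) (x : ℝ) :
    HasDerivAt (fun x => momentum a y p x ^ 2 - lam * Real.sin (y x) ^ 2)
      (-(2 * s * colatCos x) * momentum a y p x ^ 2) x := by
  have h1 := ((h.hasDerivAt_fst x).sin.pow 2).const_mul lam
  refine (((h.hasDerivAt_momentum ha x).pow 2).sub h1).congr_deriv ?_
  rw [vel_eq_momentum ha y p x]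
  have h2 := (Real.sqrt_pos.2 (metricCoeff_pos ha (y x))).ne'
  push_cast
  field_simp
  ring

lemma energy_antitoneOn (ha : a ≠ 0) (hs : 0 ≤ s) (h : IsTrajectory s lam a y p) :
    AntitoneOn (fun x => momentum a y p x ^ 2 - lam * Real.sin (y x) ^ 2) (Iic 0) := by
  refine antitoneOn_of_hasDerivWithinAt_nonpos (convex_Iic 0)
    (fun x _ => (h.hasDerivAt_energy ha x).continuousAt.continuousWithinAt)
    (fun x _ => (h.hasDerivAt_energy ha x).hasDerivWithinAt) fun x hx => ?_
  rw [interior_Iic] at hx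
  have := colatCos_nonneg (le_of_lt hx)
  have := mul_nonneg (mul_nonneg hs this) (sq_nonneg (momentum a y p x))
  linarith

end IsTrajectory

/-- A function with a limit at `-∞` cannot have a derivative that stays away from zero. -/
lemma not_tendsto_of_sq_le_sq_deriv {y p : ℝ → ℝ} {b c : ℝ} {L : ℝ}
    (hy : ∀ x, HasDerivAt y (p x) x) (hp : Continuous p) (hb : Tendsto y atBot (𝓝 L))
    (hc : 0 < c) (h : ∀ x ≤ b, c ≤ p x ^ 2) : False := by
  wlog hpos : 0 < p b generalizing y p L
  · refine this (y := fun x => -y x) (p := fun x => -p x) (fun x => (hy x).neg) hp.neg hb.neg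
      (by simpa using h) ?_
    have h1 := h b le_rfl
    have h2 : p b ≠ 0 := fun h0 => by rw [h0] at h1; linarith
    have := lt_of_le_of_ne (not_lt.1 hpos) h2
    simpa using this
  have hp' : ∀ x ≤ b, √c ≤ p x := by
    intro x hx
    have hx0 : 0 ≤ p x := by
      by_contra hneg
      obtain ⟨u, hu, hu0⟩ := intermediate_value_Icc hx hp.continuousOn
        (show (0 : ℝ) ∈ Icc (p x) (p b) from ⟨(not_le.1 hneg).le, hpos.le⟩)
      have := h u hu.2
      rw [hu0] at this
      linarith
    exact Real.sqrt_le_iff.2 ⟨hx0, h x hx⟩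
  have hmono : MonotoneOn (fun x => y x - √c * x) (Iic b) := by
    have hd : ∀ x, HasDerivAt (fun x => y x - √c * x) (p x - √c) x := fun x =>
      ((hy x).sub ((hasDerivAt_id x).const_mul √c)).congr_deriv (by simp)
    refine monotoneOn_of_hasDerivWithinAt_nonneg (convex_Iic b)
      (fun x _ => (hd x).continuousAt.continuousWithinAt)
      (fun x _ => (hd x).hasDerivWithinAt) fun x hx => ?_
    rw [interior_Iic] at hx
    linarith [hp' x (le_of_lt hx)]
  have hlim : Tendsto (fun x => y b - √c * b + √c * x) atBot atBot :=
    tendsto_atBot_add_const_left _ _ (tendsto_id.const_mul_atBot (Real.sqrt_pos.2 hc))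
  have hle : ∀ᶠ x in atBot, y x ≤ y b - √c * b + √c * x := by
    filter_upwards [eventually_le_atBot b] with x hx
    have := hmono hx (le_refl b) hx
    simp only at this
    linarith
  exact not_tendsto_nhds_of_tendsto_atBot (tendsto_atBot_mono' _ hle hlim) L hb

namespace IsConnection

variable {s lam a : ℝ} {l : ℤ} {y p : ℝ → ℝ}

lemma momentum_sq_le_of_nonpos (ha : a ≠ 0) (hs : 0 ≤ s) (hlam : 0 ≤ lam)
    (h : IsConnection s lam a l y p) {x : ℝ} (hx : x ≤ 0) :
    momentum a y p x ^ 2 ≤ lam * Real.sin (y x) ^ 2 := by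
  by_contra! hlt
  set e := momentum a y p x ^ 2 - lam * Real.sin (y x) ^ 2 with he
  have he0 : 0 < e := by linarith
  have hmin : 0 < min (a ^ 2) 1 := lt_min (by positivity) one_pos
  have hmax : 0 < a ^ 2 + 1 := by positivity
  refine not_tendsto_of_sq_le_sq_deriv (b := x) (c := e * min (a ^ 2) 1 / (a ^ 2 + 1))
    h.hasDerivAt_fst h.continuous_snd h.tendsto_atBot (by positivity) fun u hu => ?_
  have h1 := h.energy_antitoneOn ha hs (hu.trans hx : u ∈ Iic 0) hx hu
  simp only at h1
  have h2 : e ≤ momentum a y p u ^ 2 := by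
    nlinarith [mul_nonneg hlam (sq_nonneg (Real.sin (y u)))]
  rw [momentum_sq ha, le_div_iff₀ (baseCoeff_pos ha u)] at h2
  rw [div_le_iff₀ hmax]
  calc e * min (a ^ 2) 1 ≤ e * baseCoeff a u := by gcongr; exact min_le_baseCoeff a u
    _ ≤ metricCoeff a (y u) * p u ^ 2 := h2
    _ ≤ (a ^ 2 + 1) * p u ^ 2 := by gcongr; exact metricCoeff_le a _
    _ = p u ^ 2 * (a ^ 2 + 1) := by ring

lemma momentum_reflect (l : ℤ) (x : ℝ) :
    momentum a (fun x => y (-x) - l * Real.pi) (fun x => -p (-x)) x = -momentum a y p (-x) := by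
  simp only [momentum, metricCoeff_sub_int_mul_pi, baseCoeff_neg]
  ring

/-- The energy is nonpositive: it is monotone on both hemispheres and vanishes in both limits. -/
lemma momentum_sq_le (ha : a ≠ 0) (hs : 0 ≤ s) (hlam : 0 ≤ lam)
    (h : IsConnection s lam a l y p) (x : ℝ) :
    momentum a y p x ^ 2 ≤ lam * Real.sin (y x) ^ 2 := by
  rcases le_total x 0 with hx | hx
  · exact h.momentum_sq_le_of_nonpos ha hs hlam hx
  · have := h.reflect.momentum_sq_le_of_nonpos ha hs hlam (neg_nonpos.2 hx)
    rw [momentum_reflect, sin_sq_sub_int_mul_pi] at this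
    simpa using this

lemma vel_sq_le (ha : a ≠ 0) (hs : 0 ≤ s) (hlam : 0 ≤ lam)
    (h : IsConnection s lam a l y p) (x : ℝ) :
    p x ^ 2 ≤ (a ^ 2 + 1) / min (a ^ 2) 1 * lam * Real.sin (y x) ^ 2 := by
  have h1 := h.momentum_sq_le ha hs hlam x
  have hmin : 0 < min (a ^ 2) 1 := lt_min (by positivity) one_pos
  rw [momentum_sq ha, div_le_iff₀ (baseCoeff_pos ha x)] at h1
  have h2 : min (a ^ 2) 1 * p x ^ 2 ≤ metricCoeff a (y x) * p x ^ 2 := by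
    gcongr; exact min_le_metricCoeff a _
  have h3 : lam * Real.sin (y x) ^ 2 * baseCoeff a x ≤ lam * Real.sin (y x) ^ 2 * (a ^ 2 + 1) := by
    gcongr; exact baseCoeff_le a x
  rw [div_mul_eq_mul_div, div_mul_eq_mul_div, le_div_iff₀ hmin]
  linarith

lemma eq_zero_of_sin_eq_zero (ha : a ≠ 0) (hs : 0 ≤ s) (hlam : 0 ≤ lam)
    (h : IsConnection s lam a l y p) {x : ℝ} (hx : Real.sin (y x) = 0) : y = 0 := by
  have hp : p x = 0 := by
    have := h.vel_sq_le ha hs hlam x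
    rw [hx] at this
    exact pow_eq_zero_iff two_ne_zero |>.1 (le_antisymm (by simpa using this) (sq_nonneg _))
  have hconst : IsTrajectory s lam a (fun _ => y x) (fun _ => 0) :=
    ⟨fun _ => hasDerivAt_const _ _, fun u => by
      simpa [profileAccel, hx] using hasDerivAt_const u (0 : ℝ)⟩
  have heq : y = fun _ => y x := h.eq_of_eq_at ha hconst rfl hp
  have h0 : y x = 0 := by
    have h1 := h.tendsto_atBot
    rw [heq] at h1
    exact tendsto_nhds_unique tendsto_const_nhds h1
  rw [heq, h0]
  rfl

lemma eq_zero_of_eigenvalue_eq_zero (ha : a ≠ 0) (hs : 0 ≤ s)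
    (h : IsConnection s 0 a l y p) : y = 0 := by
  have hp : ∀ x, p x = 0 := fun x => by
    have := h.vel_sq_le ha hs le_rfl x
    exact pow_eq_zero_iff two_ne_zero |>.1 (le_antisymm (by simpa using this) (sq_nonneg _))
  have heq : y = fun _ => y 0 := funext fun x => is_const_of_deriv_eq_zero
    (fun x => (h.hasDerivAt_fst x).differentiableAt)
    (fun x => by rw [(h.hasDerivAt_fst x).deriv, hp]) x 0
  have h1 := h.tendsto_atBot
  rw [heq] at h1
  rw [heq, tendsto_nhds_unique tendsto_const_nhds h1]
  rfl

/-- A nontrivial solution never meets a pole of the target. -/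
lemma trichotomy (ha : a ≠ 0) (hs : 0 ≤ s) (hlam : 0 ≤ lam) (h : IsConnection s lam a l y p) :
    y = 0 ∨ (∀ x, y x ∈ Ioo 0 Real.pi) ∨ ∀ x, -y x ∈ Ioo 0 Real.pi := by
  by_cases h0 : y = 0
  · exact Or.inl h0
  have hsin : ∀ x, Real.sin (y x) ≠ 0 := fun x hx => h0 (h.eq_zero_of_sin_eq_zero ha hs hlam hx)
  have hconn : (range y).OrdConnected :=
    (isPreconnected_range h.continuous_fst).ordConnected
  have hmiss : ∀ t, Real.sin t = 0 → ∀ u v, y u ≤ t → t ≤ y v → False := by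
    intro t ht u v hu hv
    obtain ⟨w, hw⟩ := hconn.out (mem_range_self u) (mem_range_self v) ⟨hu, hv⟩
    exact hsin w (by rw [hw, ht])
  obtain ⟨x₀, hx₀⟩ := (h.tendsto_atBot.eventually (Metric.ball_mem_nhds 0 one_pos)).exists
  rw [Real.dist_eq, sub_zero, abs_lt] at hx₀
  have hpi := Real.pi_gt_three
  right
  rcases le_total (y x₀) 0 with hneg | hpos
  · right
    refine fun x => ⟨?_, ?_⟩
    · by_contra hc
      exact hmiss 0 Real.sin_zero x₀ x hneg (by linarith)
    · by_contra hc
      exact hmiss (-Real.pi) (by simp) x x₀ (by linarith) (by linarith [hx₀.1])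
  · left
    refine fun x => ⟨?_, ?_⟩
    · by_contra hc
      exact hmiss 0 Real.sin_zero x x₀ (by linarith) hpos
    · by_contra hc
      exact hmiss Real.pi Real.sin_pi x₀ x (by linarith [hx₀.2]) (by linarith)

end IsConnection

/-! ### Comparison of Prüfer angles -/

/-- The derivative of the polar angle of a solution of `v' = R q`, `q' = -γ q - R v`. -/
noncomputable def angleField (γ R : ℝ → ℝ) (x θ : ℝ) : ℝ :=
  -γ x * (Real.sin θ * Real.cos θ) - R x

/-- `θ` is an angle function on `[X, T]` for the system `v' = R q`, `q' = -γ q - R v`. -/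
def IsAngle (γ R : ℝ → ℝ) (X T : ℝ) (θ : ℝ → ℝ) : Prop :=
  ∀ x ∈ Icc X T, HasDerivWithinAt θ (angleField γ R x (θ x)) (Icc X T) x

lemma abs_sin_mul_cos_sub_le (t u : ℝ) :
    |Real.sin t * Real.cos t - Real.sin u * Real.cos u| ≤ |t - u| := by
  have h : ∀ r, HasDerivAt (fun r => Real.sin r * Real.cos r) (Real.cos (2 * r)) r := fun r => by
    refine ((Real.hasDerivAt_sin r).mul (Real.hasDerivAt_cos r)).congr_deriv ?_
    rw [Real.cos_two_mul']
    ring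
  have := convex_univ.norm_image_sub_le_of_norm_hasDerivWithin_le (C := 1)
    (fun r _ => (h r).hasDerivWithinAt) (fun r _ => by simpa using Real.abs_cos_le_one _)
    (mem_univ u) (mem_univ t)
  simpa using this

lemma IsAngle.mono {γ R θ : ℝ → ℝ} {X T X' : ℝ} (h : IsAngle γ R X T θ) (hX : X ≤ X') :
    IsAngle γ R X' T θ :=
  fun x hx => (h x ⟨hX.trans hx.1, hx.2⟩).mono (Icc_subset_Icc_left hX)

lemma exists_isAngle {γ R : ℝ → ℝ} (hγ : Continuous γ) (hR : Continuous R) {X T : ℝ} (hXT : X ≤ T)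
    (θ₀ : ℝ) : ∃ θ, θ X = θ₀ ∧ IsAngle γ R X T θ := by
  obtain ⟨b, hb⟩ := isCompact_Icc.exists_bound_of_continuousOn
    (s := Icc X T) (f := fun x => |γ x| + |R x|) (by fun_prop)
  have hb0 : 0 ≤ b := (norm_nonneg _).trans (hb X ⟨le_rfl, hXT⟩)
  have hb' : ∀ x ∈ Icc X T, |γ x| + |R x| ≤ b := fun x hx => (le_abs_self _).trans (hb x hx)
  lift b to NNReal using hb0
  have hPL : IsPicardLindelof (angleField γ R) (⟨X, le_rfl, hXT⟩ : Icc X T) θ₀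
      (b * (T - X).toNNReal) 0 b b := by
    refine ⟨fun x hx => ?_, fun θ _ => ?_, fun x hx θ _ => ?_, ?_⟩
    · refine (LipschitzWith.of_dist_le_mul fun t u => ?_).lipschitzOnWith
      rw [Real.dist_eq, Real.dist_eq, angleField, angleField,
        show -γ x * (Real.sin t * Real.cos t) - R x - (-γ x * (Real.sin u * Real.cos u) - R x)
          = -γ x * (Real.sin t * Real.cos t - Real.sin u * Real.cos u) by ring, abs_mul, abs_neg]
      exact mul_le_mul (show |γ x| ≤ b by linarith [hb' x hx, abs_nonneg (R x)])
        (abs_sin_mul_cos_sub_le t u) (abs_nonneg _) b.2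
    · unfold angleField
      fun_prop
    · have h1 : |Real.sin θ * Real.cos θ| ≤ 1 := by
        rw [abs_mul]
        exact mul_le_one₀ (Real.abs_sin_le_one _) (abs_nonneg _) (Real.abs_cos_le_one _)
      calc ‖angleField γ R x θ‖ ≤ |-γ x * (Real.sin θ * Real.cos θ)| + |R x| := abs_sub _ _
        _ ≤ |γ x| + |R x| := by
          rw [abs_mul, abs_neg]
          gcongr
          exact mul_le_of_le_one_right (abs_nonneg _) h1
        _ ≤ b := hb' x hx
    · simp [hXT]
  obtain ⟨θ, h1, h2⟩ := hPL.exists_eq_forall_mem_Icc_hasDerivWithinAt₀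
  exact ⟨θ, h1, h2⟩

/-- A function that starts positive and decreases at most exponentially stays positive. -/
lemma pos_of_neg_mul_abs_le_deriv {D D' : ℝ → ℝ} {X T K : ℝ}
    (hD : ∀ x ∈ Icc X T, HasDerivWithinAt D (D' x) (Icc X T) x)
    (hb : ∀ x ∈ Icc X T, -(K * |D x|) ≤ D' x) (h0 : 0 < D X) :
    ∀ x ∈ Icc X T, 0 < D x := by
  have hB : ∀ x, HasDerivAt (fun x => -(D X / 2 * Real.exp (-(K + 1) * (x - X))))
      ((K + 1) * (D X / 2 * Real.exp (-(K + 1) * (x - X)))) x := fun x => by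
    refine (((((hasDerivAt_id x).sub_const X).const_mul (-(K + 1))).exp).const_mul
      (D X / 2)).neg.congr_deriv ?_
    simp only [id]
    ring
  have key := image_le_of_deriv_right_lt_deriv_boundary' (f := fun x => -D x) (f' := fun x => -D' x)
    (a := X) (b := T) (B := fun x => -(D X / 2 * Real.exp (-(K + 1) * (x - X))))
    (B' := fun x => (K + 1) * (D X / 2 * Real.exp (-(K + 1) * (x - X))))
    (fun x hx => (hD x hx).neg.continuousWithinAt)
    (fun x hx => ((hD x (Ico_subset_Icc_self hx)).mono_of_mem_nhdsWithin
      (Icc_mem_nhdsGE_of_mem hx)).neg) (by simp; linarith)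
    (fun x _ => (hB x).continuousAt.continuousWithinAt) (fun x _ => (hB x).hasDerivWithinAt)
    (fun x hx hc => by
      have h1 := hb x (Ico_subset_Icc_self hx)
      have h2 : 0 < D X / 2 * Real.exp (-(K + 1) * (x - X)) := by positivity
      have h3 : D x = D X / 2 * Real.exp (-(K + 1) * (x - X)) := neg_inj.1 hc
      rw [h3, abs_of_pos h2] at h1
      linarith)
  intro x hx
  have h1 := key hx
  have h2 : 0 < D X / 2 * Real.exp (-(K + 1) * (x - X)) := by positivity
  linarith

/-- Strict comparison of a subsolution and a supersolution of the angle equation. -/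
lemma lt_of_angle_comparison {γ R φ φ' u u' : ℝ → ℝ} {X T K : ℝ}
    (hγ : ∀ x ∈ Icc X T, |γ x| ≤ K)
    (hφ : ∀ x ∈ Icc X T, HasDerivWithinAt φ (φ' x) (Icc X T) x)
    (hu : ∀ x ∈ Icc X T, HasDerivWithinAt u (u' x) (Icc X T) x)
    (hφ' : ∀ x ∈ Icc X T, φ' x ≤ angleField γ R x (φ x))
    (hu' : ∀ x ∈ Icc X T, angleField γ R x (u x) ≤ u' x) (h0 : φ X < u X) :
    ∀ x ∈ Icc X T, φ x < u x := by
  intro x hx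
  refine sub_pos.1 (pos_of_neg_mul_abs_le_deriv (D := fun x => u x - φ x) (K := K)
    (fun x hx => (hu x hx).sub (hφ x hx)) (fun x hx => ?_) (sub_pos.2 h0) x hx)
  have h1 := abs_sin_mul_cos_sub_le (u x) (φ x)
  have h2 : |γ x * (Real.sin (u x) * Real.cos (u x) - Real.sin (φ x) * Real.cos (φ x))|
      ≤ K * |u x - φ x| := by
    rw [abs_mul]
    exact mul_le_mul (hγ x hx) h1 (abs_nonneg _) ((abs_nonneg _).trans (hγ x hx))
  have h3 := hφ' x hx
  have h4 := hu' x hx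
  unfold angleField at h3 h4
  have := (abs_le.1 h2).2
  linarith

/-- Lowering the rotation rate by at most `ε` raises the angle by at most a multiple of `ε`. -/
lemma IsAngle.le_add_of_rate_close {γ R R₀ θ φ : ℝ → ℝ} {X T K ε : ℝ} (hε : 0 < ε)
    (hγ : ∀ x ∈ Icc X T, |γ x| ≤ K) (hR : ∀ x ∈ Icc X T, R₀ x - ε ≤ R x)
    (hθ : IsAngle γ R X T θ) (hφ : IsAngle γ R₀ X T φ) (h0 : θ X ≤ φ X) :
    ∀ x ∈ Icc X T, θ x ≤ φ x + 2 * ε * Real.exp ((K + 1) * (x - X)) := by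
  have hB : ∀ x, HasDerivAt (fun x => 2 * ε * Real.exp ((K + 1) * (x - X)))
      ((K + 1) * (2 * ε * Real.exp ((K + 1) * (x - X)))) x := fun x => by
    refine (((((hasDerivAt_id x).sub_const X).const_mul (K + 1)).exp).const_mul
      (2 * ε)).congr_deriv ?_
    simp only [id]
    ring
  have hd : ∀ x ∈ Icc X T, HasDerivWithinAt (fun x => θ x - φ x)
      (angleField γ R x (θ x) - angleField γ R₀ x (φ x)) (Icc X T) x :=
    fun x hx => (hθ x hx).sub (hφ x hx)
  have key := image_le_of_deriv_right_lt_deriv_boundary' (f := fun x => θ x - φ x)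
    (f' := fun x => angleField γ R x (θ x) - angleField γ R₀ x (φ x))
    (a := X) (b := T) (B := fun x => 2 * ε * Real.exp ((K + 1) * (x - X)))
    (B' := fun x => (K + 1) * (2 * ε * Real.exp ((K + 1) * (x - X))))
    (fun x hx => (hd x hx).continuousWithinAt)
    (fun x hx => (hd x (Ico_subset_Icc_self hx)).mono_of_mem_nhdsWithin
      (Icc_mem_nhdsGE_of_mem hx)) (by simp; linarith)
    (fun x _ => (hB x).continuousAt.continuousWithinAt) (fun x _ => (hB x).hasDerivWithinAt)
    (fun x hx hc => by
      have hx' := Ico_subset_Icc_self hx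
      have hK : 0 ≤ K := (abs_nonneg _).trans (hγ x hx')
      have h1 := abs_sin_mul_cos_sub_le (θ x) (φ x)
      have h2 : |γ x * (Real.sin (θ x) * Real.cos (θ x) - Real.sin (φ x) * Real.cos (φ x))|
          ≤ K * |θ x - φ x| := by
        rw [abs_mul]
        exact mul_le_mul (hγ x hx') h1 (abs_nonneg _) hK
      have h3 := hR x hx'
      have h4 : 1 ≤ Real.exp ((K + 1) * (x - X)) :=
        Real.one_le_exp (mul_nonneg (by linarith) (sub_nonneg.2 hx.1))
      have h5 : 0 < 2 * ε * Real.exp ((K + 1) * (x - X)) := by positivity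
      rw [hc, abs_of_pos h5] at h2
      have h6 := (abs_le.1 h2).1
      unfold angleField
      nlinarith)
  intro x hx
  have := key hx
  linarith

/-- A solution of `v' = R q`, `q' = -γ q - R v` that starts in the direction given by an angle
function keeps that direction. -/
lemma IsAngle.mul_cos_eq_mul_sin {γ R θ v q : ℝ → ℝ} {X T K : ℝ}
    (hγ : ∀ x ∈ Icc X T, |γ x| ≤ K) (hθ : IsAngle γ R X T θ)
    (hv : ∀ x, HasDerivAt v (R x * q x) x)
    (hq : ∀ x, HasDerivAt q (-γ x * q x - R x * v x) x)
    (h0 : q X * Real.cos (θ X) = v X * Real.sin (θ X)) :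
    ∀ x ∈ Icc X T, q x * Real.cos (θ x) = v x * Real.sin (θ x) := by
  have hd : ∀ x ∈ Icc X T, HasDerivWithinAt
      (fun x => q x * Real.cos (θ x) - v x * Real.sin (θ x))
      (-γ x * Real.cos (θ x) ^ 2 * (q x * Real.cos (θ x) - v x * Real.sin (θ x))) (Icc X T) x := by
    intro x hx
    refine (((hq x).hasDerivWithinAt.mul (hθ x hx).cos).sub
      ((hv x).hasDerivWithinAt.mul (hθ x hx).sin)).congr_deriv ?_
    have h := Real.sin_sq_add_cos_sq (θ x)
    have h' : Real.sin (θ x) ^ 2 = 1 - Real.cos (θ x) ^ 2 := by linarith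
    unfold angleField
    ring_nf
    rw [h']
    ring
  have key := eq_zero_of_abs_deriv_le_mul_abs_self_of_eq_zero_right (K := K)
    (fun x hx => (hd x hx).continuousWithinAt)
    (fun x hx => (hd x (Ico_subset_Icc_self hx)).mono_of_mem_nhdsWithin
      (Icc_mem_nhdsGE_of_mem hx)) (sub_eq_zero.2 h0) (fun x hx => by
        rw [norm_mul]
        refine mul_le_mul_of_nonneg_right ?_ (norm_nonneg _)
        rw [norm_mul, norm_neg, Real.norm_eq_abs, Real.norm_eq_abs,
          abs_of_nonneg (sq_nonneg (Real.cos (θ x)))]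
        exact (mul_le_of_le_one_right (abs_nonneg _) (Real.cos_sq_le_one _)).trans
          (hγ x (Ico_subset_Icc_self hx)))
  exact fun x hx => sub_eq_zero.1 (key x hx)

/-! ### Solutions near the equator of the target -/

/-- The frequency `√lam / a` of the equation linearised at the equator of the target. -/
noncomputable def equatorRate (lam a x : ℝ) : ℝ := √lam / a * √(baseCoeff a x)

/-- The factor by which the nonlinear rotation rate is smaller than the linear one. -/
noncomputable def rateFactor (a t : ℝ) : ℝ := a * Real.sin t / √(metricCoeff a t)

/-- The height coordinate of the target, scaled such that it forms a system of the shape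
`v' = R q`, `q' = -γ q - R v` with the momentum. -/
noncomputable def height (lam : ℝ) (y : ℝ → ℝ) (x : ℝ) : ℝ := -√lam * Real.cos (y x)

section Rates

variable {s lam a : ℝ} {y p : ℝ → ℝ}

lemma continuous_equatorRate (lam a : ℝ) : Continuous (equatorRate lam a) :=
  continuous_const.mul (contDiff_baseCoeff (n := 0) a).continuous.sqrt

lemma equatorRate_pos (ha : 0 < a) (hlam : 0 < lam) (x : ℝ) : 0 < equatorRate lam a x :=
  mul_pos (div_pos (Real.sqrt_pos.2 hlam) ha) (Real.sqrt_pos.2 (baseCoeff_pos ha.ne' x))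

lemma exists_equatorRate_bounds (ha : 0 < a) (hlam : 0 < lam) :
    ∃ r₀ > 0, ∃ r₁, ∀ x, r₀ ≤ equatorRate lam a x ∧ equatorRate lam a x ≤ r₁ := by
  have hmin : 0 < min (a ^ 2) 1 := lt_min (by positivity) one_pos
  refine ⟨√lam / a * √(min (a ^ 2) 1), by positivity, √lam / a * √(a ^ 2 + 1), fun x => ⟨?_, ?_⟩⟩
  · exact mul_le_mul_of_nonneg_left (Real.sqrt_le_sqrt (min_le_baseCoeff a x)) (by positivity)
  · exact mul_le_mul_of_nonneg_left (Real.sqrt_le_sqrt (baseCoeff_le a x)) (by positivity)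

lemma continuous_rateFactor (ha : a ≠ 0) : Continuous (rateFactor a) :=
  (continuous_const.mul Real.continuous_sin).div
    (contDiff_metricCoeff (n := 0) a).continuous.sqrt
    fun t => (Real.sqrt_pos.2 (metricCoeff_pos ha t)).ne'

lemma rateFactor_sq (ha : a ≠ 0) (t : ℝ) :
    rateFactor a t ^ 2 = 1 - Real.cos t ^ 2 / metricCoeff a t := by
  have h := metricCoeff_pos ha t
  rw [rateFactor, div_pow, Real.sq_sqrt h.le, eq_sub_iff_add_eq, ← add_div,
    div_eq_one_iff_eq h.ne', metricCoeff]
  ring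

lemma rateFactor_le_one (ha : a ≠ 0) (t : ℝ) : rateFactor a t ≤ 1 := by
  have h := metricCoeff_pos ha t
  have h1 := rateFactor_sq ha t
  have h2 : 0 ≤ Real.cos t ^ 2 / metricCoeff a t := by positivity
  nlinarith

lemma rateFactor_pos (ha : 0 < a) {t : ℝ} (ht : t ∈ Ioo 0 Real.pi) : 0 < rateFactor a t :=
  div_pos (mul_pos ha (Real.sin_pos_of_mem_Ioo ht)) (Real.sqrt_pos.2 (metricCoeff_pos ha.ne' t))

lemma one_sub_rateFactor_le (ha : 0 < a) {t : ℝ} (ht : t ∈ Ioo 0 Real.pi) :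
    1 - rateFactor a t ≤ Real.cos t ^ 2 / min (a ^ 2) 1 := by
  have hmin : 0 < min (a ^ 2) 1 := lt_min (by positivity) one_pos
  have h1 := rateFactor_sq ha.ne' t
  have h2 := rateFactor_le_one ha.ne' t
  have h3 := rateFactor_pos ha ht
  have h4 : Real.cos t ^ 2 / metricCoeff a t ≤ Real.cos t ^ 2 / min (a ^ 2) 1 := by
    gcongr
    exact min_le_metricCoeff a t
  nlinarith

/-- The linearisation at the equator bounds the nonlinear rotation rate from above. -/
lemma rate_le (ha : 0 < a) (hlam : 0 < lam) (t x : ℝ) :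
    equatorRate lam a x * rateFactor a t ≤ equatorRate lam a x :=
  mul_le_of_le_one_right (equatorRate_pos ha hlam x).le (rateFactor_le_one ha.ne' t)

lemma height_sq (hlam : 0 ≤ lam) (y : ℝ → ℝ) (x : ℝ) :
    height lam y x ^ 2 = lam * Real.cos (y x) ^ 2 := by
  rw [height, mul_pow, neg_sq, Real.sq_sqrt hlam]

lemma IsTrajectory.hasDerivAt_height (ha : 0 < a) (h : IsTrajectory s lam a y p) (x : ℝ) :
    HasDerivAt (height lam y)
      (equatorRate lam a x * rateFactor a (y x) * momentum a y p x) x := by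
  refine ((h.hasDerivAt_fst x).cos.const_mul (-√lam)).congr_deriv ?_
  have h2 := (Real.sqrt_pos.2 (metricCoeff_pos ha.ne' (y x))).ne'
  rw [vel_eq_momentum ha.ne' y p x, equatorRate, rateFactor]
  field_simp

lemma IsTrajectory.hasDerivAt_momentum' (ha : 0 < a) (hlam : 0 ≤ lam)
    (h : IsTrajectory s lam a y p) (x : ℝ) :
    HasDerivAt (momentum a y p) (-(s * colatCos x) * momentum a y p x
      - equatorRate lam a x * rateFactor a (y x) * height lam y x) x := by
  refine (h.hasDerivAt_momentum ha.ne' x).congr_deriv ?_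
  have h2 := (Real.sqrt_pos.2 (metricCoeff_pos ha.ne' (y x))).ne'
  have h3 := Real.sq_sqrt hlam
  rw [equatorRate, rateFactor, height]
  field_simp
  linear_combination (-(√(baseCoeff a x) * Real.sin (y x) * Real.cos (y x))) * h3

lemma IsTrajectory.continuous_rate (ha : 0 < a) (h : IsTrajectory s lam a y p) :
    Continuous fun x => equatorRate lam a x * rateFactor a (y x) :=
  (continuous_equatorRate lam a).mul ((continuous_rateFactor ha.ne').comp h.continuous_fst)

end Rates

lemma continuous_damping (s : ℝ) : Continuous fun x => s * colatCos x :=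
  continuous_const.mul continuous_colatCos

lemma abs_damping_le {s : ℝ} (hs : 0 < s) (x : ℝ) : |s * colatCos x| ≤ s := by
  rw [abs_mul, abs_of_pos hs]
  exact mul_le_of_le_one_right hs.le (abs_colatCos_le_one x)

/-- Where the largeness of `a` enters: a bounded subsolution of the linearised Riccati equation near
`-∞`. The constant `-s / 2` is the double root of the limiting characteristic equation in the
critical case, and the term `C₀ sin² ψ` absorbs the perturbation. -/
lemma exists_barrier {s lam a : ℝ} (hs : 0 < s) (ha : 0 < a) (hlam : 0 < lam)
    (hlarge : 4 * lam ≤ a ^ 2 * s ^ 2) :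
    ∃ C₀ > 0, ∃ X₁ ≤ 0, ∀ x ≤ X₁, ∃ φ',
      HasDerivAt (fun x => Real.arctan ((-(s / 2) - C₀ * colatSin x ^ 2) / (√lam / a))) φ' x ∧
      φ' ≤ angleField (fun x => s * colatCos x) (equatorRate lam a) x
        (Real.arctan ((-(s / 2) - C₀ * colatSin x ^ 2) / (√lam / a))) := by
  set ν := √lam / a with hν
  have hν0 : 0 < ν := div_pos (Real.sqrt_pos.2 hlam) ha
  -- the largeness of `a`: the rotation is not faster than critical damping allows
  have hν2 : ν ^ 2 ≤ (s / 2) ^ 2 := by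
    rw [hν, div_pow, Real.sq_sqrt hlam.le, div_le_iff₀ (by positivity)]
    linarith
  set C₀ := a ^ 2 * s ^ 2 / 2 + 1 with hC₀
  have hC₀0 : 0 < C₀ := by positivity
  set D := a ^ 2 * s * C₀ + (a ^ 2 + 1) * C₀ ^ 2 with hD
  have hD0 : 0 < D := by positivity
  have hev : ∀ᶠ x in atBot, colatSin x ^ 2 < min (1 / 2) (1 / D) := by
    have h1 : Tendsto (fun x => colatSin x ^ 2) atBot (𝓝 0) := by
      simpa using tendsto_colatSin_atBot.pow 2
    exact h1.eventually (gt_mem_nhds (lt_min (by norm_num) (by positivity)))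
  obtain ⟨X, hX⟩ := eventually_atBot.1 hev
  refine ⟨C₀, hC₀0, min X 0, min_le_right _ _, fun x hx => ?_⟩
  have hS := hX x (hx.trans (min_le_left _ _))
  have hC0 := colatCos_nonneg (hx.trans (min_le_right _ _))
  have hSC := colatSin_sq_add_colatCos_sq x
  have hd : HasDerivAt (fun x => (-(s / 2) - C₀ * colatSin x ^ 2) / ν)
      (-(2 * C₀ * colatSin x ^ 2 * colatCos x) / ν) x := by
    refine ((((hasDerivAt_colatSin x).pow 2).const_mul C₀).const_sub (-(s / 2))
      |>.div_const ν).congr_deriv ?_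
    push_cast
    ring
  refine ⟨_, hd.arctan, ?_⟩
  have hn2 := Real.sq_sqrt (baseCoeff_pos ha.ne' x).le
  have hn0 := Real.sqrt_nonneg (baseCoeff a x)
  have hb1 : √(baseCoeff a x) ≤ a ^ 2 + 1 := by
    rw [Real.sqrt_le_left (by positivity)]
    have := baseCoeff_le a x
    nlinarith [sq_nonneg a, sq_nonneg (a ^ 2)]
  have hS1 : colatSin x ^ 2 < 1 / 2 := hS.trans_le (min_le_left _ _)
  have hS2 : colatSin x ^ 2 * D ≤ 1 := by
    have := (hS.trans_le (min_le_right _ _)).le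
    rwa [le_div_iff₀ hD0] at this
  have hS0 := sq_nonneg (colatSin x)
  have hC2 : 1 / 2 ≤ colatCos x := by nlinarith
  have hm : baseCoeff a x = a ^ 2 * colatSin x ^ 2 + colatCos x ^ 2 := rfl
  have hnC : colatCos x ≤ √(baseCoeff a x) := by
    apply Real.le_sqrt_of_sq_le
    rw [hm]
    nlinarith [mul_nonneg (sq_nonneg a) hS0]
  rw [angleField, equatorRate, Real.sin_arctan, Real.cos_arctan, ← hν]
  set S2 := colatSin x ^ 2 with hS2'
  set C := colatCos x
  set n := √(baseCoeff a x)
  have hdiff : n - C ≤ a ^ 2 * S2 := by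
    have e : (n - C) * (n + C) = a ^ 2 * S2 := by linear_combination hn2 + hm
    rw [← e]
    exact le_mul_of_one_le_right (sub_nonneg.2 hnC) (by linarith)
  set ρ := s / 2 + C₀ * S2 with hρ
  have hρe : (-(s / 2) - C₀ * S2) / ν = -ρ / ν := by rw [hρ]; ring
  rw [hρe]
  have hq : 0 < 1 + (-ρ / ν) ^ 2 := by positivity
  have hsq := Real.mul_self_sqrt hq.le
  have hprod : -ρ / ν / √(1 + (-ρ / ν) ^ 2) * (1 / √(1 + (-ρ / ν) ^ 2))
      = -ρ / ν / (1 + (-ρ / ν) ^ 2) := by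
    rw [div_mul_div_comm, mul_one, hsq]
  rw [hprod]
  -- the Riccati inequality for the slope `-ρ / ν`, cleared of denominators
  have hfin : -(2 * C₀ * S2 * C) - s * C * ρ + n * (ν ^ 2 + ρ ^ 2) ≤ 0 := by
    have e1 : n * (ν ^ 2 + ρ ^ 2) ≤ n * ((s / 2) ^ 2 + ρ ^ 2) := by gcongr
    have e2 : n * ((s / 2) ^ 2 + ρ ^ 2) - s * C * ρ
        = (n - C) * (s ^ 2 / 2 + s * C₀ * S2) + n * (C₀ ^ 2 * S2 ^ 2) := by
      rw [hρ]; ring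
    have e3 : (n - C) * (s ^ 2 / 2 + s * C₀ * S2)
        ≤ a ^ 2 * S2 * (s ^ 2 / 2 + s * C₀ * S2) := by gcongr
    have e4 : n * (C₀ ^ 2 * S2 ^ 2) ≤ (a ^ 2 + 1) * (C₀ ^ 2 * S2 ^ 2) := by gcongr
    have e5 : C₀ * S2 ≤ 2 * C₀ * S2 * C := by
      have := mul_le_mul_of_nonneg_left hC2 (mul_nonneg hC₀0.le hS0)
      linarith
    have e6 : a ^ 2 * S2 * (s ^ 2 / 2 + s * C₀ * S2) + (a ^ 2 + 1) * (C₀ ^ 2 * S2 ^ 2)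
        = S2 * (C₀ - 1 + S2 * D) := by rw [hD, hC₀]; ring
    have e7 : S2 * (C₀ - 1 + S2 * D) ≤ S2 * C₀ :=
      mul_le_mul_of_nonneg_left (by linarith) hS0
    linarith
  have hid : 1 / (1 + (-ρ / ν) ^ 2) * (-(2 * C₀ * S2 * C) / ν)
      - (-(s * C) * (-ρ / ν / (1 + (-ρ / ν) ^ 2)) - ν * n)
      = (-(2 * C₀ * S2 * C) - s * C * ρ + n * (ν ^ 2 + ρ ^ 2)) / (ν * (1 + (-ρ / ν) ^ 2)) := by
    field_simp
    ring
  have := div_nonpos_of_nonpos_of_nonneg hfin (mul_pos hν0 hq).le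
  linarith

/-- The angles at `0` of the solutions of the linearised equation that start at some `X ≤ X₁` in
the direction of the poles. -/
def linearAngles (s lam a X₁ : ℝ) : Set ℝ :=
  {t | ∃ X ≤ X₁, ∃ φ, IsAngle (fun x => s * colatCos x) (equatorRate lam a) X 0 φ ∧ φ X = 0 ∧
    φ 0 = t}

lemma linearAngles_nonempty (s lam a : ℝ) {X₁ : ℝ} (hX₁ : X₁ ≤ 0) :
    (linearAngles s lam a X₁).Nonempty := by
  obtain ⟨φ, h1, h2⟩ := exists_isAngle (continuous_damping s) (continuous_equatorRate lam a) hX₁ 0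
  exact ⟨φ 0, X₁, le_rfl, φ, h2, h1, rfl⟩

lemma neg_abs_le_neg_mul_sin_mul_cos (g t : ℝ) : -|g| ≤ -g * (Real.sin t * Real.cos t) := by
  have h1 : |Real.sin t * Real.cos t| ≤ 1 := by
    rw [abs_mul]
    exact mul_le_one₀ (Real.abs_sin_le_one _) (abs_nonneg _) (Real.abs_cos_le_one _)
  have h2 : |-g * (Real.sin t * Real.cos t)| ≤ |g| := by
    rw [abs_mul, abs_neg]
    exact mul_le_of_le_one_right (abs_nonneg _) h1
  exact (abs_le.1 h2).1

/-- Non-oscillation of the linearised equation at `-∞`. -/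
lemma exists_bddBelow_linearAngles {s lam a : ℝ} (hs : 0 < s) (ha : 0 < a) (hlam : 0 < lam)
    (hlarge : 4 * lam ≤ a ^ 2 * s ^ 2) :
    ∃ X₁ ≤ 0, BddBelow (linearAngles s lam a X₁) := by
  obtain ⟨C₀, hC₀, X₁, hX₁, hbar⟩ := exists_barrier hs ha hlam hlarge
  obtain ⟨r₀, hr₀, r₁, hr⟩ := exists_equatorRate_bounds ha hlam
  have hν : 0 < √lam / a := div_pos (Real.sqrt_pos.2 hlam) ha
  refine ⟨X₁, hX₁, -(Real.pi / 2) + (s + r₁) * X₁, ?_⟩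
  rintro _ ⟨X, hX, φ, hφ, hφX, rfl⟩
  choose! b' hb' hb using hbar
  have hsub : Icc X X₁ ⊆ Icc X 0 := Icc_subset_Icc_right hX₁
  have h1 := lt_of_angle_comparison (K := s) (fun x _ => abs_damping_le hs x)
    (fun x hx => (hb' x hx.2).hasDerivWithinAt)
    (fun x hx => (hφ x (hsub hx)).mono hsub) (fun x hx => hb x hx.2) (fun x _ => le_rfl) (by
      rw [hφX, Real.arctan_lt_zero]
      have : 0 ≤ C₀ * colatSin X ^ 2 := by positivity
      exact div_neg_of_neg_of_pos (by linarith) hν) X₁ ⟨hX, le_rfl⟩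
  have h2 : -(Real.pi / 2) < φ X₁ := (Real.neg_pi_div_two_lt_arctan _).trans h1
  have hmono : MonotoneOn (fun x => φ x + (s + r₁) * x) (Icc X₁ 0) := by
    have hd : ∀ x ∈ Icc X₁ 0, HasDerivWithinAt (fun x => φ x + (s + r₁) * x)
        (angleField (fun x => s * colatCos x) (equatorRate lam a) x (φ x) + (s + r₁) * 1)
        (Icc X₁ 0) x := fun x hx =>
      (hφ.mono hX x hx).add ((hasDerivWithinAt_id x _).const_mul _)
    refine monotoneOn_of_hasDerivWithinAt_nonneg (convex_Icc X₁ 0)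
      (fun x hx => (hd x hx).continuousWithinAt)
      (fun x hx => (hd x (interior_subset hx)).mono interior_subset) fun x _ => ?_
    have h3 := neg_abs_le_neg_mul_sin_mul_cos (s * colatCos x) (φ x)
    have h4 := abs_damping_le hs x
    have h5 := (hr x).2
    unfold angleField
    linarith
  have h3 := hmono ⟨le_rfl, hX₁⟩ ⟨hX₁, le_rfl⟩ hX₁
  simp only [mul_zero, add_zero] at h3
  linarith

/-! ### The integrating factor of the damping -/

/-- The function `sin ψ ^ s`, for which `(dampingWeight s)' = s cos ψ dampingWeight s`. -/
noncomputable def dampingWeight (s x : ℝ) : ℝ := colatSin x ^ s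

lemma dampingWeight_pos (s x : ℝ) : 0 < dampingWeight s x := Real.rpow_pos_of_pos (colatSin_pos x) s

lemma hasDerivAt_dampingWeight (s x : ℝ) :
    HasDerivAt (dampingWeight s) (s * colatCos x * dampingWeight s x) x := by
  refine ((hasDerivAt_colatSin x).rpow_const (p := s) (Or.inl (colatSin_pos x).ne')).congr_deriv ?_
  rw [dampingWeight, Real.rpow_sub_one (colatSin_pos x).ne']
  have := (colatSin_pos x).ne'
  field_simp

lemma IsTrajectory.hasDerivAt_weight_mul_momentum {s lam a : ℝ} {y p : ℝ → ℝ} (ha : a ≠ 0)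
    (h : IsTrajectory s lam a y p) (x : ℝ) :
    HasDerivAt (fun x => dampingWeight s x * momentum a y p x)
      (dampingWeight s x * √(baseCoeff a x) *
        (lam * (Real.sin (y x) * Real.cos (y x)) / √(metricCoeff a (y x)))) x := by
  refine ((hasDerivAt_dampingWeight s x).mul (h.hasDerivAt_momentum ha x)).congr_deriv ?_
  ring

namespace IsConnection

variable {s lam a : ℝ} {l : ℤ} {y p : ℝ → ℝ}

lemma tendsto_momentum_atBot (ha : a ≠ 0) (hs : 0 ≤ s) (hlam : 0 ≤ lam)
    (h : IsConnection s lam a l y p) : Tendsto (momentum a y p) atBot (𝓝 0) := by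
  have h1 : Tendsto (fun x => lam * Real.sin (y x) ^ 2) atBot (𝓝 0) := by
    have := ((Real.continuous_sin.tendsto 0).comp h.tendsto_atBot).pow 2 |>.const_mul lam
    simpa using this
  have h2 : Tendsto (fun x => momentum a y p x ^ 2) atBot (𝓝 0) :=
    squeeze_zero (fun x => sq_nonneg _) (h.momentum_sq_le ha hs hlam) h1
  have h3 := h2.sqrt
  simp only [Real.sqrt_sq_eq_abs, Real.sqrt_zero] at h3
  exact (tendsto_zero_iff_abs_tendsto_zero _).2 h3

/-- Near `-∞` a solution in `(0, π)` increases. -/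
lemma eventually_momentum_pos (ha : a ≠ 0) (hlam : 0 < lam)
    (h : IsConnection s lam a l y p) (hy : ∀ x, y x ∈ Ioo 0 Real.pi) :
    ∀ᶠ x in atBot, y x < Real.pi / 2 ∧ 0 < momentum a y p x := by
  have hpi := Real.pi_pos
  obtain ⟨X, hX⟩ := eventually_atBot.1
    (h.tendsto_atBot.eventually (gt_mem_nhds (show (0 : ℝ) < Real.pi / 2 by linarith)))
  filter_upwards [eventually_le_atBot X] with x₂ hx₂
  refine ⟨hX x₂ hx₂, ?_⟩
  by_contra hneg
  have hmono : StrictMonoOn (fun x => dampingWeight s x * momentum a y p x) (Iic X) := by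
    refine strictMonoOn_of_hasDerivWithinAt_pos (convex_Iic X)
      (fun x _ => (h.hasDerivAt_weight_mul_momentum ha x).continuousAt.continuousWithinAt)
      (fun x _ => (h.hasDerivAt_weight_mul_momentum ha x).hasDerivWithinAt) fun x hx => ?_
    rw [interior_Iic] at hx
    have h1 := Real.sin_pos_of_mem_Ioo (hy x)
    have h2 : 0 < Real.cos (y x) :=
      Real.cos_pos_of_mem_Ioo ⟨by linarith [(hy x).1], hX x (le_of_lt hx)⟩
    have h3 := Real.sqrt_pos.2 (metricCoeff_pos ha (y x))
    have h4 := Real.sqrt_pos.2 (baseCoeff_pos ha x)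
    have h5 := dampingWeight_pos s x
    positivity
  have hanti : AntitoneOn y (Iic x₂) := by
    refine antitoneOn_of_hasDerivWithinAt_nonpos (convex_Iic x₂)
      h.continuous_fst.continuousOn (fun x _ => (h.hasDerivAt_fst x).hasDerivWithinAt)
      fun x hx => ?_
    rw [interior_Iic] at hx
    have h1 := hmono ((le_of_lt hx).trans hx₂ : x ∈ Iic X) hx₂ hx
    have h2 := mul_nonpos_of_nonneg_of_nonpos (dampingWeight_pos s x₂).le (not_lt.1 hneg)
    have h3 : momentum a y p x < 0 := by
      by_contra hc
      have := mul_nonneg (dampingWeight_pos s x).le (not_lt.1 hc)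
      simp only at h1
      linarith
    rw [vel_eq_momentum ha y p x]
    exact div_nonpos_of_nonpos_of_nonneg
      (mul_nonpos_of_nonneg_of_nonpos (Real.sqrt_nonneg _) h3.le) (Real.sqrt_nonneg _)
  have hle : y x₂ ≤ 0 := ge_of_tendsto h.tendsto_atBot (by
    filter_upwards [eventually_le_atBot x₂] with x hx
    exact hanti hx (mem_Iic.2 le_rfl) hx)
  linarith [(hy x₂).1]

/-- A solution in `(0, π)` does not touch the constant solution `π / 2`. -/
lemma height_ne_zero_or_momentum_ne_zero (ha : a ≠ 0) (hlam : 0 < lam)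
    (h : IsConnection s lam a l y p) (hy : ∀ x, y x ∈ Ioo 0 Real.pi) (x : ℝ) :
    0 < momentum a y p x ^ 2 + height lam y x ^ 2 := by
  by_contra hc
  have hq : momentum a y p x = 0 := by nlinarith [sq_nonneg (momentum a y p x)]
  have hv : height lam y x ^ 2 = 0 := by nlinarith [sq_nonneg (momentum a y p x)]
  rw [height_sq hlam.le] at hv
  have hcos : Real.cos (y x) = 0 := by
    rcases mul_eq_zero.1 hv with h1 | h1
    · exact absurd h1 hlam.ne'
    · exact pow_eq_zero_iff two_ne_zero |>.1 h1
  have hp : p x = 0 := by rw [vel_eq_momentum ha y p x, hq]; simp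
  have hconst : IsTrajectory s lam a (fun _ => y x) (fun _ => 0) :=
    ⟨fun _ => hasDerivAt_const _ _, fun u => by
      simpa [profileAccel, hcos] using hasDerivAt_const u (0 : ℝ)⟩
  have heq : y = fun _ => y x := h.eq_of_eq_at ha hconst rfl hp
  have h1 := h.tendsto_atBot
  rw [heq] at h1
  have h0 : y x = 0 := tendsto_nhds_unique tendsto_const_nhds h1
  linarith [(hy x).1]

/-- The ratio of momentum and height tends to zero, so that near `-∞` the polar angle is close
to zero. -/
lemma eventually_start (ha : a ≠ 0) (hs : 0 ≤ s) (hlam : 0 < lam)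
    (h : IsConnection s lam a l y p) (hy : ∀ x, y x ∈ Ioo 0 Real.pi) {c : ℝ} (hc : 0 < c) :
    ∀ᶠ x in atBot, height lam y x < 0 ∧ 0 < momentum a y p x ∧
      Real.arctan (momentum a y p x / height lam y x) < 0 ∧
      -c < Real.arctan (momentum a y p x / height lam y x) := by
  have hv : Tendsto (height lam y) atBot (𝓝 (-√lam)) := by
    have := ((Real.continuous_cos.tendsto 0).comp h.tendsto_atBot).const_mul (-√lam)
    rwa [Real.cos_zero, mul_one] at this
  have hr := Real.sqrt_pos.2 hlam
  have hq := (h.tendsto_momentum_atBot ha hs hlam.le).div hv (by simpa using hr.ne')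
  have ht := (Real.continuous_arctan.tendsto _).comp hq
  rw [zero_div, Real.arctan_zero] at ht
  filter_upwards [h.eventually_momentum_pos ha hlam hy,
    hv.eventually (gt_mem_nhds (show -√lam < 0 by linarith)),
    ht.eventually (lt_mem_nhds (show -c < 0 by linarith))] with x h1 h2 h3
  exact ⟨h2, h1.2, Real.arctan_lt_zero.2 (div_neg_of_pos_of_neg h1.2 h2), h3⟩

/-- The polar angle of a solution in `(0, π)`, started near `-∞`. -/
lemma exists_angle (ha : 0 < a) (hs : 0 < s) (hlam : 0 < lam)
    (h : IsConnection s lam a l y p) {X : ℝ} (hX : X ≤ 0)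
    (hv : height lam y X < 0) :
    ∃ θ, θ X = Real.arctan (momentum a y p X / height lam y X) ∧
      IsAngle (fun x => s * colatCos x) (fun x => equatorRate lam a x * rateFactor a (y x)) X 0 θ ∧
      ∀ x ∈ Icc X 0, momentum a y p x * Real.cos (θ x) = height lam y x * Real.sin (θ x) := by
  obtain ⟨θ, h1, h2⟩ := exists_isAngle (continuous_damping s) (h.continuous_rate ha) hX
    (Real.arctan (momentum a y p X / height lam y X))
  refine ⟨θ, h1, h2, h2.mul_cos_eq_mul_sin (fun x _ => abs_damping_le hs x)
    (fun x => h.hasDerivAt_height ha x) (fun x => h.hasDerivAt_momentum' ha hlam.le x) ?_⟩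
  have h3 : height lam y X * Real.tan (θ X) = momentum a y p X := by
    rw [h1, Real.tan_arctan, mul_div_cancel₀ _ hv.ne]
  have h4 : Real.cos (θ X) ≠ 0 := by rw [h1]; exact (Real.cos_arctan_pos _).ne'
  rw [← h3, mul_assoc, Real.tan_mul_cos h4]

end IsConnection

lemma IsAngle.neg_of_neg {s lam a X : ℝ} {y θ : ℝ → ℝ} (hs : 0 < s) (ha : 0 < a) (hlam : 0 < lam)
    (hy : ∀ x, y x ∈ Ioo 0 Real.pi)
    (h : IsAngle (fun x => s * colatCos x) (fun x => equatorRate lam a x * rateFactor a (y x))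
      X 0 θ) (h0 : θ X < 0) : ∀ x ∈ Icc X 0, θ x < 0 :=
  lt_of_angle_comparison (K := s) (u := fun _ => 0) (u' := fun _ => 0)
    (fun x _ => abs_damping_le hs x) h (fun x _ => hasDerivWithinAt_const x _ _)
    (fun x _ => le_rfl) (fun x _ => by
      have := mul_pos (equatorRate_pos ha hlam x) (rateFactor_pos ha (hy x))
      simp only [angleField, Real.sin_zero]
      linarith) h0

/-- The energy relative to the equator of the target. -/
lemma IsTrajectory.hasDerivAt_equatorEnergy {s lam a : ℝ} {y p : ℝ → ℝ} (ha : 0 < a)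
    (hlam : 0 ≤ lam) (h : IsTrajectory s lam a y p) (x : ℝ) :
    HasDerivAt (fun x => momentum a y p x ^ 2 + height lam y x ^ 2)
      (-(2 * (s * colatCos x)) * momentum a y p x ^ 2) x := by
  refine (((h.hasDerivAt_momentum' ha hlam x).pow 2).add
    ((h.hasDerivAt_height ha x).pow 2)).congr_deriv ?_
  push_cast
  ring

lemma IsTrajectory.equatorEnergy_antitoneOn {s lam a : ℝ} {y p : ℝ → ℝ} (ha : 0 < a) (hs : 0 < s)
    (hlam : 0 ≤ lam) (h : IsTrajectory s lam a y p) :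
    AntitoneOn (fun x => momentum a y p x ^ 2 + height lam y x ^ 2) (Iic 0) := by
  refine antitoneOn_of_hasDerivWithinAt_nonpos (convex_Iic 0)
    (fun x _ => (h.hasDerivAt_equatorEnergy ha hlam x).continuousAt.continuousWithinAt)
    (fun x _ => (h.hasDerivAt_equatorEnergy ha hlam x).hasDerivWithinAt) fun x hx => ?_
  rw [interior_Iic] at hx
  have h1 := mul_nonneg hs.le (colatCos_nonneg (le_of_lt hx))
  have := mul_nonneg h1 (sq_nonneg (momentum a y p x))
  linarith

/-- Backwards in time the energy relative to the equator grows at most exponentially. -/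
lemma IsTrajectory.equatorEnergy_le {s lam a : ℝ} {y p : ℝ → ℝ} (ha : 0 < a) (hs : 0 < s)
    (hlam : 0 ≤ lam) (h : IsTrajectory s lam a y p) {x : ℝ} (hx : x ≤ 0) :
    momentum a y p x ^ 2 + height lam y x ^ 2
      ≤ (momentum a y p 0 ^ 2 + height lam y 0 ^ 2) * Real.exp (-(2 * s * x)) := by
  have hd : ∀ x, HasDerivAt
      (fun x => (momentum a y p x ^ 2 + height lam y x ^ 2) * Real.exp (2 * s * x))
      ((-(2 * (s * colatCos x)) * momentum a y p x ^ 2) * Real.exp (2 * s * x)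
        + (momentum a y p x ^ 2 + height lam y x ^ 2) * (Real.exp (2 * s * x) * (2 * s))) x :=
    fun x => by
      refine ((h.hasDerivAt_equatorEnergy ha hlam x).mul
        ((hasDerivAt_id x).const_mul (2 * s)).exp).congr_deriv ?_
      simp
  have hmono : Monotone
      (fun x => (momentum a y p x ^ 2 + height lam y x ^ 2) * Real.exp (2 * s * x)) := by
    refine monotone_of_hasDerivAt_nonneg hd fun x => ?_
    have h1 := (abs_le.1 (abs_colatCos_le_one x)).2
    have h2 : 0 ≤ (2 * s * (1 - colatCos x)) * momentum a y p x ^ 2 :=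
      mul_nonneg (mul_nonneg (by linarith) (by linarith)) (sq_nonneg _)
    have h3 : 0 ≤ 2 * s * height lam y x ^ 2 := by positivity
    have h4 : 0 ≤ ((2 * s * (1 - colatCos x)) * momentum a y p x ^ 2
      + 2 * s * height lam y x ^ 2) * Real.exp (2 * s * x) := by positivity
    simp only [Pi.zero_apply]
    linarith
  have h1 := hmono hx
  simp only [mul_zero, Real.exp_zero, mul_one] at h1
  rw [Real.exp_neg, ← div_eq_mul_inv, le_div_iff₀ (Real.exp_pos _)]
  exact h1

/-! ### Solutions stay away from the equator of the target at the equator of the domain -/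

/-- Solutions that are close to the equator of the target at `x = 0` have there an angle that is
strictly larger than, but close to, the limit angle of the linearised equation. -/
lemma exists_angle_close {s lam a X₁ : ℝ} (hs : 0 < s) (ha : 0 < a) (hlam : 0 < lam)
    (hX₁ : X₁ ≤ 0) (hbdd : BddBelow (linearAngles s lam a X₁)) {ε : ℝ} (hε : 0 < ε) :
    ∃ e₀ > 0, ∀ (l : ℤ) (y p : ℝ → ℝ), IsConnection s lam a l y p → (∀ x, y x ∈ Ioo 0 Real.pi) →
      momentum a y p 0 ^ 2 + height lam y 0 ^ 2 < e₀ →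
      ∃ θ ∈ Ioo (sInf (linearAngles s lam a X₁)) (sInf (linearAngles s lam a X₁) + ε),
        momentum a y p 0 * Real.cos θ = height lam y 0 * Real.sin θ := by
  obtain ⟨r₀, hr₀, r₁, hr⟩ := exists_equatorRate_bounds ha hlam
  have hr₁ : 0 < r₁ := hr₀.trans_le ((hr 0).1.trans (hr 0).2)
  have hmin : 0 < min (a ^ 2) 1 := lt_min (by positivity) one_pos
  -- a linear solution `φ` that nearly realizes the infimum of the angles
  obtain ⟨t, ⟨X', hX', φ, hφ, hφX, rfl⟩, hφ0⟩ := exists_lt_of_csInf_lt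
    (linearAngles_nonempty s lam a hX₁) (lt_add_of_pos_right (sInf (linearAngles s lam a X₁))
      (half_pos hε))
  have hX'0 : X' ≤ 0 := hX'.trans hX₁
  set δ := ε / 4 * Real.exp (-((s + 1) * (0 - X'))) with hδ
  have hδ0 : 0 < δ := by positivity
  refine ⟨δ * (lam * min (a ^ 2) 1) / r₁ * Real.exp (2 * s * X'), by positivity,
    fun l y p h hy he => ?_⟩
  set τ := r₀ / (1 + s) with hτ
  have hτ0 : 0 < τ := by positivity
  obtain ⟨X, hXle, hXv⟩ := ((eventually_le_atBot X').and
    (h.eventually_start ha.ne' hs.le hlam hy (half_pos hτ0))).exists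
  obtain ⟨hv, -, hneg, hgt⟩ := hXv
  have hX0 : X ≤ 0 := hXle.trans hX'0
  obtain ⟨θ, hθX, hθ, hdir⟩ := h.exists_angle ha hs hlam hX0 hv
  have hθneg : ∀ x ∈ Icc X 0, θ x < 0 := hθ.neg_of_neg hs ha hlam hy (by rw [hθX]; exact hneg)
  refine ⟨θ 0, ⟨?_, ?_⟩, hdir 0 ⟨hX0, le_rfl⟩⟩
  · -- compare with the linear solution that starts at `X - 1`
    obtain ⟨ψ, hψ0, hψ⟩ := exists_isAngle (continuous_damping s) (continuous_equatorRate lam a)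
      (show X - 1 ≤ 0 by linarith) 0
    have hsub : Icc (X - 1) X ⊆ Icc (X - 1) 0 := Icc_subset_Icc_right hX0
    have hlin : ∀ x, HasDerivAt (fun x => τ / 2 - τ * (x - (X - 1))) (-τ) x := fun x => by
      refine ((((hasDerivAt_id x).sub_const (X - 1)).const_mul τ).const_sub (τ / 2)).congr_deriv ?_
      simp
    have h1 := lt_of_angle_comparison (K := s) (γ := fun x => s * colatCos x)
      (R := equatorRate lam a) (φ := ψ) (X := X - 1) (T := X) (fun x _ => abs_damping_le hs x)
      (fun x hx => (hψ x (hsub hx)).mono hsub) (fun x _ => (hlin x).hasDerivWithinAt)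
      (fun x _ => le_rfl) (fun x hx => by
        have e1 := abs_sin_mul_cos_sub_le (τ / 2 - τ * (x - (X - 1))) 0
        have e2 : |τ / 2 - τ * (x - (X - 1))| ≤ τ := by
          rw [abs_le]
          have h3 := mul_le_mul_of_nonneg_left (show x - (X - 1) ≤ 1 by linarith [hx.2]) hτ0.le
          have h4 := mul_nonneg hτ0.le (show 0 ≤ x - (X - 1) by linarith [hx.1])
          constructor <;> linarith
        rw [Real.sin_zero, zero_mul, sub_zero, sub_zero] at e1
        have e3 : |-(s * colatCos x) * (Real.sin (τ / 2 - τ * (x - (X - 1))) *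
            Real.cos (τ / 2 - τ * (x - (X - 1))))| ≤ s * τ := by
          rw [abs_mul, abs_neg]
          exact mul_le_mul (abs_damping_le hs x) (e1.trans e2) (abs_nonneg _) hs.le
        have e4 := (abs_le.1 e3).2
        have e5 := (hr x).1
        have e6 : τ * (1 + s) = r₀ := by rw [hτ]; field_simp
        unfold angleField
        linarith) (by rw [hψ0]; linarith) X ⟨by linarith, le_rfl⟩
    have h2 : ψ X < θ X := by rw [hθX]; linarith
    have h3 := lt_of_angle_comparison (K := s) (fun x _ => abs_damping_le hs x)
      (hψ.mono (show X - 1 ≤ X by linarith)) hθ (fun x _ => le_rfl)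
      (fun x _ => by
        have := rate_le ha hlam (y x) x
        simp only [angleField]
        linarith) h2 0 ⟨hX0, le_rfl⟩
    exact (csInf_le hbdd ⟨X - 1, by linarith, ψ, hψ, hψ0, rfl⟩).trans_lt h3
  -- close to the equator, on `[X', 0]`, the rotation rate is almost that of the linear solution `φ`
  · have hrate : ∀ x ∈ Icc X' 0,
        equatorRate lam a x - δ ≤ equatorRate lam a x * rateFactor a (y x) := by
      intro x hx
      have h1 := h.equatorEnergy_le ha hs hlam.le hx.2
      have h2 : (momentum a y p 0 ^ 2 + height lam y 0 ^ 2) * Real.exp (-(2 * s * x))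
          ≤ δ * (lam * min (a ^ 2) 1) / r₁ := by
        have e1 : Real.exp (-(2 * s * x)) ≤ Real.exp (-(2 * s * X')) := by
          apply Real.exp_le_exp.2
          have := mul_le_mul_of_nonneg_left hx.1 (show 0 ≤ 2 * s by linarith)
          linarith
        calc _ ≤ (δ * (lam * min (a ^ 2) 1) / r₁ * Real.exp (2 * s * X'))
              * Real.exp (-(2 * s * X')) := by gcongr
          _ = δ * (lam * min (a ^ 2) 1) / r₁ := by
            rw [mul_assoc, ← Real.exp_add, add_neg_cancel, Real.exp_zero, mul_one]
      have h3 : lam * Real.cos (y x) ^ 2 ≤ δ * (lam * min (a ^ 2) 1) / r₁ := by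
        rw [← height_sq hlam.le]
        linarith [sq_nonneg (momentum a y p x)]
      have h4 : r₁ * (Real.cos (y x) ^ 2 / min (a ^ 2) 1) ≤ δ := by
        rw [le_div_iff₀ hr₁] at h3
        rw [← mul_div_assoc, div_le_iff₀ hmin]
        refine le_of_mul_le_mul_left ?_ hlam
        linarith
      have h5 := one_sub_rateFactor_le ha (hy x)
      have h6 := rateFactor_le_one ha.ne' (y x)
      have h7 : equatorRate lam a x * (1 - rateFactor a (y x))
          ≤ r₁ * (Real.cos (y x) ^ 2 / min (a ^ 2) 1) :=
        mul_le_mul (hr x).2 h5 (by linarith) hr₁.le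
      linarith
    have h1 := (hθ.mono hXle).le_add_of_rate_close hδ0 (fun x _ => abs_damping_le hs x) hrate hφ
      (by rw [hφX]; exact (hθneg X' ⟨hXle, hX'0⟩).le) 0 ⟨hX'0, le_rfl⟩
    have h2 : 2 * δ * Real.exp ((s + 1) * (0 - X')) = ε / 2 := by
      rw [hδ, show 2 * (ε / 4 * Real.exp (-((s + 1) * (0 - X')))) * Real.exp ((s + 1) * (0 - X'))
        = ε / 2 * (Real.exp (-((s + 1) * (0 - X'))) * Real.exp ((s + 1) * (0 - X'))) by ring,
        ← Real.exp_add, neg_add_cancel, Real.exp_zero, mul_one]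
    linarith

/-- A solution in `(0, π)`, seen from the other pole of the domain. -/
lemma IsConnection.exists_reflect {s lam a : ℝ} {l : ℤ} {y p : ℝ → ℝ}
    (h : IsConnection s lam a l y p) (hy : ∀ x, y x ∈ Ioo 0 Real.pi) :
    ∃ (l₁ : ℤ) (y₁ p₁ : ℝ → ℝ), IsConnection s lam a l₁ y₁ p₁ ∧ (∀ x, y₁ x ∈ Ioo 0 Real.pi) ∧
      ((momentum a y₁ p₁ 0 = -momentum a y p 0 ∧ height lam y₁ 0 = height lam y 0) ∨
        (momentum a y₁ p₁ 0 = momentum a y p 0 ∧ height lam y₁ 0 = -height lam y 0)) := by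
  have hpi := Real.pi_pos
  have h0 : (0 : ℝ) ≤ l * Real.pi := ge_of_tendsto h.tendsto_atTop
    (Eventually.of_forall fun x => (hy x).1.le)
  have h1 : (l * Real.pi : ℝ) ≤ Real.pi := le_of_tendsto h.tendsto_atTop
    (Eventually.of_forall fun x => (hy x).2.le)
  have hl0 : 0 ≤ l := by
    have : (0 : ℝ) ≤ l := by
      by_contra hc
      have := mul_neg_of_neg_of_pos (not_le.1 hc) hpi
      linarith
    exact_mod_cast this
  have hl1 : l ≤ 1 := by
    have : (l : ℝ) ≤ 1 := by
      by_contra hc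
      have := mul_lt_mul_of_pos_right (not_le.1 hc) hpi
      linarith
    exact_mod_cast this
  have hr := h.reflect
  have hm := momentum_reflect (a := a) (y := y) (p := p) l 0
  obtain rfl | rfl : l = 0 ∨ l = 1 := by omega
  · refine ⟨_, _, _, hr, fun x => by simpa using hy (-x), Or.inl ⟨by simpa using hm, ?_⟩⟩
    simp [height]
  · refine ⟨_, _, _, hr.neg, fun x => ?_, Or.inr ⟨?_, ?_⟩⟩
    · have := hy (-x)
      simp only [Int.cast_one, one_mul]
      constructor <;> linarith [this.1, this.2]
    · have : ∀ (f g : ℝ → ℝ), momentum a (fun x => -f x) (fun x => -g x) 0 = -momentum a f g 0 := by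
        intro f g
        simp only [momentum, metricCoeff_neg]
        ring
      rw [this, hm]
      simp
    · simp [height]

/-- There is a neighbourhood of the equator of the target that no solution meets, together with a
small momentum, at the equator of the domain. The polar angles of the solution and of its
reflection would both be slightly larger than the same limit angle of the linearised equation,
although they add up to a multiple of `π`. -/
theorem exists_equatorEnergy_ge {s lam a : ℝ} (hs : 0 < s) (ha : 0 < a) (hlam : 0 < lam)
    (hlarge : 4 * lam ≤ a ^ 2 * s ^ 2) :
    ∃ e₀ > 0, ∀ (l : ℤ) (y p : ℝ → ℝ), IsConnection s lam a l y p → (∀ x, y x ∈ Ioo 0 Real.pi) →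
      e₀ ≤ momentum a y p 0 ^ 2 + height lam y 0 ^ 2 := by
  obtain ⟨X₁, hX₁, hbdd⟩ := exists_bddBelow_linearAngles hs ha hlam hlarge
  set I := sInf (linearAngles s lam a X₁)
  have hpi := Real.pi_pos
  set N := ⌊2 * I / Real.pi⌋
  -- the interval `(2 I, 2 I + 2 ε)` contains no multiple of `π`
  set ε := (Real.pi * (N + 1) - 2 * I) / 2 with hε
  have hN1 : Real.pi * N ≤ 2 * I := by
    have := Int.floor_le (2 * I / Real.pi)
    rw [le_div_iff₀ hpi] at this
    linarith
  have hε0 : 0 < ε := by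
    have := Int.lt_floor_add_one (2 * I / Real.pi)
    rw [div_lt_iff₀ hpi] at this
    rw [hε]
    linarith
  obtain ⟨e₀, he₀, key⟩ := exists_angle_close hs ha hlam hX₁ hbdd hε0
  refine ⟨e₀, he₀, fun l y p h hy => ?_⟩
  by_contra! hlt
  obtain ⟨l₁, y₁, p₁, h', hy', hrel⟩ := h.exists_reflect hy
  obtain ⟨θ, hθ, e1⟩ := key l y p h hy hlt
  obtain ⟨θ', hθ', e2⟩ := key l₁ y₁ p₁ h' hy' (by
    rcases hrel with ⟨h1, h2⟩ | ⟨h1, h2⟩ <;> rw [h1, h2] <;> simpa using hlt)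
  have hpos := h.height_ne_zero_or_momentum_ne_zero ha.ne' hlam hy 0
  have hsin : Real.sin (θ + θ') = 0 := by
    have e3 : momentum a y p 0 * Real.cos θ' = -(height lam y 0 * Real.sin θ') := by
      rcases hrel with ⟨h1, h2⟩ | ⟨h1, h2⟩ <;> rw [h1, h2] at e2 <;> linarith
    rw [Real.sin_add]
    have e4 : momentum a y p 0 * (Real.sin θ * Real.cos θ' + Real.cos θ * Real.sin θ') = 0 := by
      linear_combination Real.sin θ * e3 + Real.sin θ' * e1
    have e5 : height lam y 0 * (Real.sin θ * Real.cos θ' + Real.cos θ * Real.sin θ') = 0 := by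
      linear_combination -Real.cos θ' * e1 + Real.cos θ * e3
    rcases mul_eq_zero.1 e4 with h0 | h0
    · rcases mul_eq_zero.1 e5 with h1 | h1
      · rw [h0, h1] at hpos
        simp at hpos
      · exact h1
    · exact h0
  obtain ⟨n, hn⟩ := Real.sin_eq_zero_iff.1 hsin
  have hlo : Real.pi * N < n * Real.pi := by linarith [hθ.1, hθ'.1]
  have hhi : n * Real.pi < Real.pi * (N + 1) := by linarith [hθ.2, hθ'.2]
  have h1 : (N : ℝ) < n := by
    rw [mul_comm] at hlo
    exact lt_of_mul_lt_mul_right hlo hpi.le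
  have h2 : (n : ℝ) < N + 1 := by
    rw [mul_comm Real.pi] at hhi
    exact lt_of_mul_lt_mul_right hhi hpi.le
  have h3 : N < n := by exact_mod_cast h1
  have h4 : n < N + 1 := by exact_mod_cast h2
  omega

/-! ### Uniform decay at the poles of the domain -/

/-- By the barrier, a solution in `(0, π)` increases and does not reach the equator on a half line
that does not depend on the solution. -/
lemma exists_increasing_region {s lam a : ℝ} (hs : 0 < s) (ha : 0 < a) (hlam : 0 < lam)
    (hlarge : 4 * lam ≤ a ^ 2 * s ^ 2) :
    ∃ X₁ ≤ 0, ∃ B > 0, ∀ (l : ℤ) (y p : ℝ → ℝ), IsConnection s lam a l y p →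
      (∀ x, y x ∈ Ioo 0 Real.pi) → ∀ x ≤ X₁,
        height lam y x < 0 ∧ 0 < momentum a y p x ∧ momentum a y p x ≤ -B * height lam y x := by
  obtain ⟨C₀, hC₀, X₁, hX₁, hbar⟩ := exists_barrier hs ha hlam hlarge
  have hν : 0 < √lam / a := div_pos (Real.sqrt_pos.2 hlam) ha
  refine ⟨X₁, hX₁, (s / 2 + C₀) / (√lam / a), by positivity, fun l y p h hy x₀ hx₀ => ?_⟩
  choose! b' hb' hb using hbar
  have hc : 0 < -Real.arctan (-(s / 2) / (√lam / a)) := by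
    rw [neg_pos, Real.arctan_lt_zero]
    exact div_neg_of_neg_of_pos (by linarith) hν
  obtain ⟨X, hXle, hXv⟩ := ((eventually_le_atBot x₀).and
    (h.eventually_start ha.ne' hs.le hlam hy hc)).exists
  obtain ⟨hv, -, hneg, hgt⟩ := hXv
  have hX0 : X ≤ 0 := (hXle.trans hx₀).trans hX₁
  obtain ⟨θ, hθX, hθ, hdir⟩ := h.exists_angle ha hs hlam hX0 hv
  have hθneg : ∀ x ∈ Icc X 0, θ x < 0 := hθ.neg_of_neg hs ha hlam hy (by rw [hθX]; exact hneg)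
  have hsub : Icc X X₁ ⊆ Icc X 0 := Icc_subset_Icc_right hX₁
  have hlt := lt_of_angle_comparison (K := s) (X := X) (T := X₁)
    (fun x _ => abs_damping_le hs x)
    (fun x hx => (hb' x hx.2).hasDerivWithinAt) (fun x hx => (hθ x (hsub hx)).mono hsub)
    (fun x hx => hb x hx.2) (fun x _ => by
      have := rate_le ha hlam (y x) x
      simp only [angleField]
      linarith) (by
      rw [hθX]
      refine lt_of_le_of_lt ?_ (neg_neg (Real.arctan _) ▸ hgt)
      apply Real.arctan_strictMono.monotone
      have : 0 ≤ C₀ * colatSin X ^ 2 := by positivity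
      gcongr
      linarith)
  have hcos : ∀ x ∈ Icc X X₁, 0 < Real.cos (θ x) := fun x hx =>
    Real.cos_pos_of_mem_Ioo ⟨(Real.neg_pi_div_two_lt_arctan _).trans (hlt x hx),
      (hθneg x (hsub hx)).trans (by linarith [Real.pi_pos])⟩
  have hqv : ∀ x ∈ Icc X X₁, momentum a y p x = height lam y x * Real.tan (θ x) := fun x hx => by
    rw [Real.tan_eq_sin_div_cos, ← mul_div_assoc, ← hdir x (hsub hx),
      mul_div_cancel_right₀ _ (hcos x hx).ne']
  have hne : ∀ x ∈ Icc X X₁, height lam y x ≠ 0 := fun x hx h0 => by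
    have := h.height_ne_zero_or_momentum_ne_zero ha.ne' hlam hy x
    rw [hqv x hx, h0] at this
    simp at this
  have hx₀' : x₀ ∈ Icc X X₁ := ⟨hXle, hx₀⟩
  have hvneg : height lam y x₀ < 0 := by
    by_contra hcon
    have hcont : ContinuousOn (height lam y) (Icc X x₀) := fun x _ =>
      (h.hasDerivAt_height ha x).continuousAt.continuousWithinAt
    obtain ⟨u, hu, hu0⟩ := intermediate_value_Icc hXle hcont
      (show (0 : ℝ) ∈ Icc (height lam y X) (height lam y x₀) from ⟨hv.le, not_lt.1 hcon⟩)
    exact hne u ⟨hu.1, hu.2.trans hx₀⟩ hu0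
  have htan : Real.tan (θ x₀) < 0 := Real.tan_neg_of_neg_of_pi_div_two_lt
    (hθneg x₀ (hsub hx₀')) ((Real.neg_pi_div_two_lt_arctan _).trans (hlt x₀ hx₀'))
  have htan2 : -((s / 2 + C₀) / (√lam / a)) ≤ Real.tan (θ x₀) := by
    have h1 := Real.tan_lt_tan_of_lt_of_lt_pi_div_two (Real.neg_pi_div_two_lt_arctan _)
      ((hθneg x₀ (hsub hx₀')).trans (by linarith [Real.pi_pos])) (hlt x₀ hx₀')
    rw [Real.tan_arctan] at h1
    refine le_trans ?_ h1.le
    rw [← neg_div]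
    gcongr
    have h2 := colatSin_le_one x₀
    have h3 := (colatSin_pos x₀).le
    have h4 : colatSin x₀ ^ 2 ≤ 1 := pow_le_one₀ h3 h2
    nlinarith
  rw [hqv x₀ hx₀']
  refine ⟨hvneg, mul_pos_of_neg_of_neg hvneg htan, ?_⟩
  have := mul_le_mul_of_nonpos_left htan2 hvneg.le
  linarith

/-- Solutions in `(0, π)` tend to zero at `-∞` uniformly. Otherwise a solution would stay between
`δ` and the equator for a long time, hence get close to the equator. -/
lemma exists_uniform_small_pos {s lam a : ℝ} (hs : 0 < s) (ha : 0 < a) (hlam : 0 < lam)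
    (hlarge : 4 * lam ≤ a ^ 2 * s ^ 2) {δ : ℝ} (hδ : 0 < δ) (hδ' : δ < Real.pi / 2) :
    ∃ x₀ ≤ 0, ∀ (l : ℤ) (y p : ℝ → ℝ), IsConnection s lam a l y p →
      (∀ x, y x ∈ Ioo 0 Real.pi) → ∀ x ≤ x₀, y x < δ := by
  obtain ⟨e₀, he₀, hfar⟩ := exists_equatorEnergy_ge hs ha hlam hlarge
  obtain ⟨X₁, hX₁, B, hB, hinc⟩ := exists_increasing_region hs ha hlam hlarge
  obtain ⟨r₀, hr₀, r₁, hr⟩ := exists_equatorRate_bounds ha hlam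
  have hpi := Real.pi_pos
  have hsinδ : 0 < Real.sin δ := Real.sin_pos_of_pos_of_lt_pi hδ (by linarith)
  set K₀ := r₀ * (a * Real.sin δ / √(a ^ 2 + 1)) with hK₀
  have hK₀0 : 0 < K₀ := by positivity
  set η := min (K₀ / s) (1 / (2 * B)) with hη
  have hη0 : 0 < η := by positivity
  have hη1 : η * s ≤ K₀ := by
    have := min_le_left (K₀ / s) (1 / (2 * B))
    rwa [← hη, le_div_iff₀ hs] at this
  have hη2 : η * B ≤ 1 / 2 := by
    have := min_le_right (K₀ / s) (1 / (2 * B))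
    rw [← hη, le_div_iff₀ (by positivity)] at this
    linarith
  set ϑ := η * K₀ with hϑ
  have hϑ0 : 0 < ϑ := by positivity
  have hlim : Tendsto (fun x => (1 + B ^ 2) * (2 * (√lam * Real.exp (ϑ * (x - X₁)))) ^ 2) atBot
      (𝓝 0) := by
    have h1 : Tendsto (fun x => ϑ * (x - X₁)) atBot atBot :=
      (tendsto_atBot_add_const_right _ (-X₁) tendsto_id).const_mul_atBot hϑ0
    have h2 := (((Real.tendsto_exp_atBot.comp h1).const_mul √lam).const_mul 2).pow 2
      |>.const_mul (1 + B ^ 2)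
    simpa using h2
  obtain ⟨x₀, hx₀X, hx₀⟩ := ((eventually_le_atBot X₁).and
    (hlim.eventually (gt_mem_nhds he₀))).exists
  refine ⟨x₀, hx₀X.trans hX₁, fun l y p h hy => ?_⟩
  have hvel : ∀ x ≤ X₁, 0 < p x := fun x hx => by
    rw [vel_eq_momentum ha.ne' y p x]
    exact div_pos (mul_pos (Real.sqrt_pos.2 (baseCoeff_pos ha.ne' x)) (hinc l y p h hy x hx).2.1)
      (Real.sqrt_pos.2 (metricCoeff_pos ha.ne' _))
  have hmono : MonotoneOn y (Iic X₁) := by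
    refine monotoneOn_of_hasDerivWithinAt_nonneg (convex_Iic X₁) h.continuous_fst.continuousOn
      (fun x _ => (h.hasDerivAt_fst x).hasDerivWithinAt) fun x hx => ?_
    rw [interior_Iic] at hx
    exact (hvel x (le_of_lt hx)).le
  suffices hsmall : y x₀ < δ from
    fun x hx => (hmono (hx.trans hx₀X) hx₀X hx).trans_lt hsmall
  by_contra hge
  rw [not_lt] at hge
  -- while `y ≥ δ` the polar angle rotates at a definite rate
  have hrate : ∀ x ∈ Icc x₀ X₁, K₀ ≤ equatorRate lam a x * rateFactor a (y x) := by
    intro x hx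
    have h1 : δ ≤ y x := hge.trans (hmono hx₀X hx.2 hx.1)
    have h2 : y x ≤ Real.pi / 2 := by
      by_contra hc
      have h3 := Real.cos_neg_of_pi_div_two_lt_of_lt (not_le.1 hc) (by linarith [(hy x).2])
      have h4 := (hinc l y p h hy x hx.2).1
      rw [height] at h4
      have := mul_pos_of_neg_of_neg (neg_neg_of_pos (Real.sqrt_pos.2 hlam)) h3
      linarith
    have h3 : Real.sin δ ≤ Real.sin (y x) :=
      Real.sin_le_sin_of_le_of_le_pi_div_two (by linarith) h2 h1
    have h4 := Real.sqrt_pos.2 (metricCoeff_pos ha.ne' (y x))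
    have h5 : a * Real.sin δ / √(a ^ 2 + 1) ≤ rateFactor a (y x) := by
      exact div_le_div₀ (mul_nonneg ha.le (hsinδ.le.trans h3)) (mul_le_mul_of_nonneg_left h3 ha.le)
        h4 (Real.sqrt_le_sqrt (metricCoeff_le a _))
    exact mul_le_mul (hr x).1 h5 (by positivity) (hr₀.le.trans (hr x).1)
  have hd : ∀ x, HasDerivAt
      (fun x => (-height lam y x - η * momentum a y p x) * Real.exp (ϑ * x))
      ((-(equatorRate lam a x * rateFactor a (y x) * momentum a y p x)
        - η * (-(s * colatCos x) * momentum a y p x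
          - equatorRate lam a x * rateFactor a (y x) * height lam y x)) * Real.exp (ϑ * x)
        + (-height lam y x - η * momentum a y p x) * (Real.exp (ϑ * x) * ϑ)) x := fun x => by
    refine (((h.hasDerivAt_height ha x).neg.sub
      ((h.hasDerivAt_momentum' ha hlam.le x).const_mul η)).mul
      ((hasDerivAt_id x).const_mul ϑ).exp).congr_deriv ?_
    simp
  -- hence `-height - η * momentum`, which is comparable to `-height`, decays exponentially
  have hanti : AntitoneOn
      (fun x => (-height lam y x - η * momentum a y p x) * Real.exp (ϑ * x)) (Icc x₀ X₁) := by
    refine antitoneOn_of_hasDerivWithinAt_nonpos (convex_Icc x₀ X₁)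
      (fun x _ => (hd x).continuousAt.continuousWithinAt)
      (fun x _ => (hd x).hasDerivWithinAt) fun x hx => ?_
    have hx' := interior_subset hx
    obtain ⟨h1, h2, -⟩ := hinc l y p h hy x hx'.2
    have h3 := hrate x hx'
    set R := equatorRate lam a x * rateFactor a (y x)
    set q := momentum a y p x
    set v := height lam y x
    have h4 := (abs_le.1 (abs_damping_le hs x)).2
    have e1 : η * (s * colatCos x) * q ≤ R * q := by
      refine mul_le_mul_of_nonneg_right ?_ h2.le
      exact (mul_le_mul_of_nonneg_left h4 hη0.le).trans (hη1.trans h3)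
    have e2 : η * R * v ≤ ϑ * v := by
      refine mul_le_mul_of_nonpos_right ?_ h1.le
      exact mul_le_mul_of_nonneg_left h3 hη0.le
    have e3 : 0 ≤ ϑ * (η * q) := by positivity
    have e4 : -(R * q) - η * (-(s * colatCos x) * q - R * v) + (-v - η * q) * ϑ ≤ 0 := by linarith
    have := mul_nonpos_of_nonpos_of_nonneg e4 (Real.exp_pos (ϑ * x)).le
    linarith
  have h1 := hanti ⟨le_rfl, hx₀X⟩ ⟨hx₀X, le_rfl⟩ hx₀X
  simp only at h1
  obtain ⟨-, q0, -⟩ := hinc l y p h hy x₀ hx₀X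
  obtain ⟨v1, q1, b1⟩ := hinc l y p h hy X₁ le_rfl
  have h2 : -height lam y x₀ ≤ √lam := by
    rw [height, neg_mul, neg_neg]
    exact mul_le_of_le_one_right (Real.sqrt_nonneg _) (Real.cos_le_one _)
  have h3 : -height lam y X₁ - η * momentum a y p X₁ ≤ √lam * Real.exp (ϑ * (x₀ - X₁)) := by
    have e1 : (-height lam y X₁ - η * momentum a y p X₁) * Real.exp (ϑ * X₁)
        ≤ √lam * Real.exp (ϑ * x₀) := by
      refine h1.trans (mul_le_mul_of_nonneg_right ?_ (Real.exp_pos _).le)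
      have := mul_pos hη0 q0
      linarith
    have e2 : √lam * Real.exp (ϑ * (x₀ - X₁)) * Real.exp (ϑ * X₁) = √lam * Real.exp (ϑ * x₀) := by
      rw [mul_assoc, ← Real.exp_add]
      ring_nf
    exact le_of_mul_le_mul_right (e1.trans_eq e2.symm) (Real.exp_pos _)
  have h4 : -height lam y X₁ ≤ 2 * (√lam * Real.exp (ϑ * (x₀ - X₁))) := by
    have e1 := mul_le_mul_of_nonneg_left b1 hη0.le
    have e2 : η * (-B * height lam y X₁) = η * B * -height lam y X₁ := by ring
    have e3 := mul_le_mul_of_nonneg_right hη2 (neg_nonneg.2 v1.le)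
    linarith
  -- the energy relative to the equator is then too small at `X₁`, hence at `0`
  have h5 := h.equatorEnergy_antitoneOn ha hs hlam.le (mem_Iic.2 hX₁) (mem_Iic.2 le_rfl) hX₁
  simp only at h5
  have h6 := hfar l y p h hy
  have h7 : momentum a y p X₁ ^ 2 ≤ (B * -height lam y X₁) ^ 2 :=
    pow_le_pow_left₀ q1.le (by linarith) 2
  have h8 : (-height lam y X₁) ^ 2 ≤ (2 * (√lam * Real.exp (ϑ * (x₀ - X₁)))) ^ 2 :=
    pow_le_pow_left₀ (by linarith) h4 2
  have h9 : momentum a y p X₁ ^ 2 + height lam y X₁ ^ 2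
      ≤ (1 + B ^ 2) * (2 * (√lam * Real.exp (ϑ * (x₀ - X₁)))) ^ 2 := by
    have := mul_le_mul_of_nonneg_left h8 (show 0 ≤ 1 + B ^ 2 by positivity)
    nlinarith
  linarith

/-- All solutions of the boundary value problem tend to zero at `-∞` uniformly. -/
theorem exists_uniform_small {s lam a : ℝ} (hs : 0 < s) (ha : 0 < a) (hlam : 0 < lam)
    (hlarge : 4 * lam ≤ a ^ 2 * s ^ 2) {δ : ℝ} (hδ : 0 < δ) :
    ∃ X ≤ 0, ∀ x₀ ≤ X, ∀ (l : ℤ) (y p : ℝ → ℝ), IsConnection s lam a l y p →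
      ∀ x ≤ x₀, |y x| < δ := by
  have hδ1 : 0 < min δ 1 := lt_min hδ one_pos
  obtain ⟨X, hX, hx⟩ := exists_uniform_small_pos hs ha hlam hlarge (δ := min δ 1) hδ1
    ((min_le_right _ _).trans_lt (by linarith [Real.pi_gt_three]))
  refine ⟨X, hX, fun x₀ hx₀ l y p h x hxx => ?_⟩
  rcases h.trichotomy ha.ne' hs.le hlam.le with h0 | h0 | h0
  · simpa [h0] using hδ
  · rw [abs_of_pos (h0 x).1]
    exact (hx l y p h h0 x (hxx.trans hx₀)).trans_le (min_le_left _ _)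
  · rw [← abs_neg, abs_of_pos (h0 x).1]
    exact (hx _ _ _ h.neg h0 x (hxx.trans hx₀)).trans_le (min_le_left _ _)

/-! ### Volterra equations with a holomorphic parameter -/

section Volterra

lemma continuousOn_parametric_integral {P E : Type*} [TopologicalSpace P]
    [FirstCountableTopology P] [NormedAddCommGroup E] [NormedSpace ℝ E]
    {G : P → ℝ → E} {V : Set P}
    (hG : ContinuousOn (Function.uncurry G) (V ×ˢ Icc 0 1)) :
    ContinuousOn (fun x => ∫ r in (0 : ℝ)..1, G x r) V := by
  rw [continuousOn_iff_continuous_domRestrict]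
  have h1 : Continuous (Function.uncurry fun (x : V) (r : ℝ) =>
      G x (projIcc (0 : ℝ) 1 zero_le_one r)) :=
    hG.comp_continuous (f := fun w : V × ℝ => ((w.1 : P), (projIcc (0 : ℝ) 1 zero_le_one w.2 : ℝ)))
      ((continuous_subtype_val.comp continuous_fst).prodMk
        (continuous_subtype_val.comp (continuous_projIcc.comp continuous_snd)))
      fun w => ⟨w.1.2, (projIcc (0 : ℝ) 1 zero_le_one w.2).2⟩
  have h2 := intervalIntegral.continuous_parametric_intervalIntegral_of_continuous'
    (μ := MeasureTheory.volume) h1 0 1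
  convert h2 using 2 with x
  refine intervalIntegral.integral_congr fun r hr => ?_
  rw [uIcc_of_le zero_le_one] at hr
  simp [projIcc_of_mem _ hr]

/-- The integral of a family of holomorphic functions that depends continuously on the integration
variable is holomorphic. -/
lemma differentiableOn_parametric_integral {E : Type*} [NormedAddCommGroup E] [NormedSpace ℂ E]
    [CompleteSpace E] {G : ℂ → ℝ → E} {U : Set ℂ} (hU : IsOpen U)
    (hG : ContinuousOn (Function.uncurry G) (U ×ˢ Icc 0 1))
    (hd : ∀ r ∈ Icc (0 : ℝ) 1, DifferentiableOn ℂ (fun z => G z r) U) :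
    DifferentiableOn ℂ (fun z => ∫ r in (0 : ℝ)..1, G z r) U := by
  intro z₀ hz₀
  obtain ⟨ρ, hρ, hball⟩ := Metric.nhds_basis_closedBall.mem_iff.1 (hU.mem_nhds hz₀)
  obtain ⟨C, hC⟩ := ((isCompact_closedBall z₀ ρ).prod isCompact_Icc).exists_bound_of_continuousOn
    (hG.mono (prod_mono hball le_rfl))
  have hsec : ∀ z ∈ U, ContinuousOn (G z) (Icc 0 1) := fun z hz =>
    hG.comp (continuousOn_const.prodMk continuousOn_id) fun r hr => ⟨hz, hr⟩
  have hIoc : uIoc (0 : ℝ) 1 = Ioc 0 1 := uIoc_of_le zero_le_one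
  have hmeas : ∀ z ∈ U, MeasureTheory.AEStronglyMeasurable (G z)
      (MeasureTheory.volume.restrict (uIoc (0 : ℝ) 1)) := fun z hz => by
    rw [hIoc]
    exact ((hsec z hz).mono Ioc_subset_Icc_self).aestronglyMeasurable measurableSet_Ioc
  have hderiv : ∀ r ∈ Icc (0 : ℝ) 1, ∀ z ∈ U, HasDerivAt (fun z => G z r)
      (deriv (fun z => G z r) z) z := fun r hr z hz =>
    ((hd r hr).differentiableAt (hU.mem_nhds hz)).hasDerivAt
  have hball2 : ∀ z ∈ Metric.ball z₀ (ρ / 2), Metric.closedBall z (ρ / 2) ⊆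
      Metric.closedBall z₀ ρ := fun z hz => Metric.closedBall_subset_closedBall' (by
    have := (Metric.mem_ball.1 hz).le
    linarith)
  have hmeas' : MeasureTheory.AEStronglyMeasurable (fun r => deriv (fun z => G z r) z₀)
      (MeasureTheory.volume.restrict (uIoc (0 : ℝ) 1)) := by
    -- the derivative is a limit of difference quotients
    set u : ℕ → ℂ := fun n => z₀ + ((ρ / (n + 1) : ℝ) : ℂ) with hu
    have hulim : Tendsto u atTop (𝓝[≠] z₀) := by
      refine tendsto_nhdsWithin_iff.2 ⟨?_, Eventually.of_forall fun n => ?_⟩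
      · have h1 : Tendsto (fun n : ℕ => ρ / ((n : ℝ) + 1)) atTop (𝓝 0) :=
          tendsto_const_div_atTop_nhds_zero_nat ρ |>.comp (tendsto_add_atTop_nat 1) |>.congr
            fun n => by simp
        have h2 := (Complex.continuous_ofReal.tendsto 0).comp h1
        simpa [hu] using h2.const_add z₀
      · have : (0 : ℝ) < ρ / (n + 1) := by positivity
        simp only [hu, mem_compl_iff, mem_singleton_iff, add_eq_left]
        exact_mod_cast this.ne'
    have humem : ∀ n, u n ∈ U := fun n => hball (by
      have h1 : ρ / ((n : ℝ) + 1) ≤ ρ := div_le_self hρ.le (by linarith [n.cast_nonneg (α := ℝ)])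
      have h2 : (0 : ℝ) < ρ / (n + 1) := by positivity
      rw [Metric.mem_closedBall, dist_eq_norm, hu, add_sub_cancel_left, Complex.norm_real,
        Real.norm_of_nonneg h2.le]
      exact h1)
    refine aestronglyMeasurable_of_tendsto_ae atTop
        (f := fun n r => slope (fun z => G z r) z₀ (u n))
      (fun n => ?_) ?_
    · simp only [slope_def_module]
      exact ((hmeas _ (humem n)).sub (hmeas _ hz₀)).const_smul _
    · rw [hIoc]
      refine (MeasureTheory.ae_restrict_mem measurableSet_Ioc).mono fun r hr => ?_
      exact (hasDerivAt_iff_tendsto_slope.1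
        (hderiv r (Ioc_subset_Icc_self hr) z₀ hz₀)).comp hulim
  have key := intervalIntegral.hasDerivAt_integral_of_dominated_loc_of_deriv_le
    (μ := MeasureTheory.volume) (a := 0) (b := 1) (F := G) (x₀ := z₀)
    (F' := fun z r => deriv (fun z => G z r) z) (bound := fun _ => C / (ρ / 2))
    (Metric.ball_mem_nhds z₀ (half_pos hρ))
    (Filter.Eventually.mono (show ∀ᶠ z in 𝓝 z₀, z ∈ U from hU.mem_nhds hz₀) hmeas)
    ((hsec z₀ hz₀).intervalIntegrable_of_Icc zero_le_one) hmeas'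
    (Eventually.of_forall fun r hr z hz => by
      rw [hIoc] at hr
      have hr' := Ioc_subset_Icc_self hr
      refine Complex.norm_deriv_le_of_forall_mem_sphere_norm_le (half_pos hρ) ?_ fun w hw =>
        hC (w, r) ⟨hball2 z hz (Metric.sphere_subset_closedBall hw), hr'⟩
      exact ((hd r hr').mono ((hball2 z hz).trans hball)).diffContOnCl_ball le_rfl)
    intervalIntegrable_const
    (Eventually.of_forall fun r hr z hz => by
      rw [hIoc] at hr
      exact hderiv r (Ioc_subset_Icc_self hr) z
        (hball (Metric.ball_subset_closedBall (Metric.ball_subset_ball (by linarith) hz))))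
  exact key.2.differentiableAt.differentiableWithinAt

/-- A kernel `g` for Volterra equations `Y t = b t + ∫₀¹ g t r (Y (t r)) dr` on `[0, 1]`, in the
neighbourhood of size `R wt` of a reference function `Z`; the weight `wt` makes the integral
operator a contraction. -/
structure IsVolterraKernel (g : ℝ → ℝ → ℂ × ℂ → ℂ × ℂ) (k : ℝ → ℝ → ℝ) (wt : ℝ → ℝ)
    (Z : ℝ → ℂ × ℂ) (R : ℝ) : Prop where
  pos : 0 < R
  continuous_weight : ContinuousOn wt (Icc 0 1)
  weight_pos : ∀ t ∈ Icc (0 : ℝ) 1, 0 < wt t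
  continuous_ref : ContinuousOn Z (Icc 0 1)
  continuous_kernel : ContinuousOn (fun w : (ℝ × ℝ) × ℂ × ℂ => g w.1.1 w.1.2 w.2)
    {w | w.1.1 ∈ Icc (0 : ℝ) 1 ∧ w.1.2 ∈ Icc (0 : ℝ) 1 ∧
      ‖w.2 - Z (w.1.1 * w.1.2)‖ ≤ R * wt (w.1.1 * w.1.2)}
  differentiable : ∀ t ∈ Icc (0 : ℝ) 1, ∀ r ∈ Icc (0 : ℝ) 1, ∀ u, ‖u - Z (t * r)‖ ≤ R * wt (t * r) →
    DifferentiableAt ℂ (g t r) u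
  lipschitz : ∀ t ∈ Icc (0 : ℝ) 1, ∀ r ∈ Icc (0 : ℝ) 1, ∀ u v, ‖u - Z (t * r)‖ ≤ R * wt (t * r) →
    ‖v - Z (t * r)‖ ≤ R * wt (t * r) → ‖g t r u - g t r v‖ ≤ k t r * ‖u - v‖
  bound_nonneg : ∀ t ∈ Icc (0 : ℝ) 1, ∀ r ∈ Icc (0 : ℝ) 1, 0 ≤ k t r
  continuous_bound : ∀ t ∈ Icc (0 : ℝ) 1, ContinuousOn (k t) (Icc 0 1)
  contract : ∀ t ∈ Icc (0 : ℝ) 1, ∫ r in (0 : ℝ)..1, k t r * wt (t * r) ≤ wt t / 4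

lemma mul_mem_unitInterval {t r : ℝ} (ht : t ∈ Icc (0 : ℝ) 1) (hr : r ∈ Icc (0 : ℝ) 1) :
    t * r ∈ Icc (0 : ℝ) 1 :=
  ⟨mul_nonneg ht.1 hr.1, mul_le_one₀ ht.2 hr.1 hr.2⟩

namespace IsVolterraKernel

variable {g : ℝ → ℝ → ℂ × ℂ → ℂ × ℂ} {k : ℝ → ℝ → ℝ} {wt : ℝ → ℝ} {Z : ℝ → ℂ × ℂ} {R : ℝ}

/-- The substitution of a family of functions near the reference function into the kernel. -/
lemma continuousOn_subst {P : Type*} [TopologicalSpace P] (h : IsVolterraKernel g k wt Z R)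
    {V : Set P} {Y : P → ℝ → ℂ × ℂ} (hY : ContinuousOn (Function.uncurry Y) (V ×ˢ Icc 0 1))
    (hb : ∀ η ∈ V, ∀ t ∈ Icc (0 : ℝ) 1, ‖Y η t - Z t‖ ≤ R * wt t) :
    ContinuousOn (Function.uncurry fun (w : P × ℝ) r => g w.2 r (Y w.1 (w.2 * r)))
      ((V ×ˢ Icc 0 1) ×ˢ Icc 0 1) := by
  have h1 : ContinuousOn (fun w : (P × ℝ) × ℝ => Y w.1.1 (w.1.2 * w.2))
      ((V ×ˢ Icc 0 1) ×ˢ Icc 0 1) :=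
    hY.comp (f := fun w : (P × ℝ) × ℝ => (w.1.1, w.1.2 * w.2)) (by fun_prop)
      fun w hw => ⟨hw.1.1, mul_mem_unitInterval hw.1.2 hw.2⟩
  exact h.continuous_kernel.comp
    (f := fun w : (P × ℝ) × ℝ => ((w.1.2, w.2), Y w.1.1 (w.1.2 * w.2)))
    ((by fun_prop : ContinuousOn (fun w : (P × ℝ) × ℝ => (w.1.2, w.2)) _).prodMk h1)
    fun w hw => ⟨hw.1.2, hw.2, hb _ hw.1.1 _ (mul_mem_unitInterval hw.1.2 hw.2)⟩

lemma continuousOn_subst_single (h : IsVolterraKernel g k wt Z R) {Y : ℝ → ℂ × ℂ}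
    (hY : ContinuousOn Y (Icc 0 1)) (hb : ∀ t ∈ Icc (0 : ℝ) 1, ‖Y t - Z t‖ ≤ R * wt t)
    {t : ℝ} (ht : t ∈ Icc (0 : ℝ) 1) :
    ContinuousOn (fun r => g t r (Y (t * r))) (Icc 0 1) := by
  have h1 := h.continuousOn_subst (P := Unit) (V := univ) (Y := fun _ => Y)
    (hY.comp continuousOn_snd fun w hw => hw.2) fun _ _ => hb
  exact h1.comp (f := fun r => (((), t), r)) (by fun_prop) fun r hr => ⟨⟨mem_univ _, ht⟩, hr⟩

lemma norm_integral_sub_le (h : IsVolterraKernel g k wt Z R) {Y₁ Y₂ : ℝ → ℂ × ℂ}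
    (hY₁ : ContinuousOn Y₁ (Icc 0 1)) (hY₂ : ContinuousOn Y₂ (Icc 0 1))
    (hb₁ : ∀ t ∈ Icc (0 : ℝ) 1, ‖Y₁ t - Z t‖ ≤ R * wt t)
    (hb₂ : ∀ t ∈ Icc (0 : ℝ) 1, ‖Y₂ t - Z t‖ ≤ R * wt t) {c : ℝ}
    (hc : ∀ t ∈ Icc (0 : ℝ) 1, ‖Y₁ t - Y₂ t‖ ≤ c * wt t) {t : ℝ} (ht : t ∈ Icc (0 : ℝ) 1) :
    ‖(∫ r in (0 : ℝ)..1, g t r (Y₁ (t * r))) - ∫ r in (0 : ℝ)..1, g t r (Y₂ (t * r))‖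
      ≤ c / 4 * wt t := by
  have hc0 : 0 ≤ c := by
    by_contra hneg
    have h1 := (norm_nonneg _).trans (hc t ht)
    have := mul_neg_of_neg_of_pos (not_le.1 hneg) (h.weight_pos t ht)
    linarith
  have i1 := (h.continuousOn_subst_single hY₁ hb₁ ht).intervalIntegrable_of_Icc zero_le_one
    (μ := MeasureTheory.volume)
  have i2 := (h.continuousOn_subst_single hY₂ hb₂ ht).intervalIntegrable_of_Icc zero_le_one
    (μ := MeasureTheory.volume)
  rw [← intervalIntegral.integral_sub i1 i2]
  have hcont : ContinuousOn (fun r => c * (k t r * wt (t * r))) (Icc 0 1) :=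
    continuousOn_const.mul ((h.continuous_bound t ht).mul
      (h.continuous_weight.comp (by fun_prop) fun r hr => mul_mem_unitInterval ht hr))
  have h1 := intervalIntegral.norm_integral_le_of_norm_le (μ := MeasureTheory.volume)
    (a := 0) (b := 1) (f := fun r => g t r (Y₁ (t * r)) - g t r (Y₂ (t * r)))
    (g := fun r => c * (k t r * wt (t * r))) zero_le_one
    (Eventually.of_forall fun r hr => by
      have hr' := Ioc_subset_Icc_self hr
      have hm := mul_mem_unitInterval ht hr'
      calc _ ≤ k t r * ‖Y₁ (t * r) - Y₂ (t * r)‖ :=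
            h.lipschitz t ht r hr' _ _ (hb₁ _ hm) (hb₂ _ hm)
        _ ≤ k t r * (c * wt (t * r)) :=
            mul_le_mul_of_nonneg_left (hc _ hm) (h.bound_nonneg t ht r hr')
        _ = c * (k t r * wt (t * r)) := by ring)
    (hcont.intervalIntegrable_of_Icc zero_le_one)
  rw [intervalIntegral.integral_const_mul] at h1
  calc _ ≤ c * ∫ r in (0 : ℝ)..1, k t r * wt (t * r) := h1
    _ ≤ c * (wt t / 4) := mul_le_mul_of_nonneg_left (h.contract t ht) hc0
    _ = c / 4 * wt t := by ring

/-- Solutions depend on the inhomogeneous term in a Lipschitz way; in particular they are unique. -/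
lemma norm_sub_le (h : IsVolterraKernel g k wt Z R) {Y₁ Y₂ b₁ b₂ : ℝ → ℂ × ℂ}
    (hY₁ : ContinuousOn Y₁ (Icc 0 1)) (hY₂ : ContinuousOn Y₂ (Icc 0 1))
    (hb₁ : ∀ t ∈ Icc (0 : ℝ) 1, ‖Y₁ t - Z t‖ ≤ R * wt t)
    (hb₂ : ∀ t ∈ Icc (0 : ℝ) 1, ‖Y₂ t - Z t‖ ≤ R * wt t)
    (he₁ : ∀ t ∈ Icc (0 : ℝ) 1, Y₁ t = b₁ t + ∫ r in (0 : ℝ)..1, g t r (Y₁ (t * r)))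
    (he₂ : ∀ t ∈ Icc (0 : ℝ) 1, Y₂ t = b₂ t + ∫ r in (0 : ℝ)..1, g t r (Y₂ (t * r)))
    {c : ℝ} (hc : ∀ t ∈ Icc (0 : ℝ) 1, ‖b₁ t - b₂ t‖ ≤ c * wt t) :
    ∀ t ∈ Icc (0 : ℝ) 1, ‖Y₁ t - Y₂ t‖ ≤ 4 / 3 * c * wt t := by
  obtain ⟨t₀, ht₀, hmax⟩ := isCompact_Icc.exists_isMaxOn (nonempty_Icc.2 zero_le_one)
    (f := fun t => ‖Y₁ t - Y₂ t‖ / wt t)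
    ((hY₁.sub hY₂).norm.div h.continuous_weight fun t ht => (h.weight_pos t ht).ne')
  set D := ‖Y₁ t₀ - Y₂ t₀‖ / wt t₀ with hD
  have hle : ∀ t ∈ Icc (0 : ℝ) 1, ‖Y₁ t - Y₂ t‖ ≤ D * wt t := fun t ht => by
    have := hmax ht
    simp only [mem_ofPred_eq] at this
    rwa [div_le_iff₀ (h.weight_pos t ht)] at this
  -- at the maximum of the weighted distance the contraction absorbs a quarter of it
  have hstep : D ≤ c + D / 4 := by
    rw [hD, div_le_iff₀ (h.weight_pos t₀ ht₀), ← hD]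
    have h1 := h.norm_integral_sub_le hY₁ hY₂ hb₁ hb₂ hle ht₀
    have h2 := hc t₀ ht₀
    rw [he₁ t₀ ht₀, he₂ t₀ ht₀, add_sub_add_comm]
    exact (norm_add_le _ _).trans (by linarith)
  intro t ht
  refine (hle t ht).trans (mul_le_mul_of_nonneg_right ?_ (h.weight_pos t ht).le)
  linarith

/-- Solvability, with holomorphic dependence on a parameter of the inhomogeneous term. -/
theorem exists_solution (h : IsVolterraKernel g k wt Z R) {U : Set ℂ} (hU : IsOpen U)
    {b : ℂ → ℝ → ℂ × ℂ} (hbc : ContinuousOn (Function.uncurry b) (U ×ˢ Icc 0 1))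
    (hbd : ∀ t ∈ Icc (0 : ℝ) 1, DifferentiableOn ℂ (fun η => b η t) U)
    (hb : ∀ η ∈ U, ∀ t ∈ Icc (0 : ℝ) 1,
      ‖b η t + (∫ r in (0 : ℝ)..1, g t r (Z (t * r))) - Z t‖ ≤ R / 2 * wt t) :
    ∃ Y : ℂ → ℝ → ℂ × ℂ, (∀ η ∈ U, ContinuousOn (Y η) (Icc 0 1)) ∧
      (∀ η ∈ U, ∀ t ∈ Icc (0 : ℝ) 1, ‖Y η t - Z t‖ ≤ R * wt t) ∧
      (∀ η ∈ U, ∀ t ∈ Icc (0 : ℝ) 1,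
        Y η t = b η t + ∫ r in (0 : ℝ)..1, g t r (Y η (t * r))) ∧
      ∀ t ∈ Icc (0 : ℝ) 1, DifferentiableOn ℂ (fun η => Y η t) U := by
  classical
  let T : (ℂ → ℝ → ℂ × ℂ) → ℂ → ℝ → ℂ × ℂ := fun Y η t =>
    b η t + ∫ r in (0 : ℝ)..1, g t r (Y η (t * r))
  -- Picard iterates, holomorphic in the parameter, that start at the reference function
  let Yn : ℕ → ℂ → ℝ → ℂ × ℂ := fun n => T^[n] fun _ => Z
  have hsucc : ∀ n, Yn (n + 1) = T (Yn n) := fun n => Function.iterate_succ_apply' T n _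
  have hsec : ∀ {Y : ℂ → ℝ → ℂ × ℂ}, ContinuousOn (Function.uncurry Y) (U ×ˢ Icc 0 1) →
      ∀ η ∈ U, ContinuousOn (Y η) (Icc 0 1) := fun hY η hη =>
    hY.comp (continuousOn_const.prodMk continuousOn_id) fun t ht => ⟨hη, ht⟩
  have hinv : ∀ n, ContinuousOn (Function.uncurry (Yn n)) (U ×ˢ Icc 0 1) ∧
      (∀ t ∈ Icc (0 : ℝ) 1, DifferentiableOn ℂ (fun η => Yn n η t) U) ∧
      (∀ η ∈ U, ∀ t ∈ Icc (0 : ℝ) 1, ‖Yn n η t - Z t‖ ≤ (1 - (1 / 2) ^ n) * R * wt t) ∧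
      ∀ η ∈ U, ∀ t ∈ Icc (0 : ℝ) 1, ‖Yn (n + 1) η t - Yn n η t‖ ≤ R / 2 * (1 / 2) ^ n * wt t := by
    have hball : ∀ n : ℕ, ∀ t ∈ Icc (0 : ℝ) 1, (1 - (1 / 2 : ℝ) ^ n) * R * wt t ≤ R * wt t :=
      fun n t ht => by
        have h1 : (0 : ℝ) ≤ (1 / 2) ^ n := by positivity
        have h2 := mul_nonneg h1 (mul_nonneg h.pos.le (h.weight_pos t ht).le)
        linarith
    have hcontT : ∀ {Y : ℂ → ℝ → ℂ × ℂ}, ContinuousOn (Function.uncurry Y) (U ×ˢ Icc 0 1) →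
        (∀ η ∈ U, ∀ t ∈ Icc (0 : ℝ) 1, ‖Y η t - Z t‖ ≤ R * wt t) →
        ContinuousOn (Function.uncurry (T Y)) (U ×ˢ Icc 0 1) := fun hY hYb =>
      hbc.add (continuousOn_parametric_integral (h.continuousOn_subst hY hYb))
    have hdiffT : ∀ {Y : ℂ → ℝ → ℂ × ℂ}, ContinuousOn (Function.uncurry Y) (U ×ˢ Icc 0 1) →
        (∀ η ∈ U, ∀ t ∈ Icc (0 : ℝ) 1, ‖Y η t - Z t‖ ≤ R * wt t) →
        (∀ t ∈ Icc (0 : ℝ) 1, DifferentiableOn ℂ (fun η => Y η t) U) →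
        ∀ t ∈ Icc (0 : ℝ) 1, DifferentiableOn ℂ (fun η => T Y η t) U := by
      intro Y hY hYb hYd t ht
      refine (hbd t ht).add (differentiableOn_parametric_integral hU
        ((h.continuousOn_subst hY hYb).comp (f := fun w : ℂ × ℝ => ((w.1, t), w.2)) (by fun_prop)
          fun w hw => ⟨⟨hw.1, ht⟩, hw.2⟩) fun r hr η hη => ?_)
      have hm := mul_mem_unitInterval ht hr
      exact (h.differentiable t ht r hr _ (hYb η hη _ hm)).comp_differentiableWithinAt
        (f := fun η => Y η (t * r)) η (hYd _ hm η hη)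
    intro n
    induction n with
    | zero =>
      refine ⟨h.continuous_ref.comp continuousOn_snd fun w hw => hw.2,
        fun t ht => differentiableOn_const _, fun η hη t ht => by simp [Yn], fun η hη t ht => ?_⟩
      rw [hsucc]
      simpa [Yn, T] using hb η hη t ht
    | succ n ih =>
      obtain ⟨ih1, ih2, ih3, ih4⟩ := ih
      have ihb : ∀ η ∈ U, ∀ t ∈ Icc (0 : ℝ) 1, ‖Yn n η t - Z t‖ ≤ R * wt t :=
        fun η hη t ht => (ih3 η hη t ht).trans (hball n t ht)
      have hc1 : ContinuousOn (Function.uncurry (Yn (n + 1))) (U ×ˢ Icc 0 1) := by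
        rw [hsucc]; exact hcontT ih1 ihb
      have hb1 : ∀ η ∈ U, ∀ t ∈ Icc (0 : ℝ) 1,
          ‖Yn (n + 1) η t - Z t‖ ≤ (1 - (1 / 2) ^ (n + 1)) * R * wt t := fun η hη t ht => by
        have h1 := ih3 η hη t ht
        have h2 := ih4 η hη t ht
        calc _ = ‖(Yn (n + 1) η t - Yn n η t) + (Yn n η t - Z t)‖ := by rw [sub_add_sub_cancel]
          _ ≤ _ := (norm_add_le _ _).trans (add_le_add h2 h1)
          _ = _ := by ring
      refine ⟨hc1, by rw [hsucc]; exact hdiffT ih1 ihb ih2, hb1, fun η hη t ht => ?_⟩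
      have h1 := h.norm_integral_sub_le (hsec hc1 η hη) (hsec ih1 η hη)
        (fun t ht => (hb1 η hη t ht).trans (hball _ t ht)) (ihb η hη) (ih4 η hη) ht
      have h2 : Yn (n + 1 + 1) η t - Yn (n + 1) η t
          = (∫ r in (0 : ℝ)..1, g t r (Yn (n + 1) η (t * r)))
            - ∫ r in (0 : ℝ)..1, g t r (Yn n η (t * r)) := by
        rw [congrFun (congrFun (hsucc (n + 1)) η) t]
        nth_rewrite 2 [hsucc n]
        simp only [T, add_sub_add_left_eq_sub]
      rw [h2]
      refine h1.trans (mul_le_mul_of_nonneg_right ?_ (h.weight_pos t ht).le)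
      have h3 := mul_pos h.pos (pow_pos (show (0 : ℝ) < 1 / 2 by norm_num) n)
      rw [pow_succ]
      linarith
  -- the iterates converge geometrically, uniformly in the parameter
  have hstep : ∀ η ∈ U, ∀ t ∈ Icc (0 : ℝ) 1, ∀ n,
      dist (Yn n η t) (Yn (n + 1) η t) ≤ R * wt t / 2 / 2 ^ n := fun η hη t ht n => by
    rw [dist_comm, dist_eq_norm]
    refine ((hinv n).2.2.2 η hη t ht).trans_eq ?_
    rw [one_div, inv_pow]
    ring
  have hex : ∀ η t, ∃ L, η ∈ U → t ∈ Icc (0 : ℝ) 1 → Tendsto (fun n => Yn n η t) atTop (𝓝 L) := by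
    intro η t
    by_cases hη : η ∈ U
    · by_cases ht : t ∈ Icc (0 : ℝ) 1
      · obtain ⟨L, hL⟩ := cauchySeq_tendsto_of_complete (cauchySeq_of_le_geometric_two
          (hstep η hη t ht))
        exact ⟨L, fun _ _ => hL⟩
      · exact ⟨0, fun _ h => absurd h ht⟩
    · exact ⟨0, fun h => absurd h hη⟩
  choose Y hY using hex
  have hdist : ∀ η ∈ U, ∀ t ∈ Icc (0 : ℝ) 1, ∀ n, ‖Yn n η t - Y η t‖ ≤ R / 2 ^ n * wt t :=
    fun η hη t ht n => by
      have := dist_le_of_le_geometric_two_of_tendsto (hstep η hη t ht) (hY η t hη ht) n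
      rw [dist_eq_norm] at this
      exact this.trans_eq (by ring)
  obtain ⟨M, hM⟩ := isCompact_Icc.exists_bound_of_continuousOn h.continuous_weight
  have hunif : ∀ ε > 0, ∃ N : ℕ, ∀ n ≥ N, ∀ η ∈ U, ∀ t ∈ Icc (0 : ℝ) 1,
      ‖Yn n η t - Y η t‖ < ε := by
    intro ε hε
    have h1 : Tendsto (fun n : ℕ => R * M * (1 / 2 : ℝ) ^ n) atTop (𝓝 0) := by
      simpa using (tendsto_pow_atTop_nhds_zero_of_lt_one (by norm_num : (0 : ℝ) ≤ 1 / 2)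
        (by norm_num)).const_mul (R * M)
    obtain ⟨N, hN⟩ := eventually_atTop.1 (h1.eventually (gt_mem_nhds hε))
    refine ⟨N, fun n hn η hη t ht => (hdist η hη t ht n).trans_lt (lt_of_le_of_lt ?_ (hN n hn))⟩
    have h2 : wt t ≤ M := (le_abs_self _).trans (hM t ht)
    have h3 : R / 2 ^ n * wt t ≤ R / 2 ^ n * M :=
      mul_le_mul_of_nonneg_left h2 (div_nonneg h.pos.le (by positivity))
    refine h3.trans_eq ?_
    rw [one_div, inv_pow]
    ring
  have hYb : ∀ η ∈ U, ∀ t ∈ Icc (0 : ℝ) 1, ‖Y η t - Z t‖ ≤ R * wt t := fun η hη t ht => by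
    refine le_of_tendsto ((hY η t hη ht).sub_const (Z t)).norm (Eventually.of_forall fun n =>
      ((hinv n).2.2.1 η hη t ht).trans ?_)
    have h1 : (0 : ℝ) ≤ (1 / 2) ^ n := by positivity
    have h2 := mul_nonneg h1 (mul_nonneg h.pos.le (h.weight_pos t ht).le)
    linarith
  have hYc : ∀ η ∈ U, ContinuousOn (Y η) (Icc 0 1) := fun η hη => by
    refine TendstoUniformlyOn.continuousOn (F := fun n t => Yn n η t) (p := atTop) ?_
      (Frequently.of_forall fun n => hsec (hinv n).1 η hη)
    rw [Metric.tendstoUniformlyOn_iff]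
    intro ε hε
    obtain ⟨N, hN⟩ := hunif ε hε
    filter_upwards [eventually_ge_atTop N] with n hn t ht
    rw [dist_comm, dist_eq_norm]
    exact hN n hn η hη t ht
  refine ⟨Y, hYc, hYb, fun η hη t ht => ?_, fun t ht => ?_⟩
  · have h1 : Tendsto (fun n => Yn (n + 1) η t) atTop (𝓝 (Y η t)) :=
      (hY η t hη ht).comp (tendsto_add_atTop_nat 1)
    refine tendsto_nhds_unique h1 ?_
    rw [tendsto_iff_norm_sub_tendsto_zero]
    have h2 : Tendsto (fun n : ℕ => R * (1 / 2 : ℝ) ^ n / 4 * wt t) atTop (𝓝 0) := by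
      simpa using (((tendsto_pow_atTop_nhds_zero_of_lt_one (by norm_num : (0 : ℝ) ≤ 1 / 2)
        (by norm_num)).const_mul R).div_const 4).mul_const (wt t)
    refine squeeze_zero (fun n => norm_nonneg _) (fun n => ?_) h2
    rw [hsucc]
    simp only [T, add_sub_add_left_eq_sub]
    refine h.norm_integral_sub_le (hsec (hinv n).1 η hη) (hYc η hη) (fun t ht => ?_) (hYb η hη)
      (fun t ht => ?_) ht
    · refine ((hinv n).2.2.1 η hη t ht).trans ?_
      have h1 : (0 : ℝ) ≤ (1 / 2) ^ n := by positivity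
      have h2 := mul_nonneg h1 (mul_nonneg h.pos.le (h.weight_pos t ht).le)
      linarith
    · refine (hdist η hη t ht n).trans_eq ?_
      rw [one_div, inv_pow]
      ring
  · refine TendstoLocallyUniformlyOn.differentiableOn (F := fun n η => Yn n η t) (φ := atTop) ?_
      (Eventually.of_forall fun n => (hinv n).2.1 t ht) hU
    refine TendstoUniformlyOn.tendstoLocallyUniformlyOn ?_
    rw [Metric.tendstoUniformlyOn_iff]
    intro ε hε
    obtain ⟨N, hN⟩ := hunif ε hε
    filter_upwards [eventually_ge_atTop N] with n hn η hη
    rw [dist_comm, dist_eq_norm]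
    exact hN n hn η hη t ht

end IsVolterraKernel

end Volterra

/-! ### The equation at the pole -/

section Pole

/-- The entire function `θ` with `sin w = w + w ^ 3 θ w`. -/
noncomputable def sinCubic : ℂ → ℂ := dslope (dslope (dslope Complex.sin 0) 0) 0

lemma differentiable_dslope {f : ℂ → ℂ} (hf : Differentiable ℂ f) (c : ℂ) :
    Differentiable ℂ (dslope f c) :=
  differentiableOn_univ.1 ((Complex.differentiableOn_dslope univ_mem).2 hf.differentiableOn)

lemma differentiable_sinCubic : Differentiable ℂ sinCubic :=
  differentiable_dslope (differentiable_dslope (differentiable_dslope Complex.differentiable_sin 0)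
    0) 0

lemma sin_eq_sinCubic (w : ℂ) : Complex.sin w = w + w ^ 3 * sinCubic w := by
  set s1 := dslope Complex.sin 0 with hs1
  have h1 : ∀ w, w * s1 w = Complex.sin w := fun w => by
    simpa using sub_smul_dslope Complex.sin 0 w
  have h10 : s1 0 = 1 := by rw [hs1, dslope_same, Complex.deriv_sin, Complex.cos_zero]
  have heven : ∀ w, s1 (-w) = s1 w := fun w => by
    rcases eq_or_ne w 0 with rfl | hw
    · simp
    · have h2 := h1 (-w)
      rw [Complex.sin_neg, ← h1 w, neg_mul, neg_inj] at h2
      exact mul_left_cancel₀ hw h2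
  have hd : deriv s1 0 = 0 := by
    have h2 : deriv (fun w => s1 (-w)) 0 = deriv s1 0 := by rw [funext heven]
    rw [deriv_comp_neg, neg_zero] at h2
    exact self_eq_neg.1 h2.symm
  have h2 : w * dslope s1 0 w = s1 w - 1 := by simpa [h10] using sub_smul_dslope s1 0 w
  have h3 : w * sinCubic w = dslope s1 0 w := by
    simpa [hd, sinCubic, ← hs1] using sub_smul_dslope (dslope s1 0) 0 w
  linear_combination (-1 : ℂ) * h1 w - w * h2 - w ^ 2 * h3

lemma sinCubic_conj (w : ℂ) : sinCubic (starRingEnd ℂ w) = starRingEnd ℂ (sinCubic w) := by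
  refine congrFun (Continuous.ext_on (dense_compl_singleton (0 : ℂ))
    (differentiable_sinCubic.continuous.comp Complex.continuous_conj)
    (Complex.continuous_conj.comp differentiable_sinCubic.continuous) fun w hw => ?_) w
  have hw' : starRingEnd ℂ w ^ 3 ≠ 0 := pow_ne_zero _ ((map_ne_zero _).2 hw)
  have h1 := sin_eq_sinCubic (starRingEnd ℂ w)
  have h2 := congrArg (starRingEnd ℂ) (sin_eq_sinCubic w)
  rw [← Complex.sin_conj, h1, map_add, map_mul, map_pow] at h2
  exact mul_left_cancel₀ hw' (add_left_cancel h2)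

/-- The entire function `sin w / w`. -/
noncomputable def sinQuotient (w : ℂ) : ℂ := 1 + w ^ 2 * sinCubic w

lemma mul_sinQuotient (w : ℂ) : w * sinQuotient w = Complex.sin w := by
  rw [sin_eq_sinCubic, sinQuotient]
  ring

/-- The holomorphic extension of `metricCoeff`. -/
noncomputable def complexMetric (a : ℝ) (w : ℂ) : ℂ := 1 + ((a : ℂ) ^ 2 - 1) * Complex.sin w ^ 2

lemma complexMetric_ofReal (a t : ℝ) : complexMetric a t = metricCoeff a t := by
  have h : metricCoeff a t = 1 + (a ^ 2 - 1) * Real.sin t ^ 2 := by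
    rw [metricCoeff, Real.cos_sq']
    ring
  rw [h, complexMetric]
  push_cast
  ring

lemma contDiff_complexMetric {n : WithTop ℕ∞} (a : ℝ) : ContDiff ℂ n (complexMetric a) := by
  unfold complexMetric
  exact contDiff_const.add (contDiff_const.mul (Complex.contDiff_sin.pow 2))

/-- `sin w cos w / complexMetric a w = w + w ^ 3 * potentialExcess a w`. -/
noncomputable def potentialExcess (a : ℝ) (w : ℂ) : ℂ :=
  (4 * sinCubic (2 * w) - ((a : ℂ) ^ 2 - 1) * sinQuotient w ^ 2) / complexMetric a w

/-- `(a ^ 2 - 1) * sin w * cos w / complexMetric a w = w * dragQuotient a w`. -/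
noncomputable def dragQuotient (a : ℝ) (w : ℂ) : ℂ :=
  ((a : ℂ) ^ 2 - 1) * (sinQuotient w * Complex.cos w) / complexMetric a w

lemma sin_mul_cos_div_complexMetric {a : ℝ} {w : ℂ} (h : complexMetric a w ≠ 0) :
    Complex.sin w * Complex.cos w / complexMetric a w = w + w ^ 3 * potentialExcess a w := by
  have h1 := sin_eq_sinCubic (2 * w)
  rw [Complex.sin_two_mul] at h1
  have h2 : complexMetric a w = 1 + ((a : ℂ) ^ 2 - 1) * (w * sinQuotient w) ^ 2 := by
    rw [mul_sinQuotient, complexMetric]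
  rw [potentialExcess, div_eq_iff h, add_mul, mul_assoc, div_mul_cancel₀ _ h, h2]
  linear_combination h1 / 2

lemma mul_dragQuotient (a : ℝ) (w : ℂ) :
    w * dragQuotient a w
      = ((a : ℂ) ^ 2 - 1) * (Complex.sin w * Complex.cos w) / complexMetric a w := by
  rw [dragQuotient, ← mul_sinQuotient]
  ring

/-- `2 / (1 + ρ ^ 2)`, the quotient of the sine of the colatitude by `ρ = exp x`. -/
noncomputable def stereoFactor (ρ : ℂ) : ℂ := 2 / (1 + ρ ^ 2)

/-- The coefficient `baseCoeff` as a rational function of `ρ = exp x`. -/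
noncomputable def stereoBase (a : ℝ) (ρ : ℂ) : ℂ :=
  1 + ((a : ℂ) ^ 2 - 1) * (ρ * stereoFactor ρ) ^ 2

lemma colatSin_eq_stereo (x : ℝ) :
    (colatSin x : ℂ) = Real.exp x * stereoFactor (Real.exp x) := by
  have h := Real.exp_pos x
  have h1 : colatSin x = Real.exp x * (2 / (1 + Real.exp x ^ 2)) := by
    rw [colatSin, Real.cosh_eq, Real.exp_neg]
    field_simp
    ring
  rw [h1, stereoFactor]
  push_cast
  rfl

lemma colatCos_eq_stereo (x : ℝ) :
    (colatCos x : ℂ) = 1 - (Real.exp x : ℂ) ^ 2 * stereoFactor (Real.exp x) := by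
  have h := Real.exp_pos x
  have h1 : colatCos x = 1 - Real.exp x ^ 2 * (2 / (1 + Real.exp x ^ 2)) := by
    rw [colatCos, Real.cosh_eq, Real.sinh_eq, Real.exp_neg]
    field_simp
    ring
  rw [h1, stereoFactor]
  push_cast
  rfl

lemma baseCoeff_eq_stereo (a x : ℝ) : (baseCoeff a x : ℂ) = stereoBase a (Real.exp x) := by
  have h1 : baseCoeff a x = 1 + (a ^ 2 - 1) * colatSin x ^ 2 := by
    have := colatSin_sq_add_colatCos_sq x
    unfold baseCoeff
    linear_combination this
  rw [h1, stereoBase, ← colatSin_eq_stereo]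
  push_cast
  rfl

/-- With `y = ρ ^ d * G`, `y' = ρ ^ d * (d * G + ρ * H)` and `ρ = exp x`, the Euler-Lagrange
equation reads `ρ dH/dρ + (2 d + n + 1) H = ρ * poleForce`; the force has no pole at `ρ = 0`. The
argument `u` is the pair `(G, H)`. -/
noncomputable def poleForce (n d : ℕ) (a : ℝ) (ρ : ℂ) (u : ℂ × ℂ) : ℂ :=
  ((a : ℂ) ^ 2 - 1) * stereoFactor ρ ^ 2 * ((d : ℂ) * (d + n)) * u.1
    + stereoBase a ρ * ((d : ℂ) * (d + n)) * ρ ^ (2 * (d - 1)) * u.1 ^ 3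
      * potentialExcess a (ρ ^ d * u.1)
    + (n * stereoFactor ρ + ((a : ℂ) ^ 2 - 1) * stereoFactor ρ ^ 2
      * (1 - ρ ^ 2 * stereoFactor ρ) / stereoBase a ρ) * (d * u.1 + ρ * u.2)
    - ρ ^ (2 * (d - 1)) * u.1 * dragQuotient a (ρ ^ d * u.1) * (d * u.1 + ρ * u.2) ^ 2

lemma profileAccel_eq_poleForce {n d : ℕ} (hd : 1 ≤ d) {a : ℝ} (ha : a ≠ 0) (x G H : ℝ) :
    (profileAccel n (d * (d + n)) a x (Real.exp x ^ d * G)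
        (Real.exp x ^ d * (d * G + Real.exp x * H)) : ℂ)
      = (Real.exp x : ℂ) ^ d * (d ^ 2 * G - n * (Real.exp x * H)
        + (Real.exp x : ℂ) ^ 2 * poleForce n d a (Real.exp x) (G, H)) := by
  obtain ⟨e, rfl⟩ : ∃ e, d = e + 1 := ⟨d - 1, by omega⟩
  have hM : complexMetric a ((Real.exp x ^ (e + 1) * G : ℝ) : ℂ) ≠ 0 := by
    rw [complexMetric_ofReal]
    exact_mod_cast (metricCoeff_pos ha _).ne'
  have h1 := sin_mul_cos_div_complexMetric hM
  have h2 := mul_dragQuotient a ((Real.exp x ^ (e + 1) * G : ℝ) : ℂ)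
  rw [poleForce, profileAccel]
  push_cast [-Complex.ofReal_exp] at h1 h2 ⊢
  rw [mul_div_assoc, ← complexMetric_ofReal, colatSin_eq_stereo, colatCos_eq_stereo,
    baseCoeff_eq_stereo]
  push_cast [-Complex.ofReal_exp]
  rw [h1, ← h2, stereoBase]
  generalize (Real.exp x : ℂ) = r
  generalize stereoFactor r = κ
  generalize potentialExcess a _ = E
  generalize dragQuotient a _ = D
  generalize hm : 1 + ((a : ℂ) ^ 2 - 1) * (r * κ) ^ 2 = m
  rw [← hm]
  ring

lemma poleForce_conj (n d : ℕ) (a ρ : ℝ) (u : ℂ × ℂ) :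
    poleForce n d a ρ (starRingEnd ℂ u.1, starRingEnd ℂ u.2)
      = starRingEnd ℂ (poleForce n d a ρ u) := by
  simp only [poleForce, potentialExcess, dragQuotient, complexMetric, sinQuotient, stereoBase,
    stereoFactor, map_add, map_sub, map_mul, map_div₀, map_pow, map_one, Complex.conj_ofReal,
    map_natCast, ← Complex.sin_conj, ← Complex.cos_conj, ← sinCubic_conj, map_ofNat]

lemma contDiffAt_poleForce {n d : ℕ} {a : ℝ} {w : ℂ × ℂ × ℂ} {m : WithTop ℕ∞}
    (h1 : 1 + w.1 ^ 2 ≠ 0) (h2 : stereoBase a w.1 ≠ 0)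
    (h3 : complexMetric a (w.1 ^ d * w.2.1) ≠ 0) :
    ContDiffAt ℂ m (fun w : ℂ × ℂ × ℂ => poleForce n d a w.1 w.2) w := by
  have c1 : ContDiffAt ℂ m (fun w : ℂ × ℂ × ℂ => stereoFactor w.1) w := by
    unfold stereoFactor
    exact contDiffAt_const.div (by fun_prop) h1
  have c2 : ContDiffAt ℂ m (fun w : ℂ × ℂ × ℂ => stereoBase a w.1) w := by
    unfold stereoBase
    fun_prop
  have hθ : ContDiff ℂ m sinCubic := differentiable_sinCubic.contDiff
  have cf : ContDiff ℂ m (fun w : ℂ × ℂ × ℂ => w.1 ^ d * w.2.1) := by fun_prop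
  have cM : ContDiff ℂ m (fun w : ℂ × ℂ × ℂ => complexMetric a (w.1 ^ d * w.2.1)) :=
    (contDiff_complexMetric a).comp cf
  have cθ : ContDiff ℂ m (fun w : ℂ × ℂ × ℂ => sinQuotient (w.1 ^ d * w.2.1)) := by
    have h : ContDiff ℂ m (fun w : ℂ × ℂ × ℂ => sinCubic (w.1 ^ d * w.2.1)) := hθ.comp cf
    unfold sinQuotient
    fun_prop
  have c3 : ContDiffAt ℂ m (fun w : ℂ × ℂ × ℂ => potentialExcess a (w.1 ^ d * w.2.1)) w := by
    unfold potentialExcess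
    refine ContDiffAt.div ?_ cM.contDiffAt h3
    have h : ContDiff ℂ m (fun w : ℂ × ℂ × ℂ => sinCubic (2 * (w.1 ^ d * w.2.1))) :=
      hθ.comp (by fun_prop)
    have := h.contDiffAt (x := w)
    have := cθ.contDiffAt (x := w)
    fun_prop
  have c4 : ContDiffAt ℂ m (fun w : ℂ × ℂ × ℂ => dragQuotient a (w.1 ^ d * w.2.1)) w := by
    unfold dragQuotient
    refine ContDiffAt.div ?_ cM.contDiffAt h3
    have h : ContDiff ℂ m (fun w : ℂ × ℂ × ℂ => Complex.cos (w.1 ^ d * w.2.1)) :=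
      Complex.contDiff_cos.comp cf
    have := h.contDiffAt (x := w)
    have := cθ.contDiffAt (x := w)
    fun_prop
  unfold poleForce
  have c5 : ContDiffAt ℂ m (fun w : ℂ × ℂ × ℂ => ((a : ℂ) ^ 2 - 1) * stereoFactor w.1 ^ 2
      * (1 - w.1 ^ 2 * stereoFactor w.1) / stereoBase a w.1) w :=
    ContDiffAt.div (by fun_prop) c2 h2
  fun_prop

end Pole

section Pole

/-- Restriction of a kernel to a shorter interval. -/
lemma IsVolterraKernel.comp_mul {g : ℝ → ℝ → ℂ × ℂ → ℂ × ℂ} {k : ℝ → ℝ → ℝ} {wt : ℝ → ℝ}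
    {Z : ℝ → ℂ × ℂ} {R : ℝ} (h : IsVolterraKernel g k wt Z R) {τ : ℝ} (hτ : τ ∈ Icc (0 : ℝ) 1) :
    IsVolterraKernel (fun t => g (τ * t)) (fun t => k (τ * t)) (fun t => wt (τ * t))
      (fun t => Z (τ * t)) R := by
  have hm : ∀ t ∈ Icc (0 : ℝ) 1, τ * t ∈ Icc (0 : ℝ) 1 := fun t ht => mul_mem_unitInterval hτ ht
  have hc : ContinuousOn (fun t => τ * t) (Icc (0 : ℝ) 1) := by fun_prop
  constructor
  · exact h.pos
  · exact h.continuous_weight.comp hc hm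
  · exact fun t ht => h.weight_pos _ (hm t ht)
  · exact h.continuous_ref.comp hc hm
  · refine h.continuous_kernel.comp
      (f := fun w : (ℝ × ℝ) × ℂ × ℂ => ((τ * w.1.1, w.1.2), w.2)) (by fun_prop) ?_
    rintro w ⟨h1, h2, h3⟩
    refine ⟨hm _ h1, h2, ?_⟩
    simpa only [mul_assoc] using h3
  · intro t ht r hr u hu
    exact h.differentiable _ (hm t ht) r hr u (by simpa only [mul_assoc] using hu)
  · intro t ht r hr u v hu hv
    exact h.lipschitz _ (hm t ht) r hr u v (by simpa only [mul_assoc] using hu)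
      (by simpa only [mul_assoc] using hv)
  · exact fun t ht r hr => h.bound_nonneg _ (hm t ht) r hr
  · exact fun t ht => h.continuous_bound _ (hm t ht)
  · intro t ht
    simpa only [mul_assoc] using h.contract _ (hm t ht)

/-- The kernel of the Volterra equation for the pair `(G, H)` of `poleForce`. -/
noncomputable def poleKernel (n d : ℕ) (a : ℝ) (t r : ℝ) (u : ℂ × ℂ) : ℂ × ℂ :=
  ((t : ℂ) * u.2, (r : ℂ) ^ (2 * d + n + 1) * t * poleForce n d a ((t * r : ℝ) : ℂ) u)

/-- `Y = (G, H)` solves the Volterra form of the Euler-Lagrange equation on `[0, 1]`, where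
`G 0 = c`. -/
structure IsPoleSolution (n d : ℕ) (a : ℝ) (c : ℂ) (Y : ℝ → ℂ × ℂ) : Prop where
  continuousOn : ContinuousOn Y (Icc 0 1)
  eq_add_integral : ∀ t ∈ Icc (0 : ℝ) 1,
    Y t = (c, 0) + ∫ r in (0 : ℝ)..1, poleKernel n d a t r (Y (t * r))

/-- Complex conjugation on `ℂ × ℂ`. -/
noncomputable def conjPair : ℂ × ℂ →L[ℝ] ℂ × ℂ :=
  (Complex.conjCLE : ℂ →L[ℝ] ℂ).prodMap (Complex.conjCLE : ℂ →L[ℝ] ℂ)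

lemma conjPair_apply (u : ℂ × ℂ) : conjPair u = (starRingEnd ℂ u.1, starRingEnd ℂ u.2) := rfl

lemma norm_conjPair (u : ℂ × ℂ) : ‖conjPair u‖ = ‖u‖ := by
  simp [conjPair_apply, Prod.norm_def]

lemma poleKernel_conjPair (n d : ℕ) (a t r : ℝ) (u : ℂ × ℂ) :
    poleKernel n d a t r (conjPair u) = conjPair (poleKernel n d a t r u) := by
  simp only [poleKernel, conjPair_apply, poleForce_conj, map_mul, map_pow, Complex.conj_ofReal]

lemma one_add_sq_ne_zero (ρ : ℝ) : 1 + (ρ : ℂ) ^ 2 ≠ 0 := by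
  have : (0 : ℝ) < 1 + ρ ^ 2 := by positivity
  exact_mod_cast this.ne'

lemma stereoBase_ne_zero {a : ℝ} (ha : a ≠ 0) {ρ : ℝ} (hρ : 0 ≤ ρ) : stereoBase a ρ ≠ 0 := by
  rcases hρ.eq_or_lt with rfl | h
  · simp [stereoBase]
  · have h1 := baseCoeff_eq_stereo a (Real.log ρ)
    rw [Real.exp_log h] at h1
    rw [← h1]
    exact_mod_cast (baseCoeff_pos ha _).ne'

lemma eq_ofReal_of_conjPair_eq {u : ℂ × ℂ} (h : conjPair u = u) :
    u = ((u.1.re : ℂ), (u.2.re : ℂ)) := by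
  rw [conjPair_apply, Prod.ext_iff] at h
  exact Prod.ext (Complex.conj_eq_iff_re.1 h.1).symm (Complex.conj_eq_iff_re.1 h.2).symm

lemma contDiffAt_poleForce_ofReal {n d : ℕ} {a : ℝ} (ha : a ≠ 0) {ρ : ℝ} (hρ : 0 ≤ ρ) {u : ℂ × ℂ}
    (hu : conjPair u = u) {m : WithTop ℕ∞} :
    ContDiffAt ℂ m (fun w : ℂ × ℂ × ℂ => poleForce n d a w.1 w.2) (ρ, u) := by
  refine contDiffAt_poleForce (one_add_sq_ne_zero ρ) (stereoBase_ne_zero ha hρ) ?_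
  rw [eq_ofReal_of_conjPair_eq hu]
  have h1 : (ρ : ℂ) ^ d * (u.1.re : ℂ) = ((ρ ^ d * u.1.re : ℝ) : ℂ) := by push_cast; rfl
  rw [h1, complexMetric_ofReal]
  exact_mod_cast (metricCoeff_pos ha _).ne'

/-- Near a real curve the Volterra operator is a contraction for an exponential weight. -/
lemma exists_isVolterraKernel (n d : ℕ) {a : ℝ} (ha : a ≠ 0) {Z : ℝ → ℂ × ℂ}
    (hZ : ContinuousOn Z (Icc 0 1)) (hreal : ∀ t ∈ Icc (0 : ℝ) 1, conjPair (Z t) = Z t) :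
    ∃ L, 0 ≤ L ∧ ∃ k R, IsVolterraKernel (poleKernel n d a) k (fun t => Real.exp (L * t)) Z R := by
  set F : ℂ × ℂ × ℂ → ℂ := fun w => poleForce n d a w.1 w.2 with hF
  set D : Set (ℂ × ℂ × ℂ) := {w | ContDiffAt ℂ 1 F w} with hD
  have hDo : IsOpen D := isOpen_iff_mem_nhds.2 fun w hw =>
    (show ContDiffAt ℂ 1 F w from hw).eventually (by simp)
  have hcore : IsCompact ((fun t : ℝ => ((t : ℂ), Z t)) '' Icc 0 1) :=
    isCompact_Icc.image_of_continuousOn (Complex.continuous_ofReal.continuousOn.prodMk hZ)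
  -- on a compact complex neighbourhood of the curve the force is Lipschitz in `u`
  obtain ⟨R₀, hR₀, hsub⟩ := hcore.exists_cthickening_subset_open hDo (by
    rintro _ ⟨t, ht, rfl⟩
    exact contDiffAt_poleForce_ofReal (m := 1) ha ht.1 (hreal t ht))
  have hmem : ∀ ρ ∈ Icc (0 : ℝ) 1, ∀ u, ‖u - Z ρ‖ ≤ R₀ → ((ρ : ℂ), u) ∈
      Metric.cthickening R₀ ((fun t : ℝ => ((t : ℂ), Z t)) '' Icc 0 1) := fun ρ hρ u hu =>
    Metric.mem_cthickening_of_dist_le _ _ _ _ (mem_image_of_mem _ hρ) (by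
      rw [Prod.dist_eq, dist_self, dist_eq_norm]
      exact max_le hR₀.le hu)
  obtain ⟨K, hK⟩ := (hcore.cthickening (r := R₀)).exists_bound_of_continuousOn
    (f := fderiv ℂ F) fun w hw =>
      ((show ContDiffAt ℂ 1 F w from hsub hw).fderiv_right (m := 0) (by simp)).continuousAt
        |>.continuousWithinAt
  have hK0 : 0 ≤ K := (norm_nonneg _).trans (hK _ (hmem 0 (by simp) (Z 0) (by simpa using hR₀.le)))
  have hda : ∀ ρ ∈ Icc (0 : ℝ) 1, ∀ u, ‖u - Z ρ‖ ≤ R₀ → HasFDerivAt (fun u => F ((ρ : ℂ), u))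
      ((fderiv ℂ F ((ρ : ℂ), u)).comp (ContinuousLinearMap.inr ℂ ℂ (ℂ × ℂ))) u := fun ρ hρ u hu =>
    ((show ContDiffAt ℂ 1 F _ from hsub (hmem ρ hρ u hu)).differentiableAt
      (by simp)).hasFDerivAt.comp u (hasFDerivAt_prodMk_right _ _)
  have hlip : ∀ ρ ∈ Icc (0 : ℝ) 1, ∀ u v, ‖u - Z ρ‖ ≤ R₀ → ‖v - Z ρ‖ ≤ R₀ →
      ‖F ((ρ : ℂ), u) - F ((ρ : ℂ), v)‖ ≤ K * ‖u - v‖ := fun ρ hρ u v hu hv => by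
    refine (convex_closedBall (Z ρ) R₀).norm_image_sub_le_of_norm_hasFDerivWithin_le
      (f := fun u => F ((ρ : ℂ), u)) (fun w hw => (hda ρ hρ w (by
        rwa [mem_closedBall_iff_norm] at hw)).hasFDerivWithinAt) (fun w hw => ?_)
        (mem_closedBall_iff_norm.2 hv) (mem_closedBall_iff_norm.2 hu)
    refine (ContinuousLinearMap.opNorm_comp_le _ _).trans ?_
    have h1 := hK _ (hmem ρ hρ w (mem_closedBall_iff_norm.1 hw))
    have h2 := ContinuousLinearMap.norm_inr_le_one ℂ ℂ (ℂ × ℂ)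
    exact (mul_le_mul h1 h2 (norm_nonneg _) hK0).trans_eq (mul_one K)
  -- with this exponent the integral of `(K + 1) t exp (L t r)` over `r` is at most `exp (L t) / 4`
  set L := 4 * (K + 1) with hL
  have hL0 : 0 ≤ L := by positivity
  have hRw : ∀ ρ ∈ Icc (0 : ℝ) 1, R₀ * Real.exp (-L) * Real.exp (L * ρ) ≤ R₀ := fun ρ hρ => by
    rw [mul_assoc, ← Real.exp_add]
    refine mul_le_of_le_one_right hR₀.le (Real.exp_le_one_iff.2 ?_)
    nlinarith [hρ.2]
  refine ⟨L, hL0, fun t r => (K + 1) * t, R₀ * Real.exp (-L), ?_⟩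
  constructor
  · positivity
  · fun_prop
  · exact fun t _ => Real.exp_pos _
  · exact hZ
  · have h1 : ContinuousOn (fun w : (ℝ × ℝ) × ℂ × ℂ => F (((w.1.1 * w.1.2 : ℝ) : ℂ), w.2))
        {w | w.1.1 ∈ Icc (0 : ℝ) 1 ∧ w.1.2 ∈ Icc (0 : ℝ) 1 ∧
          ‖w.2 - Z (w.1.1 * w.1.2)‖ ≤ R₀ * Real.exp (-L) * Real.exp (L * (w.1.1 * w.1.2))} := by
      rintro w ⟨h1, h2, h3⟩
      have hm := mul_mem_unitInterval h1 h2
      refine ContinuousAt.continuousWithinAt (ContinuousAt.comp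
        (f := fun w : (ℝ × ℝ) × ℂ × ℂ => (((w.1.1 * w.1.2 : ℝ) : ℂ), w.2)) (g := F)
        (show ContDiffAt ℂ 1 F _ from hsub (hmem _ hm w.2 (h3.trans (hRw _ hm)))).continuousAt
        (by fun_prop))
    have c1 : Continuous fun w : (ℝ × ℝ) × ℂ × ℂ => (w.1.1 : ℂ) :=
      Complex.continuous_ofReal.comp (by fun_prop)
    have c2 : Continuous fun w : (ℝ × ℝ) × ℂ × ℂ => (w.1.2 : ℂ) :=
      Complex.continuous_ofReal.comp (by fun_prop)
    exact (c1.mul (by fun_prop)).continuousOn.prodMk (((c2.pow _).mul c1).continuousOn.mul h1)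
  · intro t ht r hr u hu
    have hm := mul_mem_unitInterval ht hr
    have h1 := (hda _ hm u (hu.trans (hRw _ hm))).differentiableAt
    simp only [hF] at h1
    unfold poleKernel
    fun_prop
  · intro t ht r hr u v hu hv
    have hm := mul_mem_unitInterval ht hr
    have h1 := hlip _ hm u v (hu.trans (hRw _ hm)) (hv.trans (hRw _ hm))
    simp only [hF] at h1
    have h0 := norm_nonneg (u - v)
    have h2 : ‖u.2 - v.2‖ ≤ ‖u - v‖ := norm_snd_le (u - v)
    rw [poleKernel, poleKernel, Prod.mk_sub_mk, Prod.norm_mk, ← mul_sub, ← mul_sub, norm_mul,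
      norm_mul, norm_mul, norm_pow, Complex.norm_real, Complex.norm_real,
      Real.norm_of_nonneg ht.1, Real.norm_of_nonneg hr.1]
    refine max_le ?_ ?_
    · calc t * ‖u.2 - v.2‖ ≤ t * ‖u - v‖ := mul_le_mul_of_nonneg_left h2 ht.1
        _ ≤ (K + 1) * t * ‖u - v‖ := by nlinarith [mul_nonneg (mul_nonneg hK0 ht.1) h0]
    · calc r ^ (2 * d + n + 1) * t * ‖_‖ ≤ 1 * t * (K * ‖u - v‖) := by
            gcongr
            · simpa using ht.1
            · exact ht.1
            · exact pow_le_one₀ hr.1 hr.2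
        _ ≤ (K + 1) * t * ‖u - v‖ := by nlinarith [mul_nonneg ht.1 h0]
  · exact fun t ht r _ => mul_nonneg (by linarith) ht.1
  · exact fun t _ => continuousOn_const
  · intro t ht
    have h1 : ∀ r ∈ uIcc (0 : ℝ) 1, HasDerivAt (fun r => Real.exp (L * (t * r)) / 4)
        ((K + 1) * t * Real.exp (L * (t * r))) r := fun r _ => by
      refine ((((hasDerivAt_id r).const_mul t).const_mul L).exp.div_const 4).congr_deriv ?_
      simp only [id, hL]
      ring
    rw [intervalIntegral.integral_eq_sub_of_hasDerivAt h1
      (Continuous.intervalIntegrable (by fun_prop) _ _)]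
    simp

namespace IsPoleSolution

variable {n d : ℕ} {a : ℝ} {c : ℂ} {Y Z : ℝ → ℂ × ℂ}

lemma apply_zero (h : IsPoleSolution n d a c Y) : Y 0 = (c, 0) := by
  rw [h.eq_add_integral 0 (by simp)]
  simp [poleKernel]

/-- Solutions with the same value at `0` agree near `0`. -/
lemma exists_eqOn (ha : a ≠ 0) (hZ : IsPoleSolution n d a c Z)
    (hreal : ∀ t ∈ Icc (0 : ℝ) 1, conjPair (Z t) = Z t) (hY : IsPoleSolution n d a c Y) :
    ∃ τ ∈ Ioc (0 : ℝ) 1, EqOn Y Z (Icc 0 τ) := by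
  obtain ⟨L, hL0, k, R, hk⟩ := exists_isVolterraKernel n d ha hZ.continuousOn hreal
  have hc : ContinuousWithinAt (fun t => ‖Y t - Z t‖) (Icc 0 1) 0 :=
    (hY.continuousOn.sub hZ.continuousOn).norm 0 (by simp)
  have h1 : ∀ᶠ t in 𝓝[Icc 0 1] (0 : ℝ), ‖Y t - Z t‖ < R :=
    hc.eventually (gt_mem_nhds (by simp [hY.apply_zero, hZ.apply_zero, hk.pos]))
  obtain ⟨ε, hε, h2⟩ := Metric.mem_nhdsWithin_iff.1 h1
  -- near `0` both solutions lie where the operator, restricted to `[0, τ]`, is a contraction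
  set τ := min (ε / 2) 1 with hτdef
  have hτ : τ ∈ Icc (0 : ℝ) 1 := ⟨le_min (half_pos hε).le zero_le_one, min_le_right _ _⟩
  have hτ0 : 0 < τ := lt_min (half_pos hε) one_pos
  have hm : ∀ t ∈ Icc (0 : ℝ) 1, τ * t ∈ Icc (0 : ℝ) 1 := fun t ht => mul_mem_unitInterval hτ ht
  have hcm : ContinuousOn (fun t => τ * t) (Icc (0 : ℝ) 1) := by fun_prop
  have hw : ∀ t ∈ Icc (0 : ℝ) 1, 1 ≤ Real.exp (L * (τ * t)) := fun t ht =>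
    Real.one_le_exp (mul_nonneg hL0 (hm t ht).1)
  have key := (hk.comp_mul hτ).norm_sub_le (Y₁ := fun t => Y (τ * t)) (Y₂ := fun t => Z (τ * t))
    (b₁ := fun _ => (c, 0)) (b₂ := fun _ => (c, 0)) (c := 0)
    (hY.continuousOn.comp hcm hm) (hZ.continuousOn.comp hcm hm)
    (fun t ht => by
      have h3 : ‖Y (τ * t) - Z (τ * t)‖ < R := h2 ⟨by
        have h4 : τ * t ≤ ε / 2 := (mul_le_of_le_one_right hτ.1 ht.2).trans (min_le_left _ _)
        rw [Metric.mem_ball, dist_zero_right, Real.norm_of_nonneg (hm t ht).1]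
        linarith, hm t ht⟩
      nlinarith [hw t ht, hk.pos])
    (fun t ht => by
      rw [sub_self, norm_zero]
      exact mul_nonneg hk.pos.le (Real.exp_pos _).le)
    (fun t ht => by simpa only [mul_assoc] using hY.eq_add_integral _ (hm t ht))
    (fun t ht => by simpa only [mul_assoc] using hZ.eq_add_integral _ (hm t ht))
    (fun t ht => by simp)
  refine ⟨τ, ⟨hτ0, hτ.2⟩, fun x hx => ?_⟩
  have h3 := key (x / τ) ⟨div_nonneg hx.1 hτ0.le, (div_le_one hτ0).2 hx.2⟩
  rw [mul_zero, zero_mul, norm_le_zero_iff, sub_eq_zero] at h3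
  simpa only [mul_div_cancel₀ x hτ0.ne'] using h3

/-- A real solution belongs to a holomorphic family, parametrized by the value of `G` at `0`. -/
theorem exists_family (ha : a ≠ 0) {c : ℝ} (hZ : IsPoleSolution n d a c Z)
    (hreal : ∀ t ∈ Icc (0 : ℝ) 1, conjPair (Z t) = Z t) :
    ∃ δ > 0, ∃ C, ∃ Y : ℂ → ℝ → ℂ × ℂ, (∀ η ∈ Metric.ball (c : ℂ) δ, IsPoleSolution n d a η (Y η)) ∧
      (∀ t ∈ Icc (0 : ℝ) 1, DifferentiableOn ℂ (fun η => Y η t) (Metric.ball (c : ℂ) δ)) ∧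
      (∀ η ∈ Metric.ball (c : ℂ) δ, ∀ η' ∈ Metric.ball (c : ℂ) δ, ∀ t ∈ Icc (0 : ℝ) 1,
        ‖Y η t - Y η' t‖ ≤ C * ‖η - η'‖) ∧
      (∀ η ∈ Metric.ball (c : ℂ) δ, ∀ t ∈ Icc (0 : ℝ) 1, ‖Y η t‖ ≤ C) ∧
      ∀ x : ℝ, (x : ℂ) ∈ Metric.ball (c : ℂ) δ → ∀ t ∈ Icc (0 : ℝ) 1, conjPair (Y x t) = Y x t := by
  obtain ⟨L, hL0, k, R, hk⟩ := exists_isVolterraKernel n d ha hZ.continuousOn hreal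
  have hw : ∀ t ∈ Icc (0 : ℝ) 1, 1 ≤ Real.exp (L * t) := fun t ht =>
    Real.one_le_exp (mul_nonneg hL0 ht.1)
  have hw1 : ∀ t ∈ Icc (0 : ℝ) 1, Real.exp (L * t) ≤ Real.exp L := fun t ht =>
    Real.exp_le_exp.2 (mul_le_of_le_one_right hL0 ht.2)
  have hpair : ∀ η η' : ℂ, ‖((η, 0) : ℂ × ℂ) - (η', 0)‖ = ‖η - η'‖ := fun η η' => by
    simp [Prod.norm_def]
  obtain ⟨Y, hYc, hYb, hYe, hYd⟩ := hk.exists_solution (U := Metric.ball (c : ℂ) (R / 2))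
    Metric.isOpen_ball (b := fun η _ => (η, 0)) (by fun_prop) (fun t _ => by fun_prop)
    (fun η hη t ht => by
      conv_lhs => arg 1; arg 2; rw [hZ.eq_add_integral t ht]
      rw [add_sub_add_right_eq_sub, hpair]
      have h1 := (mem_ball_iff_norm.1 hη).le
      nlinarith [hw t ht, hk.pos])
  obtain ⟨B, hB⟩ := isCompact_Icc.exists_bound_of_continuousOn hZ.continuousOn
  refine ⟨R / 2, half_pos hk.pos, max (4 / 3 * Real.exp L) (R * Real.exp L + B), Y,
    fun η hη => ⟨hYc η hη, hYe η hη⟩, hYd, ?_, ?_, ?_⟩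
  · intro η hη η' hη' t ht
    refine (hk.norm_sub_le (hYc η hη) (hYc η' hη') (hYb η hη) (hYb η' hη') (hYe η hη) (hYe η' hη')
      (c := ‖η - η'‖) (fun t ht => ?_) t ht).trans ?_
    · rw [hpair]
      exact le_mul_of_one_le_right (norm_nonneg _) (hw t ht)
    · calc 4 / 3 * ‖η - η'‖ * Real.exp (L * t) ≤ 4 / 3 * ‖η - η'‖ * Real.exp L := by
            gcongr
            exact mul_le_of_le_one_right hL0 ht.2
        _ = 4 / 3 * Real.exp L * ‖η - η'‖ := by ring
        _ ≤ _ := mul_le_mul_of_nonneg_right (le_max_left _ _) (norm_nonneg _)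
  · intro η hη t ht
    have h1 := (hYb η hη t ht).trans (mul_le_mul_of_nonneg_left (hw1 t ht) hk.pos.le)
    calc ‖Y η t‖ = ‖(Y η t - Z t) + Z t‖ := by rw [sub_add_cancel]
      _ ≤ _ := (norm_add_le _ _).trans (add_le_add h1 (hB t ht))
      _ ≤ _ := le_max_right _ _
  · intro x hx t ht
    -- for a real parameter the conjugate of the solution is a solution, hence equal to it
    have hconjint : ∀ t ∈ Icc (0 : ℝ) 1, conjPair (Y x t)
        = ((x : ℂ), 0) + ∫ r in (0 : ℝ)..1, poleKernel n d a t r (conjPair (Y x (t * r))) := by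
      intro t ht
      nth_rewrite 1 [hYe x hx t ht]
      simp only [poleKernel_conjPair]
      rw [map_add, ContinuousLinearMap.intervalIntegral_comp_comm conjPair
        ((hk.continuousOn_subst_single (hYc x hx) (hYb x hx) ht).intervalIntegrable_of_Icc
          zero_le_one)]
      simp [conjPair_apply]
    have h1 := hk.norm_sub_le (c := 0) (b₁ := fun _ => ((x : ℂ), 0)) (b₂ := fun _ => ((x : ℂ), 0))
      (Y₁ := fun t => conjPair (Y x t))
      (conjPair.continuous.comp_continuousOn (hYc x hx)) (hYc x hx)
      (fun t ht => by
        rw [← hreal t ht, ← map_sub, norm_conjPair]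
        exact hYb x hx t ht)
      (hYb x hx) hconjint (hYe x hx) (fun t ht => by simp) t ht
    rw [mul_zero, zero_mul, norm_le_zero_iff, sub_eq_zero] at h1
    exact h1

end IsPoleSolution

end Pole

/-! ### Asymptotics at the pole -/

section Asymptotics

lemma colatSin_le_two_mul_exp (x : ℝ) : colatSin x ≤ 2 * Real.exp x := by
  rw [colatSin, inv_le_iff_one_le_mul₀ (Real.cosh_pos x), Real.cosh_eq]
  have h1 : Real.exp x * Real.exp (-x) = 1 := by rw [← Real.exp_add]; simp
  nlinarith [sq_nonneg (Real.exp x)]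

lemma abs_sin_mul_cos_sub_le_of_abs_le {y : ℝ} (hy : |y| ≤ 1 / 2) :
    |Real.sin y * Real.cos y - y| ≤ 4 * |y| ^ 3 := by
  have h2 : |2 * y| = 2 * |y| := by rw [abs_mul, abs_two]
  have h1 := Real.sin_bound (x := 2 * y) (by rw [h2]; linarith)
  rw [Real.sin_two_mul, h2] at h1
  have h0 := abs_nonneg y
  have h4 : |y| ^ 5 ≤ |y| ^ 3 := pow_le_pow_of_le_one h0 (by linarith) (by norm_num)
  have h3 : |(2 * y) ^ 3 / 6| = 4 / 3 * |y| ^ 3 := by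
    rw [abs_div, abs_pow, h2, abs_of_pos (by norm_num : (0 : ℝ) < 6)]
    ring
  have h5 : 2 * (Real.sin y * Real.cos y - y)
      = (2 * Real.sin y * Real.cos y - (2 * y - (2 * y) ^ 3 / 6)) - (2 * y) ^ 3 / 6 := by ring
  have h6 : 2 * |Real.sin y * Real.cos y - y| ≤ (2 * |y|) ^ 5 / 100 + 4 / 3 * |y| ^ 3 := by
    rw [← abs_two, ← abs_mul, h5, ← h3]
    rw [abs_two]
    exact (abs_sub _ _).trans (add_le_add h1 le_rfl)
  nlinarith

/-- The deviation from the equation linearized at the pole. -/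
lemma exists_abs_profileAccel_sub_le (s lam : ℝ) {a : ℝ} (ha : a ≠ 0) {P : ℝ} (hP : 0 ≤ P) :
    ∃ C, 0 ≤ C ∧ ∀ x ≤ 0, ∀ y p, |y| ≤ 1 / 2 → |p| ≤ P * |y| →
      |profileAccel s lam a x y p - lam * y + s * p| ≤ C * (colatSin x ^ 2 + y ^ 2) * |y| := by
  set μ := min (a ^ 2) 1 with hμ
  have hμ0 : 0 < μ := lt_min (by positivity) one_pos
  set A := |a ^ 2 - 1| with hA
  have hA0 : 0 ≤ A := abs_nonneg _
  refine ⟨|lam| * (A + 4 + A) / μ + |s| * P + A * P / μ + A * P ^ 2 / μ, by positivity,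
    fun x hx y p hy hp => ?_⟩
  set S := colatSin x
  set C := colatCos x
  set M := metricCoeff a y with hM
  set m := baseCoeff a x with hm
  have hMμ : μ ≤ M := min_le_metricCoeff a y
  have hmμ : μ ≤ m := min_le_baseCoeff a x
  have hM0 : 0 < M := hμ0.trans_le hMμ
  have hm0 : 0 < m := hμ0.trans_le hmμ
  have hSC : S ^ 2 + C ^ 2 = 1 := colatSin_sq_add_colatCos_sq x
  have hC0 : 0 ≤ C := colatCos_nonneg hx
  have hC1 : C ≤ 1 := (le_abs_self _).trans (abs_colatCos_le_one x)
  set σ := Real.sin y * Real.cos y with hσ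
  have hsin : |Real.sin y| ≤ |y| := Real.abs_sin_le_abs
  have hσy : |σ| ≤ |y| := by
    rw [hσ, abs_mul]
    exact (mul_le_of_le_one_right (abs_nonneg _) (Real.abs_cos_le_one y)).trans hsin
  have hmS : m - 1 = (a ^ 2 - 1) * S ^ 2 := by rw [hm, baseCoeff]; linear_combination hSC
  have hMS : M - 1 = (a ^ 2 - 1) * Real.sin y ^ 2 := by
    rw [hM, metricCoeff]
    linear_combination Real.sin_sq_add_cos_sq y
  have hy0 := abs_nonneg y
  have hy2 : |y| ^ 2 = y ^ 2 := sq_abs y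
  have hsum : S ^ 2 * |y| ≤ (S ^ 2 + y ^ 2) * |y| := by
    gcongr
    linarith [sq_nonneg y]
  have hsum' : |y| ^ 3 ≤ (S ^ 2 + y ^ 2) * |y| := by
    rw [pow_succ, hy2]
    gcongr
    linarith [sq_nonneg S]
  set D := (S ^ 2 + y ^ 2) * |y| with hD
  have hD0 : 0 ≤ D := by positivity
  have t1 : |lam * (((m - 1) * σ + (σ - y) - y * (M - 1)) / M)| ≤ |lam| * (A + 4 + A) / μ * D := by
    rw [abs_mul, abs_div, abs_of_pos hM0, mul_div_assoc, mul_assoc]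
    refine mul_le_mul_of_nonneg_left ?_ (abs_nonneg _)
    rw [div_mul_eq_mul_div]
    refine div_le_div₀ (by positivity) ?_ hμ0 hMμ
    have e1 : |(m - 1) * σ| ≤ A * D := by
      rw [hmS, abs_mul, abs_mul, abs_of_nonneg (sq_nonneg S), mul_assoc]
      exact mul_le_mul_of_nonneg_left ((mul_le_mul_of_nonneg_left hσy (sq_nonneg S)).trans hsum) hA0
    have e2 : |σ - y| ≤ 4 * D := (abs_sin_mul_cos_sub_le_of_abs_le hy).trans (by linarith)
    have e3 : |y * (M - 1)| ≤ A * D := by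
      rw [hMS, abs_mul, abs_mul, abs_of_nonneg (sq_nonneg (Real.sin y))]
      have : Real.sin y ^ 2 ≤ |y| ^ 2 := by
        rw [← sq_abs (Real.sin y)]
        gcongr
      calc |y| * (A * Real.sin y ^ 2) ≤ |y| * (A * |y| ^ 2) := by gcongr
        _ = A * |y| ^ 3 := by ring
        _ ≤ A * D := by gcongr
    calc _ ≤ |(m - 1) * σ| + |σ - y| + |y * (M - 1)| :=
          (abs_sub _ _).trans (add_le_add (abs_add_le _ _) le_rfl)
      _ ≤ _ := by linarith
  have t2 : |s * (1 - C) * p| ≤ |s| * P * D := by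
    rw [abs_mul, abs_mul, abs_of_nonneg (by linarith : (0 : ℝ) ≤ 1 - C)]
    have : 1 - C ≤ S ^ 2 := by nlinarith
    calc |s| * (1 - C) * |p| ≤ |s| * S ^ 2 * (P * |y|) := by gcongr
      _ = |s| * P * (S ^ 2 * |y|) := by ring
      _ ≤ _ := by gcongr
  have t3 : |(a ^ 2 - 1) * S ^ 2 * C / m * p| ≤ A * P / μ * D := by
    rw [abs_mul, abs_div, abs_mul, abs_mul, abs_of_pos hm0, abs_of_nonneg (sq_nonneg S),
      abs_of_nonneg hC0]
    calc A * S ^ 2 * C / m * |p| ≤ A * S ^ 2 * 1 / μ * (P * |y|) := by gcongr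
      _ = A * P / μ * (S ^ 2 * |y|) := by ring
      _ ≤ _ := by gcongr
  have t4 : |(a ^ 2 - 1) * σ / M * p ^ 2| ≤ A * P ^ 2 / μ * D := by
    rw [abs_mul, abs_div, abs_mul, abs_of_pos hM0, abs_pow]
    calc A * |σ| / M * |p| ^ 2 ≤ A * |y| / μ * (P * |y|) ^ 2 := by gcongr
      _ = A * P ^ 2 / μ * |y| ^ 3 := by ring
      _ ≤ _ := by gcongr
  have hsplit : profileAccel s lam a x y p - lam * y + s * p
      = lam * (((m - 1) * σ + (σ - y) - y * (M - 1)) / M) + s * (1 - C) * p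
        + (a ^ 2 - 1) * S ^ 2 * C / m * p - (a ^ 2 - 1) * σ / M * p ^ 2 := by
    simp only [profileAccel]
    rw [← hσ, ← hm, ← hM]
    field_simp
    ring
  rw [hsplit, mul_assoc (_ + _ + _ + _) (S ^ 2 + y ^ 2), ← hD]
  have := (abs_sub (lam * (((m - 1) * σ + (σ - y) - y * (M - 1)) / M) + s * (1 - C) * p
        + (a ^ 2 - 1) * S ^ 2 * C / m * p) ((a ^ 2 - 1) * σ / M * p ^ 2)).trans
    (add_le_add ((abs_add_le _ _).trans (add_le_add (abs_add_le _ _) le_rfl)) le_rfl)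
  linarith

/-- A bounded solution of `u' = -κ u + E` on a half-line inherits an exponential bound of `E`. -/
lemma abs_le_of_hasDerivAt_of_bounded {κ A K B x₁ : ℝ} (hκ : 1 ≤ κ) (hA : 0 ≤ A) (hK : 0 ≤ K)
    {u E : ℝ → ℝ} (hu : ∀ x ≤ x₁, HasDerivAt u (-κ * u x + E x) x) (hB : ∀ x ≤ x₁, |u x| ≤ B)
    (hE : ∀ x ≤ x₁, |E x| ≤ K * Real.exp (A * x)) : |u x₁| ≤ K * Real.exp (A * x₁) := by
  have main : ∀ (u E : ℝ → ℝ), (∀ x ≤ x₁, HasDerivAt u (-κ * u x + E x) x) →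
      (∀ x ≤ x₁, |u x| ≤ B) → (∀ x ≤ x₁, |E x| ≤ K * Real.exp (A * x)) →
      u x₁ ≤ K * Real.exp (A * x₁) := by
    intro u E hu hB hE
    have hd : ∀ x ≤ x₁, HasDerivAt (fun x => Real.exp (κ * x) * (u x - K * Real.exp (A * x)))
        (Real.exp (κ * x) * (E x - (κ + A) * (K * Real.exp (A * x)))) x := fun x hx => by
      refine ((((hasDerivAt_id x).const_mul κ).exp).mul ((hu x hx).sub
        ((((hasDerivAt_id x).const_mul A).exp).const_mul K))).congr_deriv ?_
      simp only [id, Pi.sub_apply]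
      ring
    have hanti : AntitoneOn (fun x => Real.exp (κ * x) * (u x - K * Real.exp (A * x)))
        (Iic x₁) := by
      refine antitoneOn_of_deriv_nonpos (convex_Iic _)
        (fun x hx => (hd x hx).continuousAt.continuousWithinAt) (fun x hx =>
          (hd x (mem_Iic.1 (interior_subset hx))).differentiableAt.differentiableWithinAt) fun x
              hx => ?_
      have hx' : x ≤ x₁ := mem_Iic.1 (interior_subset hx)
      rw [(hd x hx').deriv]
      refine mul_nonpos_of_nonneg_of_nonpos (Real.exp_pos _).le ?_
      have h1 := (le_abs_self _).trans (hE x hx')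
      have h2 : 0 ≤ K * Real.exp (A * x) := by positivity
      nlinarith
    have hlim : Tendsto (fun x => Real.exp (κ * x) * (B + K * Real.exp (A * x₁))) atBot (𝓝 0) := by
      have h1 : Tendsto (fun x : ℝ => κ * x) atBot atBot :=
        tendsto_id.const_mul_atBot (by linarith)
      simpa using (Real.tendsto_exp_atBot.comp h1).mul_const (B + K * Real.exp (A * x₁))
    have h0 : Real.exp (κ * x₁) * (u x₁ - K * Real.exp (A * x₁)) ≤ 0 := by
      refine ge_of_tendsto hlim ?_
      filter_upwards [eventually_le_atBot x₁] with x hx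
      refine (hanti (mem_Iic.2 hx) (mem_Iic.2 le_rfl) hx).trans
          (mul_le_mul_of_nonneg_left ?_ (Real.exp_pos _).le)
      have h1 := (le_abs_self _).trans (hB x hx)
      have h2 : 0 ≤ K * Real.exp (A * x) := by positivity
      have h3 : 0 ≤ K * Real.exp (A * x₁) := by positivity
      linarith
    have := nonpos_of_mul_nonpos_right h0 (Real.exp_pos _)
    linarith
  refine abs_le.2 ⟨?_, main u E hu hB hE⟩
  have := main (fun x => -u x) (fun x => -E x) (fun x hx => (hu x hx).neg.congr_deriv (by ring))
    (fun x hx => by rw [abs_neg]; exact hB x hx) (fun x hx => by rw [abs_neg]; exact hE x hx)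
  linarith

/-- If `p - d y` is small compared to the running maximum of `|y|`, then `|y|` increases. -/
lemma abs_le_abs_of_forall_max {d X : ℝ} (hd : 1 ≤ d) {y p : ℝ → ℝ}
    (hy : ∀ x, HasDerivAt y (p x) x) (hlim : Tendsto y atBot (𝓝 0))
    (hu : ∀ x ≤ X, (∀ t ≤ x, |y t| ≤ |y x|) → |p x - d * y x| ≤ |y x| / 4) {x t : ℝ} (hx : x ≤ X)
    (ht : t ≤ x) : |y t| ≤ |y x| := by
  have hc : Continuous y := continuous_iff_continuousAt.2 fun x => (hy x).continuousAt
  obtain ⟨x₁, hx₁, hmax⟩ : ∃ x₁ ∈ Iic x, ∀ t ∈ Iic x, |y t| ≤ |y x₁| := by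
    by_cases h0 : ∀ t ∈ Iic x, y t = 0
    · exact ⟨x, mem_Iic.2 le_rfl, fun t ht => by simp [h0 t ht]⟩
    · push Not at h0
      obtain ⟨t₀, ht₀, h0⟩ := h0
      refine hc.abs.continuousOn.exists_isMaxOn' isClosed_Iic ht₀ ?_
      rw [cocompact_eq_atBot_atTop, inf_sup_right, eventually_sup]
      refine ⟨Eventually.filter_mono inf_le_left ?_, ?_⟩
      · have h1 : Tendsto (fun t => |y t|) atBot (𝓝 0) := by simpa using hlim.abs
        filter_upwards [h1.eventually (gt_mem_nhds (abs_pos.2 h0))] with t ht using ht.le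
      · have h1 : (atTop ⊓ 𝓟 (Iic x) : Filter ℝ) = ⊥ := by
          rw [inf_principal_eq_bot]
          filter_upwards [eventually_gt_atTop x] with t ht using not_le.2 ht
        rw [h1]
        exact eventually_bot
  rcases eq_or_lt_of_le (show x₁ ≤ x from hx₁) with rfl | hlt
  · exact hmax t ht
  · have h1 := hu x₁ (hx₁.trans hx) fun t ht => hmax t (ht.trans hx₁)
    have hloc : IsLocalMax (fun t => y t ^ 2) x₁ := by
      filter_upwards [Iio_mem_nhds hlt] with t ht
      exact sq_le_sq.2 (hmax t (mem_Iic.2 (le_of_lt ht)))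
    have h2 := hloc.hasDerivAt_eq_zero ((hy x₁).pow 2)
    have h3 : y x₁ * p x₁ = 0 := by
      have : (2 : ℝ) * y x₁ * p x₁ = 0 := by simpa using h2
      linarith
    have h4 : |y x₁ * (p x₁ - d * y x₁)| ≤ |y x₁| * (|y x₁| / 4) := by
      rw [abs_mul]
      exact mul_le_mul_of_nonneg_left h1 (abs_nonneg _)
    have h5 : |y x₁| * |y x₁| = y x₁ * y x₁ := abs_mul_abs_self _
    have h6 : y x₁ = 0 := by
      rw [show y x₁ * (p x₁ - d * y x₁) = -(d * (y x₁ * y x₁)) by linear_combination h3, abs_neg,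
        abs_of_nonneg (by nlinarith [mul_self_nonneg (y x₁)])] at h4
      nlinarith [mul_self_nonneg (y x₁)]
    have h7 := hmax t (mem_Iic.2 ht)
    rw [h6, abs_zero] at h7
    exact h7.trans (abs_nonneg _)

/-- A function on a half-line with exponentially small derivative converges. -/
lemma exists_abs_sub_le_of_hasDerivAt {K A X : ℝ} (hK : 0 ≤ K) (hA : 1 ≤ A) {g g' : ℝ → ℝ}
    (hg : ∀ x ≤ X, HasDerivAt g (g' x) x) (hb : ∀ x ≤ X, |g' x| ≤ K * Real.exp (A * x)) :
    ∃ c, ∀ x ≤ X, |g x - c| ≤ K * Real.exp (A * x) := by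
  have hstep : ∀ x ≤ X, ∀ t ≤ x, |g x - g t| ≤ K * Real.exp (A * x) := by
    have main : ∀ (g g' : ℝ → ℝ), (∀ x ≤ X, HasDerivAt g (g' x) x) →
        (∀ x ≤ X, |g' x| ≤ K * Real.exp (A * x)) → ∀ x ≤ X, ∀ t ≤ x,
        g x - g t ≤ K * Real.exp (A * x) := by
      intro g g' hg hb x hx t ht
      have hd : ∀ x ≤ X, HasDerivAt (fun x => g x - K * Real.exp (A * x))
          (g' x - A * (K * Real.exp (A * x))) x := fun x hx => by
        refine ((hg x hx).sub ((((hasDerivAt_id x).const_mul A).exp).const_mul K)).congr_deriv ?_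
        simp only [id]
        ring
      have hanti : AntitoneOn (fun x => g x - K * Real.exp (A * x)) (Iic X) := by
        refine antitoneOn_of_deriv_nonpos (convex_Iic _)
          (fun x hx => (hd x hx).continuousAt.continuousWithinAt) (fun x hx =>
            (hd x (mem_Iic.1 (interior_subset hx))).differentiableAt.differentiableWithinAt) fun x
                hx => ?_
        have hx' : x ≤ X := mem_Iic.1 (interior_subset hx)
        rw [(hd x hx').deriv]
        have h1 := (le_abs_self _).trans (hb x hx')
        have h2 : 0 ≤ K * Real.exp (A * x) := by positivity
        nlinarith
      have h1 : g x - K * Real.exp (A * x) ≤ g t - K * Real.exp (A * t) :=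
        hanti (mem_Iic.2 (ht.trans hx)) (mem_Iic.2 hx) ht
      have h2 : 0 ≤ K * Real.exp (A * t) := by positivity
      linarith
    intro x hx t ht
    refine abs_le.2 ⟨?_, main g g' hg hb x hx t ht⟩
    have := main (fun x => -g x) (fun x => -g' x) (fun x hx => (hg x hx).neg)
      (fun x hx => by rw [abs_neg]; exact hb x hx) x hx t ht
    linarith
  have hlim : Tendsto (fun N : ℕ => 2 * (K * Real.exp (A * (X - N)))) atTop (𝓝 0) := by
    have h1 : Tendsto (fun N : ℕ => A * (X - N)) atTop atBot :=
      (tendsto_atBot_add_const_left _ X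
        (tendsto_neg_atTop_atBot.comp tendsto_natCast_atTop_atTop)).const_mul_atBot (by linarith)
    simpa using ((Real.tendsto_exp_atBot.comp h1).const_mul K).const_mul 2
  have hcau : CauchySeq fun N : ℕ => g (X - N) := by
    refine cauchySeq_of_le_tendsto_0 _ (fun n m N hn hm => ?_) hlim
    have hN : X - (N : ℝ) ≤ X := by linarith [N.cast_nonneg (α := ℝ)]
    have h1 := hstep (X - N) hN (X - n) (by
      have : (N : ℝ) ≤ n := by exact_mod_cast hn
      linarith)
    have h2 := hstep (X - N) hN (X - m) (by
      have : (N : ℝ) ≤ m := by exact_mod_cast hm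
      linarith)
    rw [Real.dist_eq, show g (X - n) - g (X - m) = (g (X - N) - g (X - m)) - (g (X - N) - g (X - n))
      by ring]
    exact (abs_sub _ _).trans (by linarith)
  obtain ⟨c, hc⟩ := cauchySeq_tendsto_of_complete hcau
  refine ⟨c, fun x hx => le_of_tendsto (hc.const_sub (g x)).abs ?_⟩
  filter_upwards [tendsto_natCast_atTop_atTop.eventually_ge_atTop (X - x)] with N hN
  exact hstep x hx _ (by linarith)

/-- All solutions that tend to `0` at the pole are `c exp (d x)` to leading order, with uniform
estimates of the remainder. -/
theorem exists_uniform_asymptotics {n d : ℕ} (hn : 1 ≤ n) (hd : 1 ≤ d) {a : ℝ} (ha : 0 < a)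
    (hlarge : 4 * ((d : ℝ) * (d + n)) ≤ a ^ 2 * (n : ℝ) ^ 2) :
    ∃ X ≤ 0, ∃ K, ∀ l y p, IsConnection n (d * (d + n)) a l y p →
      (∀ x ≤ X, |p x - d * y x| ≤ K * Real.exp ((d + 5 / 4) * x)) ∧
      ∃ c, ∀ x ≤ X, |y x - c * Real.exp (d * x)| ≤ K * Real.exp ((d + 5 / 4) * x) := by
  have hn' : (1 : ℝ) ≤ n := by exact_mod_cast hn
  have hd' : (1 : ℝ) ≤ d := by exact_mod_cast hd
  set lam : ℝ := d * (d + n) with hlam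
  have hlam0 : 0 < lam := by positivity
  have hmin : 0 < min (a ^ 2) 1 := lt_min (by positivity) one_pos
  set P := Real.sqrt ((a ^ 2 + 1) / min (a ^ 2) 1 * lam) with hP
  obtain ⟨C, hC, hacc⟩ := exists_abs_profileAccel_sub_le (n : ℝ) lam ha.ne'
      (Real.sqrt_nonneg _ : 0 ≤ P)
  set δ := min (1 / 2) (1 / (8 * (C + 1))) with hδdef
  have hδ : 0 < δ := lt_min (by norm_num) (by positivity)
  obtain ⟨X₀, hX₀, hsmall⟩ := exists_uniform_small (by linarith) ha hlam0 hlarge hδ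
  obtain ⟨X₁, hX₁⟩ := (tendsto_colatSin_atBot.eventually (gt_mem_nhds hδ)).exists_forall_of_atBot
  set X := min X₀ X₁ with hX
  have hX0 : X ≤ 0 := (min_le_left _ _).trans hX₀
  set K₁ := Real.exp (-((d - 1 / 4) * X)) with hK₁
  refine ⟨X, hX0, C * (4 + K₁ ^ 2) * K₁, fun l y p h => ?_⟩
  have hy : ∀ x ≤ X, |y x| < δ := fun x hx => hsmall X₀ le_rfl l y p h x
      (hx.trans (min_le_left _ _))
  have hy2 : ∀ x ≤ X, |y x| ≤ 1 / 2 := fun x hx => (hy x hx).le.trans (min_le_left _ _)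
  have hp : ∀ x, |p x| ≤ P * |y x| := fun x => by
    have h1 := h.vel_sq_le ha.ne' (by linarith) hlam0.le x
    have h2 : Real.sin (y x) ^ 2 ≤ y x ^ 2 := sq_le_sq.2 Real.abs_sin_le_abs
    have h3 : 0 ≤ (a ^ 2 + 1) / min (a ^ 2) 1 * lam := by positivity
    have h4 : |p x| ≤ |P * y x| := sq_le_sq.1 (by
      rw [mul_pow, hP, Real.sq_sqrt h3]
      exact h1.trans (mul_le_mul_of_nonneg_left h2 h3))
    rwa [abs_mul, abs_of_nonneg (Real.sqrt_nonneg _ : 0 ≤ P)] at h4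
  -- the defect of the linearized equation `p' = lam y - n p`, whose exponents are `d` and `-(d +
  -- n)`
  set E : ℝ → ℝ := fun x => profileAccel n lam a x (y x) (p x) - lam * y x + n * p x with hE
  have hEb : ∀ x ≤ X, |E x| ≤ C * (colatSin x ^ 2 + y x ^ 2) * |y x| := fun x hx =>
    hacc x (hx.trans hX0) _ _ (hy2 x hx) (hp x)
  have hu : ∀ x, HasDerivAt (fun x => p x - d * y x) (-(d + n) * (p x - d * y x) + E x) x :=
    fun x => ((h.hasDerivAt_snd x).sub ((h.hasDerivAt_fst x).const_mul (d : ℝ))).congr_deriv (by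
      simp only [hE, hlam]
      ring)
  have hsq : ∀ t, |t| < δ → t ^ 2 ≤ 1 / (8 * (C + 1)) := fun t ht => by
    have h1 : |t| ≤ 1 / (8 * (C + 1)) := ht.le.trans (min_le_right _ _)
    have h2 : |t| ≤ 1 / 2 := ht.le.trans (min_le_left _ _)
    rw [← sq_abs]
    nlinarith [abs_nonneg t]
  have hE4 : ∀ x ≤ X, |E x| ≤ 1 / 4 * |y x| := fun x hx => by
    refine (hEb x hx).trans (mul_le_mul_of_nonneg_right ?_ (abs_nonneg _))
    have h1 := hsq _ (hy x hx)
    have h2 := hsq (colatSin x) (by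
      rw [abs_of_pos (colatSin_pos x)]
      exact hX₁ x (hx.trans (min_le_right _ _)))
    calc C * (colatSin x ^ 2 + y x ^ 2)
        ≤ C * (1 / (8 * (C + 1)) + 1 / (8 * (C + 1))) := by gcongr
      _ ≤ 1 / 4 := by
        rw [← add_div, mul_div_assoc', div_le_div_iff₀ (by positivity) (by norm_num)]
        linarith
  have hbdd : ∀ x ≤ X, |p x - d * y x| ≤ P + d := fun x hx => by
    have h1 : |(d : ℝ) * y x| ≤ d * 1 := by
      rw [abs_mul, Nat.abs_cast]
      exact mul_le_mul_of_nonneg_left ((hy2 x hx).trans (by norm_num)) (by positivity)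
    have h2 : |p x| ≤ P * 1 := (hp x).trans
      (mul_le_mul_of_nonneg_left ((hy2 x hx).trans (by norm_num)) (Real.sqrt_nonneg _))
    exact (abs_sub _ _).trans (by linarith)
  -- boundedness excludes the exponent `-(d + n)`, and so `p` is close to `d y`
  have hstep : ∀ x ≤ X, (∀ t ≤ x, |y t| ≤ |y x|) → |p x - d * y x| ≤ |y x| / 4 := by
    intro x hx hmax
    have h1 := abs_le_of_hasDerivAt_of_bounded (κ := d + n) (A := 0) (K := |y x| / 4) (x₁ := x)
      (by linarith) le_rfl (by positivity) (fun t _ => hu t) (fun t ht => hbdd t (ht.trans hx))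
      (fun t ht => by
        rw [zero_mul, Real.exp_zero, mul_one]
        have := hE4 t (ht.trans hx)
        have := hmax t ht
        linarith)
    simpa using h1
  have hmono : ∀ x ≤ X, ∀ t ≤ x, |y t| ≤ |y x| := fun x hx t ht =>
    abs_le_abs_of_forall_max hd' h.hasDerivAt_fst h.tendsto_atBot hstep hx ht
  have hu4 : ∀ x ≤ X, |p x - d * y x| ≤ |y x| / 4 := fun x hx => hstep x hx (hmono x hx)
  -- the solution decays at least like `exp ((d - 1 / 4) x)`
  have hdecay : ∀ x ≤ X, |y x| ≤ K₁ * Real.exp ((d - 1 / 4) * x) := by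
    have hd2 : ∀ x, HasDerivAt (fun x => Real.exp (-((d - 1 / 4) * x)) * y x)
        (Real.exp (-((d - 1 / 4) * x)) * (p x - d * y x + y x / 4)) x := fun x => by
      refine ((((hasDerivAt_id x).const_mul ((d : ℝ) - 1 / 4)).neg.exp).mul
        (h.hasDerivAt_fst x)).congr_deriv ?_
      simp only [id, Pi.neg_apply]
      ring
    have hmon : MonotoneOn (fun x => (Real.exp (-((d - 1 / 4) * x)) * y x) ^ 2) (Iic X) := by
      refine monotoneOn_of_deriv_nonneg (convex_Iic _)
        (fun x _ => ((hd2 x).pow 2).continuousAt.continuousWithinAt)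
        (fun x _ => ((hd2 x).pow 2).differentiableAt.differentiableWithinAt) fun x hx => ?_
      have hx' : x ≤ X := mem_Iic.1 (interior_subset hx)
      rw [(show HasDerivAt (fun x => (Real.exp (-((d - 1 / 4) * x)) * y x) ^ 2) _ x from
        (hd2 x).pow 2).deriv]
      have h1 := hu4 x hx'
      have h2 : 0 ≤ y x * (p x - d * y x + y x / 4) := by
        have h3 : |y x * (p x - d * y x)| ≤ |y x| * (|y x| / 4) := by
          rw [abs_mul]
          exact mul_le_mul_of_nonneg_left h1 (abs_nonneg _)
        have h4 := neg_abs_le (y x * (p x - d * y x))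
        have h5 : |y x| * |y x| = y x * y x := abs_mul_abs_self _
        nlinarith
      have h3 : 0 ≤ Real.exp (-((d - 1 / 4) * x)) ^ 2 := sq_nonneg _
      have h4 := mul_nonneg h3 h2
      simp only [Nat.cast_ofNat, Nat.add_one_sub_one, pow_one]
      nlinarith
    intro x hx
    have h1 := hmon (mem_Iic.2 hx) (mem_Iic.2 le_rfl) hx
    have h2 := sq_le_sq.1 h1
    rw [abs_mul, abs_mul, abs_of_pos (Real.exp_pos _), abs_of_pos (Real.exp_pos _)] at h2
    have h3 : Real.exp (-((d - 1 / 4) * X)) * |y X| ≤ K₁ :=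
      mul_le_of_le_one_right (Real.exp_pos _).le ((hy2 X le_rfl).trans (by norm_num))
    have h4 := mul_le_mul_of_nonneg_right (h2.trans h3) (Real.exp_pos ((d - 1 / 4) * x)).le
    rwa [mul_right_comm, ← Real.exp_add, neg_add_cancel, Real.exp_zero, one_mul] at h4
  -- by the decay the defect is of higher order
  have hEfin : ∀ x ≤ X, |E x| ≤ C * (4 + K₁ ^ 2) * K₁ * Real.exp ((d + 5 / 4) * x) := fun x hx => by
    have hx0 := hx.trans hX0
    have h1 : colatSin x ^ 2 ≤ 4 * Real.exp (2 * x) := by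
      refine (pow_le_pow_left₀ (colatSin_pos x).le (colatSin_le_two_mul_exp x) 2).trans_eq ?_
      rw [mul_pow, ← Real.exp_nat_mul]
      norm_num
    have h2 : y x ^ 2 ≤ K₁ ^ 2 * Real.exp (2 * ((d - 1 / 4) * x)) := by
      rw [← sq_abs]
      refine (pow_le_pow_left₀ (abs_nonneg _) (hdecay x hx) 2).trans_eq ?_
      rw [mul_pow, ← Real.exp_nat_mul ((d - 1 / 4) * x), Nat.cast_two]
    have h3 : Real.exp (2 * x) * Real.exp ((d - 1 / 4) * x) ≤ Real.exp ((d + 5 / 4) * x) := by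
      rw [← Real.exp_add]
      exact Real.exp_le_exp.2 (by nlinarith)
    have h4 : Real.exp (2 * ((d - 1 / 4) * x)) * Real.exp ((d - 1 / 4) * x)
        ≤ Real.exp ((d + 5 / 4) * x) := by
      rw [← Real.exp_add]
      exact Real.exp_le_exp.2 (by nlinarith)
    calc |E x| ≤ C * (colatSin x ^ 2 + y x ^ 2) * |y x| := hEb x hx
      _ ≤ C * (4 * Real.exp (2 * x) + K₁ ^ 2 * Real.exp (2 * ((d - 1 / 4) * x)))
          * (K₁ * Real.exp ((d - 1 / 4) * x)) := by
        gcongr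
        exact hdecay x hx
      _ = C * K₁ * (4 * (Real.exp (2 * x) * Real.exp ((d - 1 / 4) * x))
          + K₁ ^ 2 * (Real.exp (2 * ((d - 1 / 4) * x)) * Real.exp ((d - 1 / 4) * x))) := by ring
      _ ≤ C * K₁ * (4 * Real.exp ((d + 5 / 4) * x) + K₁ ^ 2 * Real.exp ((d + 5 / 4) * x)) := by
        have : 0 ≤ C * K₁ := mul_nonneg hC (Real.exp_pos _).le
        gcongr
      _ = _ := by ring
  have hufin : ∀ x ≤ X, |p x - d * y x| ≤ C * (4 + K₁ ^ 2) * K₁ * Real.exp ((d + 5 / 4) * x) :=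
    fun x hx => abs_le_of_hasDerivAt_of_bounded (κ := d + n) (x₁ := x) (by linarith) (by linarith)
      (by positivity) (fun t _ => hu t) (fun t ht => hbdd t (ht.trans hx))
      (fun t ht => hEfin t (ht.trans hx))
  refine ⟨hufin, ?_⟩
  -- `exp (-d x) y` has an integrable derivative; its limit is the leading coefficient
  have hg : ∀ x ≤ X, HasDerivAt (fun x => Real.exp (-(d * x)) * y x)
      (Real.exp (-(d * x)) * (p x - d * y x)) x := fun x _ => by
    refine ((((hasDerivAt_id x).const_mul (d : ℝ)).neg.exp).mul (h.hasDerivAt_fst x)).congr_deriv ?_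
    simp only [id, Pi.neg_apply]
    ring
  obtain ⟨c, hc⟩ := exists_abs_sub_le_of_hasDerivAt (K := C * (4 + K₁ ^ 2) * K₁) (A := 5 / 4)
    (by positivity) (by norm_num) hg fun x hx => by
      rw [abs_mul, abs_of_pos (Real.exp_pos _)]
      calc _ ≤ Real.exp (-(d * x)) * (C * (4 + K₁ ^ 2) * K₁ * Real.exp ((d + 5 / 4) * x)) := by
            gcongr
            exact hufin x hx
        _ = C * (4 + K₁ ^ 2) * K₁ * (Real.exp (-(d * x)) * Real.exp ((d + 5 / 4) * x)) := by ring
        _ = _ := by rw [← Real.exp_add]; ring_nf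
  refine ⟨c, fun x hx => ?_⟩
  have h1 := mul_le_mul_of_nonneg_right (hc x hx) (Real.exp_pos (d * x)).le
  have h2 : Real.exp (-(d * x)) * Real.exp (d * x) = 1 := by rw [← Real.exp_add]; simp
  rw [← abs_of_pos (Real.exp_pos (d * x)), ← abs_mul, abs_of_pos (Real.exp_pos (d * x)), sub_mul,
    mul_right_comm, h2, one_mul] at h1
  refine h1.trans_eq ?_
  rw [mul_assoc, ← Real.exp_add]
  ring_nf

end Asymptotics

/-! ### Solutions on the half-line and the Volterra equation -/

section Bridge

/-- The pair `(G, H)` with `y = r ^ d * G`, `p = r ^ d * (d * G + r * H)`, where `r = exp x`. -/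
noncomputable def poleCurve (d : ℕ) (c : ℝ) (y p : ℝ → ℝ) (r : ℝ) : ℂ × ℂ :=
  if r ≤ 0 then ((c : ℂ), 0) else
    (((y (Real.log r) / r ^ d : ℝ) : ℂ),
      (((p (Real.log r) - d * y (Real.log r)) / r ^ (d + 1) : ℝ) : ℂ))

/-- The pair `(y, p)` that belongs to a pair `(G, H)` of functions of `r = exp x`. -/
noncomputable def poleLift (d : ℕ) (Y : ℝ → ℂ × ℂ) (x : ℝ) : ℝ × ℝ :=
  (Real.exp x ^ d * (Y (Real.exp x)).1.re,
    Real.exp x ^ d * (d * (Y (Real.exp x)).1.re + Real.exp x * (Y (Real.exp x)).2.re))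

lemma poleLift_poleCurve (d : ℕ) (c : ℝ) (y p : ℝ → ℝ) (x : ℝ) :
    poleLift d (poleCurve d c y p) x = (y x, p x) := by
  have h := Real.exp_pos x
  simp only [poleLift, poleCurve, if_neg (not_le.2 h), Real.log_exp, Complex.ofReal_re]
  refine Prod.ext ?_ ?_
  · field_simp
  · field_simp
    ring

lemma conjPair_poleCurve (d : ℕ) (c : ℝ) (y p : ℝ → ℝ) (r : ℝ) :
    conjPair (poleCurve d c y p r) = poleCurve d c y p r := by
  unfold poleCurve
  split_ifs <;> simp [conjPair_apply]

lemma hasDerivAt_poleCurve {n d : ℕ} (hd : 1 ≤ d) {a : ℝ} (ha : a ≠ 0) {y p : ℝ → ℝ}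
    (h : IsTrajectory n (d * (d + n)) a y p) (c : ℝ) {r : ℝ} (hr : 0 < r) :
    HasDerivAt (poleCurve d c y p) ((poleCurve d c y p r).2,
      poleForce n d a r (poleCurve d c y p r)
        - (2 * d + n + 1) * (poleCurve d c y p r).2 / r) r := by
  have hlog := Real.hasDerivAt_log hr.ne'
  have hy := (h.hasDerivAt_fst (Real.log r)).comp r hlog
  have hp := (h.hasDerivAt_snd (Real.log r)).comp r hlog
  have hG := (hy.div (hasDerivAt_pow d r) (pow_ne_zero d hr.ne')).ofReal_comp
  have hH := ((hp.sub (hy.const_mul (d : ℝ))).div (hasDerivAt_pow (d + 1) r)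
    (pow_ne_zero (d + 1) hr.ne')).ofReal_comp
  have heq : poleCurve d c y p =ᶠ[𝓝 r] fun r => (((y (Real.log r) / r ^ d : ℝ) : ℂ),
      (((p (Real.log r) - d * y (Real.log r)) / r ^ (d + 1) : ℝ) : ℂ)) := by
    filter_upwards [lt_mem_nhds hr] with t ht
    simp only [poleCurve, if_neg (not_le.2 ht)]
  refine ((hG.prodMk hH).congr_of_eventuallyEq heq).congr_deriv ?_
  have hacc := profileAccel_eq_poleForce (n := n) hd ha (Real.log r) (y (Real.log r) / r ^ d)
    ((p (Real.log r) - d * y (Real.log r)) / r ^ (d + 1))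
  rw [Real.exp_log hr] at hacc
  have e1 : r ^ d * (y (Real.log r) / r ^ d) = y (Real.log r) := by field_simp
  have e2 : r ^ d * (d * (y (Real.log r) / r ^ d)
      + r * ((p (Real.log r) - d * y (Real.log r)) / r ^ (d + 1))) = p (Real.log r) := by
    field_simp
    ring
  rw [e1, e2] at hacc
  have hrc : (r : ℂ) ≠ 0 := by exact_mod_cast hr.ne'
  simp only [poleCurve, if_neg (not_le.2 hr), Function.comp_apply, Pi.sub_apply]
  refine Prod.ext ?_ ?_
  · obtain ⟨e, rfl⟩ : ∃ e, d = e + 1 := ⟨d - 1, by omega⟩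
    simp only [Complex.ofReal_inj, add_tsub_cancel_right]
    push_cast
    field_simp
    ring
  · push_cast at hacc ⊢
    rw [hacc]
    generalize poleForce n d a _ _ = Q
    generalize (y (Real.log r) : ℂ) = u
    generalize (p (Real.log r) : ℂ) = v
    field_simp
    ring

lemma continuousOn_poleCurve {d : ℕ} {c K X : ℝ} {y p : ℝ → ℝ} (hy : Continuous y)
    (hp : Continuous p)
    (hu : ∀ x ≤ X, |p x - d * y x| ≤ K * Real.exp ((d + 5 / 4) * x))
    (hc : ∀ x ≤ X, |y x - c * Real.exp (d * x)| ≤ K * Real.exp ((d + 5 / 4) * x)) :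
    ContinuousOn (poleCurve d c y p) (Icc 0 1) := by
  rintro r ⟨hr, -⟩
  rcases hr.eq_or_lt with rfl | hr
  · have h0 : poleCurve d c y p 0 = ((c : ℂ), 0) := if_pos le_rfl
    have hlog : ∀ q : ℝ, 0 < q → Tendsto (fun r => K * Real.exp (q * Real.log r)) (𝓝[>] 0) (𝓝 0) :=
      fun q hq => by
        have h1 : Tendsto (fun r => q * Real.log r) (𝓝[>] 0) atBot :=
          Real.tendsto_log_nhdsGT_zero.const_mul_atBot hq
        simpa using (Real.tendsto_exp_atBot.comp h1).const_mul K
    have hev : ∀ᶠ r in 𝓝[>] (0 : ℝ), 0 < r ∧ Real.log r ≤ X :=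
      (eventually_mem_nhdsWithin).and (Real.tendsto_log_nhdsGT_zero.eventually_le_atBot X)
    have hexp : ∀ r : ℝ, 0 < r → ∀ m : ℕ, Real.exp (m * Real.log r) = r ^ m := fun r hr m => by
      rw [Real.exp_nat_mul, Real.exp_log hr]
    have hG : Tendsto (fun r => y (Real.log r) / r ^ d) (𝓝[>] 0) (𝓝 c) := by
      rw [tendsto_iff_norm_sub_tendsto_zero]
      refine squeeze_zero' (Eventually.of_forall fun _ => norm_nonneg _) ?_
          (hlog (5 / 4) (by norm_num))
      filter_upwards [hev] with r hr
      have hrd : 0 < r ^ d := pow_pos hr.1 d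
      have h1 := hc _ hr.2
      rw [hexp r hr.1, add_mul, Real.exp_add, hexp r hr.1] at h1
      have h2 : y (Real.log r) / r ^ d - c = (y (Real.log r) - c * r ^ d) / r ^ d := by field_simp
      rw [Real.norm_eq_abs, h2, abs_div, abs_of_pos hrd, div_le_iff₀ hrd]
      linarith
    have hH : Tendsto (fun r => (p (Real.log r) - d * y (Real.log r)) / r ^ (d + 1)) (𝓝[>] 0)
        (𝓝 0) := by
      rw [tendsto_zero_iff_norm_tendsto_zero]
      refine squeeze_zero' (Eventually.of_forall fun _ => norm_nonneg _) ?_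
          (hlog (1 / 4) (by norm_num))
      filter_upwards [hev] with r hr
      have hrd : 0 < r ^ (d + 1) := pow_pos hr.1 _
      have h1 := hu _ hr.2
      rw [show ((d : ℝ) + 5 / 4) * Real.log r = ((d + 1 : ℕ) : ℝ) * Real.log r
        + 1 / 4 * Real.log r by push_cast; ring, Real.exp_add, hexp r hr.1] at h1
      rw [Real.norm_eq_abs, abs_div, abs_of_pos hrd, div_le_iff₀ hrd]
      linarith
    have h1 : Tendsto (poleCurve d c y p) (𝓝[>] 0) (𝓝 ((c : ℂ), 0)) := by
      have h2 := ((Complex.continuous_ofReal.tendsto c).comp hG).prodMk_nhds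
        ((Complex.continuous_ofReal.tendsto 0).comp hH)
      rw [Complex.ofReal_zero] at h2
      refine h2.congr' ?_
      filter_upwards [hev] with r hr
      simp only [poleCurve, if_neg (not_le.2 hr.1), Function.comp_apply]
    have h2 : ContinuousWithinAt (poleCurve d c y p) (Ioi 0) 0 := by
      rw [ContinuousWithinAt, h0]; exact h1
    exact (continuousWithinAt_Ioi_iff_Ici.1 h2).mono Icc_subset_Ici_self
  · have heq : poleCurve d c y p =ᶠ[𝓝 r] fun r => (((y (Real.log r) / r ^ d : ℝ) : ℂ),
        (((p (Real.log r) - d * y (Real.log r)) / r ^ (d + 1) : ℝ) : ℂ)) := by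
      filter_upwards [lt_mem_nhds hr] with t ht
      simp only [poleCurve, if_neg (not_le.2 ht)]
    refine ContinuousAt.continuousWithinAt (ContinuousAt.congr ?_ heq.symm)
    have hlog := Real.continuousAt_log hr.ne'
    have c1 : ContinuousAt (fun r => y (Real.log r)) r := hy.continuousAt.comp hlog
    have c2 : ContinuousAt (fun r => p (Real.log r)) r := hp.continuousAt.comp hlog
    refine (Complex.continuous_ofReal.continuousAt.comp
      (c1.div (continuous_pow d).continuousAt (pow_ne_zero d hr.ne'))).prodMk
      (Complex.continuous_ofReal.continuousAt.comp
        ((c2.sub (continuousAt_const.mul c1)).div (continuous_pow (d + 1)).continuousAt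
          (pow_ne_zero _ hr.ne')))

lemma continuousOn_poleForce {n d : ℕ} {a : ℝ} (ha : a ≠ 0) {Y : ℝ → ℂ × ℂ}
    (hY : ContinuousOn Y (Icc 0 1)) (hreal : ∀ t ∈ Icc (0 : ℝ) 1, conjPair (Y t) = Y t) :
    ContinuousOn (fun t : ℝ => poleForce n d a t (Y t)) (Icc 0 1) := fun t ht =>
  ContinuousAt.comp_continuousWithinAt (f := fun t : ℝ => ((t : ℂ), Y t))
    (g := fun w : ℂ × ℂ × ℂ => poleForce n d a w.1 w.2)
    (contDiffAt_poleForce_ofReal (m := 0) ha ht.1 (hreal t ht)).continuousAt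
    (Complex.continuous_ofReal.continuousWithinAt.prodMk (hY t ht))

/-- A trajectory with regular asymptotics solves the Volterra equation. -/
lemma isPoleSolution_poleCurve {n d : ℕ} (hd : 1 ≤ d) {a : ℝ} (ha : a ≠ 0) {c K X : ℝ}
    {y p : ℝ → ℝ} (h : IsTrajectory n (d * (d + n)) a y p)
    (hu : ∀ x ≤ X, |p x - d * y x| ≤ K * Real.exp ((d + 5 / 4) * x))
    (hc : ∀ x ≤ X, |y x - c * Real.exp (d * x)| ≤ K * Real.exp ((d + 5 / 4) * x)) :
    IsPoleSolution n d a c (poleCurve d c y p) := by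
  have hcont := continuousOn_poleCurve h.continuous_fst h.continuous_snd hu hc
  refine ⟨hcont, fun t ht => ?_⟩
  set Y := poleCurve d c y p with hY
  have h0 : Y 0 = ((c : ℂ), 0) := if_pos le_rfl
  rcases ht.1.eq_or_lt with rfl | ht0
  · simp [poleKernel, h0]
  have hm : ∀ r ∈ Icc (0 : ℝ) 1, t * r ∈ Icc (0 : ℝ) 1 := fun r hr => mul_mem_unitInterval ht hr
  have hYt : ContinuousOn (fun r => Y (t * r)) (Icc 0 1) := hcont.comp (by fun_prop) hm
  have hpow : ContinuousOn (fun r : ℝ => (r : ℂ) ^ (2 * d + n + 1)) (Icc 0 1) :=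
    (Complex.continuous_ofReal.pow _).continuousOn
  have hker : ContinuousOn (fun r => poleKernel n d a t r (Y (t * r))) (Icc 0 1) := by
    have h2 : ContinuousOn (fun r : ℝ => poleForce n d a ((t * r : ℝ) : ℂ) (Y (t * r))) (Icc 0 1) :=
      (continuousOn_poleForce ha hcont fun t _ => conjPair_poleCurve d c y p t).comp
        (f := fun r => t * r) (by fun_prop) hm
    unfold poleKernel
    exact (continuousOn_const.mul hYt.snd).prodMk ((hpow.mul continuousOn_const).mul h2)
  have hφ : ContinuousOn (fun r : ℝ => ((Y (t * r)).1, (r : ℂ) ^ (2 * d + n + 1) * (Y (t * r)).2))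
      (Icc 0 1) := hYt.fst.prodMk (hpow.mul hYt.snd)
  have hder : ∀ r ∈ Ioo (0 : ℝ) 1, HasDerivAt
      (fun r : ℝ => ((Y (t * r)).1, (r : ℂ) ^ (2 * d + n + 1) * (Y (t * r)).2))
      (poleKernel n d a t r (Y (t * r))) r := fun r hr => by
    have h1 := (hasDerivAt_poleCurve hd ha h c (mul_pos ht0 hr.1)).scomp r
      ((hasDerivAt_id r).const_mul t)
    have hfst : HasDerivAt (fun r => (Y (t * r)).1) _ r :=
      (ContinuousLinearMap.fst ℝ ℂ ℂ).hasFDerivAt.comp_hasDerivAt r h1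
    have hsnd : HasDerivAt (fun r => (Y (t * r)).2) _ r :=
      (ContinuousLinearMap.snd ℝ ℂ ℂ).hasFDerivAt.comp_hasDerivAt r h1
    have hrp : HasDerivAt (fun r : ℝ => (r : ℂ) ^ (2 * d + n + 1)) _ r :=
      ((hasDerivAt_id r).ofReal_comp).pow (2 * d + n + 1)
    refine (hfst.prodMk (hrp.mul hsnd)).congr_deriv ?_
    have hrc : (r : ℂ) ≠ 0 := by exact_mod_cast hr.1.ne'
    have htc : (t : ℂ) ≠ 0 := by exact_mod_cast ht0.ne'
    refine Prod.ext ?_ ?_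
    · simp [poleKernel, Y]
    · simp only [poleKernel, ContinuousLinearMap.coe_snd', id, Prod.smul_snd, Complex.real_smul,
        Y, add_tsub_cancel_right]
      push_cast
      generalize poleForce n d a _ _ = Q
      field_simp
      ring
  have key := intervalIntegral.integral_eq_sub_of_hasDerivAt_of_le zero_le_one hφ hder
    (hker.intervalIntegrable_of_Icc zero_le_one)
  rw [key]
  simp [h0]

/-- The derivative at the end of a primitive, also at the end points of the interval. -/
lemma hasDerivWithinAt_integral_Icc {E : Type*} [NormedAddCommGroup E] [NormedSpace ℝ E]
    [CompleteSpace E] {f : ℝ → E} (hf : ContinuousOn f (Icc 0 1)) {t : ℝ} (ht : t ∈ Icc (0 : ℝ) 1) :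
    HasDerivWithinAt (fun t => ∫ r in (0 : ℝ)..t, f r) (f t) (Icc 0 1) t := by
  set F : ℝ → E := IccExtend zero_le_one ((Icc (0 : ℝ) 1).domRestrict f) with hF
  have hFc : Continuous F := (continuousOn_iff_continuous_domRestrict.1 hf).Icc_extend'
  have heq : ∀ r ∈ Icc (0 : ℝ) 1, F r = f r := fun r hr => by
    simp [hF, IccExtend_of_mem zero_le_one _ hr]
  rw [← heq t ht]
  refine (hFc.integral_hasStrictDerivAt 0 t).hasDerivAt.hasDerivWithinAt.congr_of_mem
    (fun s hs => intervalIntegral.integral_congr fun r hr => ?_) ht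
  rw [uIcc_of_le hs.1] at hr
  exact (heq r ⟨hr.1, hr.2.trans hs.2⟩).symm

namespace IsPoleSolution

variable {n d : ℕ} {a : ℝ} {c : ℂ} {Y Z : ℝ → ℂ × ℂ}

lemma hasDerivWithinAt (ha : a ≠ 0) (h : IsPoleSolution n d a c Y)
    (hreal : ∀ t ∈ Icc (0 : ℝ) 1, conjPair (Y t) = Y t) {t : ℝ} (ht : t ∈ Ioc (0 : ℝ) 1) :
    HasDerivWithinAt Y ((Y t).2, poleForce n d a t (Y t) - (2 * d + n + 1) * (Y t).2 / t)
      (Icc 0 1) t := by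
  have htI := Ioc_subset_Icc_self ht
  have hQ := continuousOn_poleForce (n := n) (d := d) ha h.continuousOn hreal
  have hpow : ContinuousOn (fun r : ℝ => (r : ℂ) ^ (2 * d + n + 1)) (Icc 0 1) :=
    (Complex.continuous_ofReal.pow _).continuousOn
  have hint : ∀ t ∈ Icc (0 : ℝ) 1, IntervalIntegrable (fun r => poleKernel n d a t r (Y (t * r)))
      MeasureTheory.volume 0 1 := fun t ht => by
    refine ContinuousOn.intervalIntegrable_of_Icc zero_le_one ?_
    have hm : ∀ r ∈ Icc (0 : ℝ) 1, t * r ∈ Icc (0 : ℝ) 1 := fun r hr => mul_mem_unitInterval ht hr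
    have h2 : ContinuousOn (fun r : ℝ => poleForce n d a ((t * r : ℝ) : ℂ) (Y (t * r))) (Icc 0 1) :=
      hQ.comp (f := fun r => t * r) (by fun_prop) hm
    have hYt : ContinuousOn (fun r => Y (t * r)) (Icc 0 1) :=
      h.continuousOn.comp (by fun_prop) hm
    unfold poleKernel
    exact (continuousOn_const.mul hYt.snd).prodMk ((hpow.mul continuousOn_const).mul h2)
  have hfst : ∀ t ∈ Icc (0 : ℝ) 1, (Y t).1 = c + ∫ r in (0 : ℝ)..t, (Y r).2 := fun t ht => by
    have h1 := congrArg (ContinuousLinearMap.fst ℝ ℂ ℂ) (h.eq_add_integral t ht)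
    rw [map_add, ← ContinuousLinearMap.intervalIntegral_comp_comm _ (hint t ht)] at h1
    simp only [ContinuousLinearMap.coe_fst', poleKernel] at h1
    have h2 := intervalIntegral.smul_integral_comp_mul_left (a := 0) (b := 1)
      (fun r => (Y r).2) t
    rw [mul_zero, mul_one, ← intervalIntegral.integral_smul] at h2
    rw [h1, ← h2]
    simp only [Complex.real_smul]
  have hsnd : ∀ t ∈ Icc (0 : ℝ) 1, (t : ℂ) ^ (2 * d + n + 1) * (Y t).2
      = ∫ r in (0 : ℝ)..t, (r : ℂ) ^ (2 * d + n + 1) * poleForce n d a r (Y r) := fun t ht => by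
    have h1 := congrArg (ContinuousLinearMap.snd ℝ ℂ ℂ) (h.eq_add_integral t ht)
    rw [map_add, ← ContinuousLinearMap.intervalIntegral_comp_comm _ (hint t ht)] at h1
    simp only [ContinuousLinearMap.coe_snd', poleKernel, zero_add] at h1
    have h2 := intervalIntegral.smul_integral_comp_mul_left (a := 0) (b := 1)
      (fun r : ℝ => (r : ℂ) ^ (2 * d + n + 1) * poleForce n d a r (Y r)) t
    rw [mul_zero, mul_one, ← intervalIntegral.integral_smul] at h2
    rw [h1, ← h2, ← intervalIntegral.integral_const_mul]
    refine intervalIntegral.integral_congr fun r _ => ?_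
    simp only [Complex.real_smul, Complex.ofReal_mul, mul_pow]
    ring
  have htc : (t : ℂ) ≠ 0 := by exact_mod_cast ht.1.ne'
  have d1 : HasDerivWithinAt (fun t => (Y t).1) (Y t).2 (Icc 0 1) t :=
    ((hasDerivWithinAt_integral_Icc h.continuousOn.snd htI).const_add c).congr_of_mem hfst htI
  have d2 : HasDerivWithinAt (fun t : ℝ => (t : ℂ) ^ (2 * d + n + 1) * (Y t).2)
      ((t : ℂ) ^ (2 * d + n + 1) * poleForce n d a t (Y t)) (Icc 0 1) t :=
    (hasDerivWithinAt_integral_Icc (hpow.mul hQ) htI).congr_of_mem hsnd htI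
  have d3 : HasDerivWithinAt (fun t : ℝ => (t : ℂ) ^ (2 * d + n + 1)) _ (Icc 0 1) t :=
    (((hasDerivAt_id t).ofReal_comp).pow (2 * d + n + 1)).hasDerivWithinAt
  have d4 := d2.div d3 (pow_ne_zero _ (by simpa using htc))
  have d5 : HasDerivWithinAt (fun t => (Y t).2)
      (poleForce n d a t (Y t) - (2 * d + n + 1) * (Y t).2 / t) (Icc 0 1) t := by
    have hev : (fun t => (Y t).2) =ᶠ[𝓝[Icc 0 1] t]
        (fun t : ℝ => (t : ℂ) ^ (2 * d + n + 1) * (Y t).2) / fun t : ℝ => (t : ℂ) ^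
            (2 * d + n + 1) := by
      filter_upwards [mem_nhdsWithin_of_mem_nhds (lt_mem_nhds ht.1)] with s hs
      have : (s : ℂ) ≠ 0 := by exact_mod_cast (show s ≠ 0 from (ne_of_gt hs))
      simp only [Pi.div_apply]
      field_simp
    refine (d4.congr_of_eventuallyEq_of_mem hev htI).congr_deriv ?_
    simp only [id, add_tsub_cancel_right]
    push_cast
    field_simp
    ring
  exact d1.prodMk d5

/-- A real solution of the Volterra equation solves the Euler-Lagrange equation on `(-∞, 0]`. -/
lemma hasDerivWithinAt_poleLift (hd : 1 ≤ d) (ha : a ≠ 0) (h : IsPoleSolution n d a c Y)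
    (hreal : ∀ t ∈ Icc (0 : ℝ) 1, conjPair (Y t) = Y t) {x : ℝ} (hx : x ≤ 0) :
    HasDerivWithinAt (poleLift d Y) (profileField n (d * (d + n)) a x (poleLift d Y x)) (Iic 0)
        x := by
  have hmaps : MapsTo Real.exp (Iic 0) (Icc 0 1) := fun x hx =>
    ⟨(Real.exp_pos x).le, Real.exp_le_one_iff.2 hx⟩
  have hexp : HasDerivWithinAt Real.exp (Real.exp x) (Iic 0) x :=
      (Real.hasDerivAt_exp x).hasDerivWithinAt
  have h1 := (h.hasDerivWithinAt ha hreal ⟨Real.exp_pos x, Real.exp_le_one_iff.2 hx⟩).scomp x hexp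
      hmaps
  have hG : HasDerivWithinAt (fun x => (Y (Real.exp x)).1.re) _ (Iic 0) x :=
    (Complex.reCLM.comp (ContinuousLinearMap.fst ℝ ℂ ℂ)).hasFDerivAt.comp_hasDerivWithinAt x h1
  have hH : HasDerivWithinAt (fun x => (Y (Real.exp x)).2.re) _ (Iic 0) x :=
    (Complex.reCLM.comp (ContinuousLinearMap.snd ℝ ℂ ℂ)).hasFDerivAt.comp_hasDerivWithinAt x h1
  have hpow := hexp.pow d
  have hy := hpow.mul hG
  have hp := hpow.mul ((hG.const_mul (d : ℝ)).add (hexp.mul hH))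
  refine (hy.prodMk hp).congr_deriv ?_
  have hY := eq_ofReal_of_conjPair_eq (hreal (Real.exp x) (hmaps hx))
  set G := (Y (Real.exp x)).1.re with hGdef
  set H := (Y (Real.exp x)).2.re with hHdef
  have hacc := congrArg Complex.re (profileAccel_eq_poleForce (n := n) hd ha x G H)
  rw [← hY] at hacc
  set Q := poleForce n d a (Real.exp x) (Y (Real.exp x)) with hQ
  set r := Real.exp x with hr
  have hr0 : r ≠ 0 := (Real.exp_pos x).ne'
  have hre : ((r : ℂ) ^ d * (d ^ 2 * G - n * (r * H) + (r : ℂ) ^ 2 * Q)).re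
      = r ^ d * (d ^ 2 * G - n * (r * H) + r ^ 2 * Q.re) := by
    have : (r : ℂ) ^ d * (d ^ 2 * G - n * (r * H) + (r : ℂ) ^ 2 * Q)
        = ((r ^ d * (d ^ 2 * G - n * (r * H)) : ℝ) : ℂ) + ((r ^ d * r ^ 2 : ℝ) : ℂ) * Q := by
      push_cast; ring
    rw [this, Complex.add_re, Complex.ofReal_re, Complex.re_ofReal_mul]
    ring
  rw [Complex.ofReal_re, hre] at hacc
  have hQM : (Q - (2 * d + n + 1) * (Y r).2 / r).re = Q.re - (2 * d + n + 1) * H / r := by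
    rw [hY]
    have : ((2 * d + n + 1) * (H : ℂ) / r) = (((2 * d + n + 1) * H / r : ℝ) : ℂ) := by
      push_cast
      rfl
    simp only [this, Complex.sub_re, Complex.ofReal_re]
  simp only [profileField, poleLift, ← hr, ← hGdef, ← hHdef]
  rw [hacc]
  simp only [ContinuousLinearMap.comp_apply, ContinuousLinearMap.coe_fst', Complex.reCLM_apply,
    ContinuousLinearMap.coe_snd', Prod.smul_fst, Prod.smul_snd, Complex.smul_re, smul_eq_mul, hQM,
    Pi.add_apply, Pi.mul_apply, Pi.pow_apply, ← hr, ← hGdef, ← hHdef]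
  obtain ⟨e, rfl⟩ : ∃ e, d = e + 1 := ⟨d - 1, by omega⟩
  simp only [add_tsub_cancel_right]
  refine Prod.ext ?_ ?_
  · push_cast
    ring
  · push_cast
    field_simp
    ring

lemma tendsto_poleLift_fst (h : IsPoleSolution n d a c Y) :
    Tendsto (fun x => Real.exp (-(d * x)) * (poleLift d Y x).1) atBot (𝓝 c.re) := by
  have h1 : Tendsto (fun x => (Y (Real.exp x)).1.re) atBot (𝓝 c.re) := by
    have h2 : Tendsto Real.exp atBot (𝓝[Icc 0 1] 0) :=
      tendsto_nhdsWithin_iff.2 ⟨Real.tendsto_exp_atBot, by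
        filter_upwards [eventually_le_atBot 0] with x hx
        exact ⟨(Real.exp_pos x).le, Real.exp_le_one_iff.2 hx⟩⟩
    have h3 := (h.continuousOn 0 (by simp)).tendsto.comp h2
    rw [h.apply_zero] at h3
    exact (Complex.continuous_re.tendsto _).comp h3.fst_nhds
  refine h1.congr fun x => ?_
  rw [poleLift, ← mul_assoc, ← Real.exp_nat_mul, ← Real.exp_add]
  simp

lemma tendsto_poleLift_fst_zero (hd : 1 ≤ d) (h : IsPoleSolution n d a c Y) :
    Tendsto (fun x => (poleLift d Y x).1) atBot (𝓝 0) := by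
  have h1 : Tendsto (fun x : ℝ => (d : ℝ) * x) atBot atBot :=
    tendsto_id.const_mul_atBot (by exact_mod_cast hd)
  have h2 := (Real.tendsto_exp_atBot.comp h1).mul h.tendsto_poleLift_fst
  rw [zero_mul] at h2
  refine h2.congr fun x => ?_
  rw [← mul_assoc, Function.comp_apply, ← Real.exp_add]
  simp

/-- A real solution is determined by the value of `G` at `0`. -/
lemma poleLift_eq (hd : 1 ≤ d) (ha : a ≠ 0) (hY : IsPoleSolution n d a c Y)
    (hYr : ∀ t ∈ Icc (0 : ℝ) 1, conjPair (Y t) = Y t) (hZ : IsPoleSolution n d a c Z)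
    (hZr : ∀ t ∈ Icc (0 : ℝ) 1, conjPair (Z t) = Z t) {x : ℝ} (hx : x ≤ 0) :
    poleLift d Y x = poleLift d Z x := by
  obtain ⟨τ, hτ, heq⟩ := hZ.exists_eqOn ha hZr hY
  have hlog : Real.log τ ≤ 0 := Real.log_nonpos hτ.1.le hτ.2
  have h0 : ∀ t ≤ Real.log τ, poleLift d Y t = poleLift d Z t := fun t ht => by
    have h1 : Real.exp t ≤ τ := by
      rw [← Real.exp_log hτ.1]; exact Real.exp_le_exp.2 ht
    rw [poleLift, poleLift, heq ⟨(Real.exp_pos t).le, h1⟩]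
  rcases le_total x (Real.log τ) with hx' | hx'
  · exact h0 x hx'
  · have hsub : Icc (Real.log τ) 0 ⊆ Iic 0 := fun t ht => ht.2
    exact profileField_unique ha (s := n) (lam := d * (d + n)) ⟨le_rfl, hlog⟩
      (fun t ht => (hY.hasDerivWithinAt_poleLift hd ha hYr ht.2).mono hsub)
      (fun t ht => (hZ.hasDerivWithinAt_poleLift hd ha hZr ht.2).mono hsub)
      (h0 _ le_rfl) ⟨hx', hx⟩

end IsPoleSolution

end Bridge

/-! ### Intersections of analytic curves -/

section Curves

/-- If two analytic plane curves, one of them regular, meet in parameters that accumulate, then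
the first is locally contained in the second; coordinate version. -/
lemma eventually_exists_eq_of_deriv_ne_zero {α β α' β' : ℝ → ℝ} {t s : ℝ} (hα : AnalyticAt ℝ α t)
    (hβ : AnalyticAt ℝ β t) (hα' : AnalyticAt ℝ α' s) (hβ' : AnalyticAt ℝ β' s)
    (hd : deriv α' s ≠ 0) (hts : α t = α' s)
    (hfreq : ∃ᶠ q in 𝓝 (t, s), q.1 ≠ t ∧ α q.1 = α' q.2 ∧ β q.1 = β' q.2) {V : Set ℝ}
    (hV : V ∈ 𝓝 s) : ∀ᶠ c in 𝓝 t, ∃ u ∈ V, α c = α' u ∧ β c = β' u := by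
  set h := hα'.hasStrictDerivAt.localInverse _ _ _ hd with hh
  have hleft : ∀ᶠ u in 𝓝 s, h (α' u) = u := HasStrictDerivAt.eventually_left_inverse ..
  have hright : ∀ᶠ v in 𝓝 (α' s), α' (h v) = v := HasStrictDerivAt.eventually_right_inverse ..
  have hs : h (α' s) = s := hleft.self_of_nhds
  have hψ : AnalyticAt ℝ (h ∘ α) t := by
    refine AnalyticAt.comp ?_ hα
    rw [hts]
    exact hα'.analyticAt_localInverse hd
  have hψt : (h ∘ α) t = s := by rw [Function.comp_apply, hts, hs]
  have hβψ : AnalyticAt ℝ (β' ∘ (h ∘ α)) t := by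
    refine AnalyticAt.comp ?_ hψ
    rwa [hψt]
  have hzero : ∃ᶠ c in 𝓝[≠] t, β c = (β' ∘ (h ∘ α)) c := by
    rw [frequently_nhdsWithin_iff]
    have h1 : ∃ᶠ q in 𝓝 (t, s), β q.1 = (β' ∘ (h ∘ α)) q.1 ∧ q.1 ∈ ({t}ᶜ : Set ℝ) := by
      refine (hfreq.and_eventually ((continuousAt_snd (p := (t, s))).eventually hleft)).mono ?_
      rintro q ⟨⟨h1, h2, h3⟩, h4⟩
      refine ⟨?_, h1⟩
      rw [Function.comp_apply, Function.comp_apply, h2, h4, h3]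
    exact (continuousAt_fst (p := (t, s))).frequently h1
  have heq := (hβ.frequently_eq_iff_eventually_eq hβψ).1 hzero
  have hr' : ∀ᶠ c in 𝓝 t, α' (h (α c)) = α c :=
    hα.continuousAt.eventually (by rwa [hts])
  have hV' : ∀ᶠ c in 𝓝 t, (h ∘ α) c ∈ V := hψ.continuousAt.eventually (by rwa [hψt])
  filter_upwards [heq, hr', hV'] with c h1 h2 h3
  exact ⟨h (α c), h3, h2.symm, h1⟩

lemma eventually_exists_eq_of_frequently {γ γ' : ℝ → ℝ × ℝ} {t s κ : ℝ} (hγ : AnalyticAt ℝ γ t)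
    (hγ' : AnalyticAt ℝ γ' s) (hκ : 0 < κ) (hreg : ∀ᶠ u in 𝓝 s, κ * |u - s| ≤ ‖γ' u - γ' s‖)
    (hts : γ t = γ' s) (hfreq : ∃ᶠ q in 𝓝 (t, s), q.1 ≠ t ∧ γ q.1 = γ' q.2) {V : Set ℝ}
    (hV : V ∈ 𝓝 s) : ∀ᶠ c in 𝓝 t, ∃ u ∈ V, γ c = γ' u := by
  have hf : ∀ {γ : ℝ → ℝ × ℝ} {t : ℝ}, AnalyticAt ℝ γ t → AnalyticAt ℝ (fun c => (γ c).1) t :=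
    fun h => analyticAt_fst.comp h
  have hs : ∀ {γ : ℝ → ℝ × ℝ} {t : ℝ}, AnalyticAt ℝ γ t → AnalyticAt ℝ (fun c => (γ c).2) t :=
    fun h => analyticAt_snd.comp h
  by_cases h1 : deriv (fun c => (γ' c).1) s = 0
  · by_cases h2 : deriv (fun c => (γ' c).2) s = 0
    · exfalso
      have h3 : HasDerivAt γ' (0, 0) s := by
        have e1 := (hf hγ').differentiableAt.hasDerivAt
        have e2 := (hs hγ').differentiableAt.hasDerivAt
        rw [h1] at e1
        rw [h2] at e2
        exact e1.prodMk e2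
      rw [hasDerivAt_iff_isLittleO] at h3
      have h4 := h3.def (half_pos hκ)
      have h5 : ∀ᶠ u in 𝓝[≠] s, False := by
        filter_upwards [nhdsWithin_le_nhds h4, nhdsWithin_le_nhds hreg, self_mem_nhdsWithin]
          with u h6 h7 h8
        rw [show ((0 : ℝ), (0 : ℝ)) = 0 from rfl, smul_zero, sub_zero, Real.norm_eq_abs] at h6
        have h9 : 0 < |u - s| := abs_pos.2 (sub_ne_zero.2 h8)
        nlinarith
      exact (h5.exists).elim fun _ h => h
    · have := eventually_exists_eq_of_deriv_ne_zero (hs hγ) (hf hγ) (hs hγ') (hf hγ') h2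
        (by rw [hts]) (hfreq.mono fun q hq => ⟨hq.1, by rw [hq.2], by rw [hq.2]⟩) hV
      filter_upwards [this] with c hc
      obtain ⟨u, hu, e1, e2⟩ := hc
      exact ⟨u, hu, Prod.ext e2 e1⟩
  · have := eventually_exists_eq_of_deriv_ne_zero (hf hγ) (hs hγ) (hf hγ') (hs hγ') h1
      (by rw [hts]) (hfreq.mono fun q hq => ⟨hq.1, by rw [hq.2], by rw [hq.2]⟩) hV
    filter_upwards [this] with c hc
    obtain ⟨u, hu, e1, e2⟩ := hc
    exact ⟨u, hu, Prod.ext e1 e2⟩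

end Curves

/-! ### Quantitative dependence on the data -/

section Dependence

lemma exists_lipschitz_profileField (s lam : ℝ) {a : ℝ} (ha : a ≠ 0) (b c R : ℝ) :
    ∃ K : NNReal, LipschitzOnWith K (fun w : ℝ × ℝ × ℝ => profileField s lam a w.1 w.2)
      (Icc b c ×ˢ Metric.closedBall (0 : ℝ × ℝ) R) :=
  ((contDiff_profileField (n := 1) s lam ha).contDiffOn
    (s := Icc b c ×ˢ Metric.closedBall (0 : ℝ × ℝ) R)).exists_lipschitzOnWith (by simp)
    ((convex_Icc b c).prod (convex_closedBall 0 R)) (isCompact_Icc.prod (isCompact_closedBall _ _))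

/-- Two bounded solutions that are close at the end of an interval are close at its beginning. -/
lemma exists_norm_sub_le_mul_norm_sub (s lam : ℝ) {a : ℝ} (ha : a ≠ 0) {b c : ℝ} (hbc : b ≤ c)
    (R : ℝ) : ∃ K > 0, ∀ f g : ℝ → ℝ × ℝ,
      (∀ x ∈ Icc b c, HasDerivWithinAt f (profileField s lam a x (f x)) (Icc b c) x) →
      (∀ x ∈ Icc b c, HasDerivWithinAt g (profileField s lam a x (g x)) (Icc b c) x) →
      (∀ x ∈ Icc b c, ‖f x‖ ≤ R) → (∀ x ∈ Icc b c, ‖g x‖ ≤ R) →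
      ‖f b - g b‖ ≤ K * ‖f c - g c‖ := by
  obtain ⟨L, hL⟩ := exists_lipschitz_profileField s lam ha b c R
  refine ⟨Real.exp (L * (c - b)), Real.exp_pos _, fun f g hf hg hfR hgR => ?_⟩
  have hm : ∀ {t}, t ∈ Icc (-c) (-b) → -t ∈ Icc b c := fun ht => ⟨by linarith [ht.2], by
    linarith [ht.1]⟩
  have hmaps : MapsTo (fun t : ℝ => -t) (Icc (-c) (-b)) (Icc b c) := fun t ht => hm ht
  have hrev : ∀ f : ℝ → ℝ × ℝ,
      (∀ x ∈ Icc b c, HasDerivWithinAt f (profileField s lam a x (f x)) (Icc b c) x) →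
      ∀ t ∈ Icc (-c) (-b), HasDerivWithinAt (fun t => f (-t))
        (-profileField s lam a (-t) (f (-t))) (Icc (-c) (-b)) t := fun f hf t ht => by
    have := (hf (-t) (hm ht)).scomp t ((hasDerivAt_neg t).hasDerivWithinAt) hmaps
    rw [neg_one_smul] at this
    exact this
  have hci : ∀ {F : ℝ → ℝ × ℝ} {v : ℝ × ℝ} {t}, t ∈ Ico (-c) (-b) →
      HasDerivWithinAt F v (Icc (-c) (-b)) t → HasDerivWithinAt F v (Ici t) t := fun ht h =>
    h.mono_of_mem_nhdsWithin (Icc_mem_nhdsGE_of_mem ht)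
  have key := dist_le_of_trajectories_ODE_of_mem (K := L)
    (v := fun t z => -profileField s lam a (-t) z)
    (s := fun _ => Metric.closedBall (0 : ℝ × ℝ) R) (a := -c) (b := -b) (f := fun t => f (-t))
    (g := fun t => g (-t)) (δ := ‖f c - g c‖)
    (fun t ht u hu v hv => by
      have := hL (show (-t, u) ∈ _ from ⟨hm (Ico_subset_Icc_self ht), hu⟩)
        (show (-t, v) ∈ _ from ⟨hm (Ico_subset_Icc_self ht), hv⟩)
      simpa [Prod.edist_eq, edist_neg_neg] using this)
    (fun t ht => (hrev f hf t ht).continuousWithinAt)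
    (fun t ht => hci ht (hrev f hf t (Ico_subset_Icc_self ht)))
    (fun t ht => mem_closedBall_zero_iff.2 (hfR _ (hm (Ico_subset_Icc_self ht))))
    (fun t ht => (hrev g hg t ht).continuousWithinAt)
    (fun t ht => hci ht (hrev g hg t (Ico_subset_Icc_self ht)))
    (fun t ht => mem_closedBall_zero_iff.2 (hgR _ (hm (Ico_subset_Icc_self ht))))
    (by simp [dist_eq_norm]) (-b) ⟨by linarith, le_rfl⟩
  simp only [neg_neg, dist_eq_norm] at key
  rw [mul_comm, show c - b = -b - -c by ring]
  exact key

/-- Bounded solutions satisfy Taylor's formula with a uniform remainder. -/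
lemma exists_quadratic_remainder (s lam : ℝ) {a : ℝ} (ha : a ≠ 0) (b c R : ℝ) :
    ∃ K, ∀ z : ℝ → ℝ × ℝ, (∀ x, HasDerivAt z (profileField s lam a x (z x)) x) →
      (∀ x, ‖z x‖ ≤ R) → ∀ x ∈ Icc b c, ∀ x' ∈ Icc b c,
        ‖z x' - z x - (x' - x) • profileField s lam a x (z x)‖ ≤ K * (x' - x) ^ 2 := by
  obtain ⟨L, hL⟩ := exists_lipschitz_profileField s lam ha b c R
  obtain ⟨B, hB⟩ := (isCompact_Icc.prod (isCompact_closedBall (0 : ℝ × ℝ)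
      R)).exists_bound_of_continuousOn
    (f := fun w : ℝ × ℝ × ℝ => profileField s lam a w.1 w.2) (s := Icc b c ×ˢ _)
    (contDiff_profileField (n := 0) s lam ha).continuous.continuousOn
  refine ⟨L * (1 + max B 0), fun z hz hzR x hx x' hx' => ?_⟩
  have hsub : uIcc x x' ⊆ Icc b c := uIcc_subset_Icc hx hx'
  have hmem : ∀ t ∈ uIcc x x', (t, z t) ∈ Icc b c ×ˢ Metric.closedBall (0 : ℝ × ℝ) R :=
    fun t ht => ⟨hsub ht, mem_closedBall_zero_iff.2 (hzR t)⟩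
  have hz1 : ∀ t ∈ uIcc x x', ‖z t - z x‖ ≤ max B 0 * ‖t - x‖ := fun t ht =>
    (convex_uIcc x x').norm_image_sub_le_of_norm_hasDerivWithin_le
      (fun u _ => (hz u).hasDerivWithinAt)
      (fun u hu => (hB _ (hmem u hu)).trans (le_max_left _ _)) left_mem_uIcc ht
  have h2 := (convex_uIcc x x').norm_image_sub_le_of_norm_hasDerivWithin_le
    (f := fun t => z t - t • profileField s lam a x (z x))
    (f' := fun t => profileField s lam a t (z t) - (1 : ℝ) • profileField s lam a x (z x))
    (C := L * (1 + max B 0) * |x' - x|)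
    (fun t _ => ((hz t).sub ((hasDerivAt_id t).smul_const _)).hasDerivWithinAt)
    (fun t ht => by
      have h3 := hL.norm_sub_le (hmem t ht) (hmem x left_mem_uIcc)
      rw [one_smul]
      refine h3.trans ?_
      rw [mul_assoc]
      refine mul_le_mul_of_nonneg_left ?_ L.2
      have h4 : |t - x| ≤ |x' - x| := abs_sub_left_of_mem_uIcc ht
      have h5 := hz1 t ht
      rw [Real.norm_eq_abs] at h5
      have h6 : max B 0 * |t - x| ≤ max B 0 * |x' - x| :=
        mul_le_mul_of_nonneg_left h4 (le_max_right _ _)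
      have h7 : 0 ≤ max B 0 * |x' - x| := mul_nonneg (le_max_right _ _) (abs_nonneg _)
      rw [Prod.mk_sub_mk, Prod.norm_mk, Real.norm_eq_abs]
      exact max_le (by linarith) (by linarith [abs_nonneg (x' - x)]))
    left_mem_uIcc right_mem_uIcc
  rw [Real.norm_eq_abs, mul_assoc, abs_mul_abs_self, ← sq] at h2
  rw [sub_smul]
  refine le_of_eq_of_le ?_ h2
  congr 1
  module

lemma hasDerivAt_of_quadratic_remainder {E : Type*} [NormedAddCommGroup E] [NormedSpace ℝ E]
    {z : ℝ → E} {v : E} {x K : ℝ}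
    (h : ∀ᶠ x' in 𝓝 x, ‖z x' - z x - (x' - x) • v‖ ≤ K * (x' - x) ^ 2) : HasDerivAt z v x := by
  rw [hasDerivAt_iff_isLittleO]
  refine (Asymptotics.IsBigO.of_bound K ?_).trans_isLittleO
    (Asymptotics.isLittleO_pow_sub_sub x one_lt_two)
  filter_upwards [h] with x' hx'
  rwa [norm_pow, norm_norm, Real.norm_eq_abs, sq_abs]

end Dependence

/-! ### Families of solutions near a connection -/

section Families

/-- `y` is asymptotic to `c exp (d x)` at `-∞`. -/
def HasLeadingCoeff (d : ℕ) (y : ℝ → ℝ) (c : ℝ) : Prop :=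
  Tendsto (fun x => Real.exp (-(d * x)) * y x) atBot (𝓝 c)

lemma HasLeadingCoeff.of_abs_sub_le {d : ℕ} {y : ℝ → ℝ} {c K X : ℝ}
    (h : ∀ x ≤ X, |y x - c * Real.exp (d * x)| ≤ K * Real.exp ((d + 5 / 4) * x)) :
    HasLeadingCoeff d y c := by
  have hlim : Tendsto (fun x => K * Real.exp (5 / 4 * x)) atBot (𝓝 0) := by
    have h1 : Tendsto (fun x : ℝ => 5 / 4 * x) atBot atBot :=
      tendsto_id.const_mul_atBot (by norm_num)
    simpa using (Real.tendsto_exp_atBot.comp h1).const_mul K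
  rw [HasLeadingCoeff, tendsto_iff_norm_sub_tendsto_zero]
  refine squeeze_zero' (Eventually.of_forall fun _ => norm_nonneg _) ?_ hlim
  filter_upwards [eventually_le_atBot X] with x hx
  have h1 : Real.exp (-(d * x)) * Real.exp (d * x) = 1 := by rw [← Real.exp_add]; simp
  have h2 : Real.exp (-(d * x)) * y x - c
      = Real.exp (-(d * x)) * (y x - c * Real.exp (d * x)) := by linear_combination c * h1
  rw [Real.norm_eq_abs, h2, abs_mul, abs_of_pos (Real.exp_pos _)]
  calc _ ≤ Real.exp (-(d * x)) * (K * Real.exp ((d + 5 / 4) * x)) := by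
        gcongr
        exact h x hx
    _ = K * (Real.exp (-(d * x)) * Real.exp ((d + 5 / 4) * x)) := by ring
    _ = _ := by rw [← Real.exp_add]; ring_nf

/-- The parameters of a connection problem for which compactness holds. -/
structure IsAdmissible (n d : ℕ) (a : ℝ) : Prop where
  one_le_dim : 1 ≤ n
  one_le_degree : 1 ≤ d
  pos : 0 < a
  large : 4 * ((d : ℝ) * (d + n)) ≤ a ^ 2 * (n : ℝ) ^ 2

namespace IsAdmissible

variable {n d : ℕ} {a : ℝ}

/-- The solution of the Volterra equation that belongs to a connection. -/
lemma exists_isPoleSolution (H : IsAdmissible n d a) {l : ℤ} {y p : ℝ → ℝ}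
    (h : IsConnection n (d * (d + n)) a l y p) {c : ℝ} (hc : HasLeadingCoeff d y c) :
    IsPoleSolution n d a c (poleCurve d c y p) := by
  obtain ⟨X, -, K, hK⟩ := exists_uniform_asymptotics H.one_le_dim H.one_le_degree H.pos H.large
  obtain ⟨h1, c', h2⟩ := hK l y p h
  obtain rfl : c' = c := tendsto_nhds_unique (HasLeadingCoeff.of_abs_sub_le h2) hc
  exact isPoleSolution_poleCurve H.one_le_degree H.pos.ne' h.toIsTrajectory h1 h2

/-- A connection is determined by its leading coefficient at the pole. -/
lemma eq_of_hasLeadingCoeff (H : IsAdmissible n d a) {l l' : ℤ} {y p y' p' : ℝ → ℝ}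
    (h : IsConnection n (d * (d + n)) a l y p) (h' : IsConnection n (d * (d + n)) a l' y' p')
        {c : ℝ}
    (hc : HasLeadingCoeff d y c) (hc' : HasLeadingCoeff d y' c) : y = y' := by
  have h1 := (H.exists_isPoleSolution h hc).poleLift_eq H.one_le_degree H.pos.ne'
    (fun t _ => conjPair_poleCurve d c y p t) (H.exists_isPoleSolution h' hc')
    (fun t _ => conjPair_poleCurve d c y' p' t) (x := 0) le_rfl
  rw [poleLift_poleCurve, poleLift_poleCurve, Prod.mk.injEq] at h1
  exact h.toIsTrajectory.eq_of_eq_at H.pos.ne' h'.toIsTrajectory h1.1 h1.2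

/-- Near a connection the solutions that tend to `0` at the pole form an analytic one-parameter
family; the parameter is the leading coefficient. -/
theorem exists_analytic_family (H : IsAdmissible n d a) {l : ℤ} {y p : ℝ → ℝ}
    (h : IsConnection n (d * (d + n)) a l y p) {c : ℝ} (hc : HasLeadingCoeff d y c) :
    ∃ δ > 0, ∃ κ > 0, ∃ w : ℝ → ℝ → ℝ × ℝ,
      (∀ t ∈ Metric.ball c δ, ∀ x ≤ 0,
        HasDerivWithinAt (w t) (profileField n (d * (d + n)) a x (w t x)) (Iic 0) x) ∧
      (∀ t ∈ Metric.ball c δ, Tendsto (fun x => (w t x).1) atBot (𝓝 0)) ∧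
      (∀ t ∈ Metric.ball c δ, HasLeadingCoeff d (fun x => (w t x).1) t) ∧
      (∀ t ∈ Metric.ball c δ, AnalyticAt ℝ (fun t => w t 0) t) ∧
      (∀ t ∈ Metric.ball c δ, ∀ t' ∈ Metric.ball c δ, κ * |t - t'| ≤ ‖w t 0 - w t' 0‖) ∧
      ∀ t ∈ Metric.ball c δ, ∀ (l' : ℤ) (y' p' : ℝ → ℝ),
        IsConnection n (d * (d + n)) a l' y' p' → HasLeadingCoeff d y' t → w t 0 =
            (y' 0, p' 0) := by
  have ha := H.pos.ne'
  obtain ⟨δ, hδ, C, Y, hY, hYd, hYl, hYb, hYr⟩ := (H.exists_isPoleSolution h hc).exists_family ha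
    fun t _ => conjPair_poleCurve d c y p t
  have hball : ∀ t ∈ Metric.ball c δ, (t : ℂ) ∈ Metric.ball (c : ℂ) δ := fun t ht => by
    rw [Metric.mem_ball, dist_eq_norm, ← Complex.ofReal_sub, Complex.norm_real, ← dist_eq_norm]
    exact ht
  have hYr' : ∀ t ∈ Metric.ball c δ, ∀ r ∈ Icc (0 : ℝ) 1, conjPair (Y t r) = Y t r :=
    fun t ht => hYr t (hball t ht)
  have hC0 : 0 ≤ C := (norm_nonneg _).trans
    (hYb c (hball c (Metric.mem_ball_self hδ)) 0 (by simp))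
  have hexp0 : ∀ x ≤ (0 : ℝ), Real.exp x ∈ Icc (0 : ℝ) 1 := fun x hx =>
    ⟨(Real.exp_pos x).le, Real.exp_le_one_iff.2 hx⟩
  have hderiv : ∀ t ∈ Metric.ball c δ, ∀ x ≤ 0, HasDerivWithinAt (poleLift d (Y t))
      (profileField n (d * (d + n)) a x (poleLift d (Y t) x)) (Iic 0) x := fun t ht x hx =>
    (hY t (hball t ht)).hasDerivWithinAt_poleLift H.one_le_degree ha (hYr' t ht) hx
  -- at a point `x₁` near the pole the value of `y` is a bi-Lipschitz function of the parameter
  set r₁ := 1 / (2 * (C + 1)) with hr₁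
  have hr₁0 : 0 < r₁ := by positivity
  have hr₁1 : r₁ ≤ 1 := by
    rw [hr₁, div_le_one (by positivity)]
    linarith
  set x₁ := Real.log r₁ with hx₁
  have hx₁0 : x₁ ≤ 0 := Real.log_nonpos hr₁0.le hr₁1
  have hexp₁ : Real.exp x₁ = r₁ := Real.exp_log hr₁0
  have hlow : ∀ t ∈ Metric.ball c δ, ∀ t' ∈ Metric.ball c δ,
      r₁ ^ d / 2 * |t - t'| ≤ ‖poleLift d (Y t) x₁ - poleLift d (Y t') x₁‖ := by
    intro t ht t' ht'
    have hI : r₁ ∈ Icc (0 : ℝ) 1 := ⟨hr₁0.le, hr₁1⟩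
    set D : ℝ → ℝ := fun r => (Y t r).1.re - (Y t' r).1.re with hD
    have hdist : |t - t'| = ‖(t : ℂ) - t'‖ := by
      rw [← Complex.ofReal_sub, Complex.norm_real, Real.norm_eq_abs]
    have hDcont : ContinuousOn D (Icc 0 1) :=
      (Complex.continuous_re.comp_continuousOn (hY t (hball t ht)).continuousOn.fst).sub
        (Complex.continuous_re.comp_continuousOn (hY t' (hball t' ht')).continuousOn.fst)
    have hDd : ∀ r ∈ Ioo (0 : ℝ) 1, HasDerivAt D ((Y t r).2.re - (Y t' r).2.re) r := fun r hr => by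
      have e : ∀ s ∈ Metric.ball c δ, HasDerivAt (fun r => (Y s r).1.re) (Y s r).2.re r :=
        fun s hs => by
          have e1 := ((hY s (hball s hs)).hasDerivWithinAt ha (hYr' s hs)
            (Ioo_subset_Ioc_self hr)).hasDerivAt (Icc_mem_nhds hr.1 hr.2)
          exact (Complex.reCLM.comp (ContinuousLinearMap.fst ℝ ℂ ℂ)).hasFDerivAt.comp_hasDerivAt r
              e1
      exact (e t ht).sub (e t' ht')
    -- `D` starts at `t - t'` and its derivative is at most `C |t - t'|`
    obtain ⟨q, hq, hslope⟩ := exists_hasDerivAt_eq_slope D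
      (fun r => (Y t r).2.re - (Y t' r).2.re) hr₁0 (hDcont.mono (Icc_subset_Icc_right hr₁1))
      fun r hr => hDd r ⟨hr.1, hr.2.trans_le hr₁1⟩
    have hq1 : q ∈ Icc (0 : ℝ) 1 := ⟨hq.1.le, hq.2.le.trans hr₁1⟩
    have hDb : |(Y t q).2.re - (Y t' q).2.re| ≤ C * |t - t'| := by
      rw [← Complex.sub_re, hdist]
      exact (Complex.abs_re_le_norm _).trans ((norm_snd_le (Y t q - Y t' q)).trans
        (hYl t (hball t ht) t' (hball t' ht') q hq1))
    have hD0 : D 0 = t - t' := by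
      simp only [hD]
      rw [(hY t (hball t ht)).apply_zero, (hY t' (hball t' ht')).apply_zero]
      simp
    rw [sub_zero, hD0, eq_div_iff hr₁0.ne'] at hslope
    have h1 : |t - t'| / 2 ≤ |D r₁| := by
      have h2 : |t - t'| ≤ |D r₁| + |((Y t q).2.re - (Y t' q).2.re) * r₁| := by
        rw [hslope]
        have := abs_sub (D r₁) (D r₁ - (t - t'))
        rwa [sub_sub_cancel] at this
      rw [abs_mul, abs_of_pos hr₁0] at h2
      have h3 : |(Y t q).2.re - (Y t' q).2.re| * r₁ ≤ C * |t - t'| * r₁ := by gcongr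
      have h4 : C * r₁ ≤ 1 / 2 := by
        rw [hr₁, mul_one_div, div_le_div_iff₀ (by positivity) two_pos]
        linarith
      have h5 := mul_le_mul_of_nonneg_right h4 (abs_nonneg (t - t'))
      linarith
    refine le_trans ?_ (norm_fst_le _)
    simp only [poleLift, hexp₁, Prod.fst_sub]
    rw [← mul_sub, Real.norm_eq_abs, abs_mul, abs_of_pos (pow_pos hr₁0 d)]
    have h6 := mul_le_mul_of_nonneg_left h1 (pow_pos hr₁0 d).le
    linarith
  have hbound : ∀ t ∈ Metric.ball c δ, ∀ x ≤ 0, ‖poleLift d (Y t) x‖ ≤ (d + 1) * C := by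
    intro t ht x hx
    have hr := hexp0 x hx
    have hpw : Real.exp x ^ d ≤ 1 := pow_le_one₀ hr.1 hr.2
    have hpw0 : 0 ≤ Real.exp x ^ d := pow_nonneg hr.1 d
    have h0 := hYb t (hball t ht) _ hr
    have h1 : |(Y t (Real.exp x)).1.re| ≤ C :=
      (Complex.abs_re_le_norm _).trans ((norm_fst_le _).trans h0)
    have h2 : |(Y t (Real.exp x)).2.re| ≤ C :=
      (Complex.abs_re_le_norm _).trans ((norm_snd_le _).trans h0)
    have hd0 : (0 : ℝ) ≤ d := Nat.cast_nonneg d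
    rw [poleLift, Prod.norm_mk, Real.norm_eq_abs, Real.norm_eq_abs, abs_mul, abs_mul,
      abs_of_nonneg hpw0]
    refine max_le ?_ ?_
    · calc _ ≤ 1 * C := by gcongr
        _ ≤ (d + 1) * C := by gcongr; linarith
    · have h3 : |d * (Y t (Real.exp x)).1.re + Real.exp x * (Y t (Real.exp x)).2.re|
          ≤ d * C + 1 * C := by
        refine (abs_add_le _ _).trans ?_
        rw [abs_mul, abs_mul, Nat.abs_cast, abs_of_nonneg hr.1]
        gcongr
        exact hr.2
      calc _ ≤ 1 * (d * C + 1 * C) := by gcongr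
        _ = (d + 1) * C := by ring
  -- by Gronwall's inequality the lower bound at `x₁` persists up to the equator
  obtain ⟨K, hK, hgron⟩ := exists_norm_sub_le_mul_norm_sub (n : ℝ) (d * (d + n)) ha hx₁0
      ((d + 1) * C)
  have hsub : Icc x₁ 0 ⊆ Iic (0 : ℝ) := fun x hx => hx.2
  refine ⟨δ, hδ, r₁ ^ d / 2 / K, by positivity, fun t => poleLift d (Y t), hderiv,
    fun t ht => (hY t (hball t ht)).tendsto_poleLift_fst_zero H.one_le_degree,
    fun t ht => ?_, fun t ht => ?_, fun t ht t' ht' => ?_, fun t ht l' y' p' h' hc' => ?_⟩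
  · have := (hY t (hball t ht)).tendsto_poleLift_fst
    rwa [Complex.ofReal_re] at this
  · have h1 : AnalyticAt ℂ (fun η => Y η 1) (t : ℂ) :=
      (hYd 1 (by simp)).analyticAt (Metric.isOpen_ball.mem_nhds (hball t ht))
    have h2 : AnalyticAt ℝ (fun t : ℝ => Y t 1) t :=
      AnalyticAt.comp (g := fun η : ℂ => Y η 1) h1.restrictScalars (Complex.ofRealCLM.analyticAt t)
    have h3 : AnalyticAt ℝ (fun t : ℝ => (Y t 1).1.re) t :=
      ((Complex.reCLM.comp (ContinuousLinearMap.fst ℝ ℂ ℂ)).analyticAt _).comp h2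
    have h4 : AnalyticAt ℝ (fun t : ℝ => (Y t 1).2.re) t :=
      ((Complex.reCLM.comp (ContinuousLinearMap.snd ℝ ℂ ℂ)).analyticAt _).comp h2
    simp only [poleLift, Real.exp_zero, one_pow, one_mul]
    exact h3.prod ((analyticAt_const.mul h3).add h4)
  · have h1 := hgron (poleLift d (Y t)) (poleLift d (Y t'))
      (fun x hx => (hderiv t ht x hx.2).mono hsub) (fun x hx => (hderiv t' ht' x hx.2).mono hsub)
      (fun x hx => hbound t ht x hx.2) (fun x hx => hbound t' ht' x hx.2)
    have h2 := (hlow t ht t' ht').trans h1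
    rw [div_mul_eq_mul_div, div_le_iff₀ hK]
    linarith
  · have h1 := (hY t (hball t ht)).poleLift_eq H.one_le_degree ha (hYr' t ht)
      (H.exists_isPoleSolution h' hc') (fun r _ => conjPair_poleCurve d t y' p' r) (x := 0) le_rfl
    rwa [poleLift_poleCurve] at h1

end IsAdmissible

end Families

/-! ### Finiteness of the set of connections -/

section Finiteness

/-- The pairs of leading coefficients, at the two poles, of the solutions from `0` to `l π`. -/
def leadingPairs (n d : ℕ) (a : ℝ) (l : ℤ) : Set (ℝ × ℝ) :=
  {q | ∃ y p, IsConnection n (d * (d + n)) a l y p ∧ HasLeadingCoeff d y q.1 ∧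
    HasLeadingCoeff d (fun x => y (-x) - l * Real.pi) q.2}

namespace IsConnection

variable {s lam a : ℝ} {l : ℤ} {y p : ℝ → ℝ}

lemma norm_le (ha : a ≠ 0) (hs : 0 ≤ s) (hlam : 0 ≤ lam) (h : IsConnection s lam a l y p) (x : ℝ) :
    ‖(y x, p x)‖ ≤ Real.pi + ((a ^ 2 + 1) / min (a ^ 2) 1 * lam + 1) := by
  have hmin : 0 < min (a ^ 2) 1 := lt_min (by positivity) one_pos
  have hB : 0 ≤ (a ^ 2 + 1) / min (a ^ 2) 1 * lam := by positivity
  have hpi := Real.pi_pos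
  have hy : |y x| ≤ Real.pi := by
    rcases h.trichotomy ha hs hlam with h0 | h0 | h0
    · simp [h0, hpi.le]
    · rw [abs_of_pos (h0 x).1]
      exact (h0 x).2.le
    · rw [← abs_neg, abs_of_pos (h0 x).1]
      exact (h0 x).2.le
  have hp : |p x| ≤ (a ^ 2 + 1) / min (a ^ 2) 1 * lam + 1 := by
    have h1 := h.vel_sq_le ha hs hlam x
    have h2 := mul_le_mul_of_nonneg_left (Real.sin_sq_le_one (y x)) hB
    refine abs_le_of_sq_le_sq ?_ (by linarith)
    nlinarith
  rw [Prod.norm_mk, Real.norm_eq_abs, Real.norm_eq_abs]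
  exact max_le (by linarith) (by linarith)

end IsConnection

/-- Solutions on the two half-lines that match at the equator form a solution on the line. -/
lemma isConnection_of_halves {s lam a : ℝ} {l : ℤ} {w w' : ℝ → ℝ × ℝ}
    (hw : ∀ x ≤ 0, HasDerivWithinAt w (profileField s lam a x (w x)) (Iic 0) x)
    (hw' : ∀ x ≤ 0, HasDerivWithinAt w' (profileField s lam a x (w' x)) (Iic 0) x)
    (hlim : Tendsto (fun x => (w x).1) atBot (𝓝 0))
    (hlim' : Tendsto (fun x => (w' x).1) atBot (𝓝 0))
    (hmatch : w 0 = ((w' 0).1 + l * Real.pi, -(w' 0).2)) :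
    ∃ y p, IsConnection s lam a l y p ∧ ∀ x ≤ 0, y x = (w x).1 := by
  set v : ℝ → ℝ × ℝ := fun x => ((w' (-x)).1 + l * Real.pi, -(w' (-x)).2) with hv
  set z : ℝ → ℝ × ℝ := fun x => if x ≤ 0 then w x else v x with hz
  have hzl : ∀ x ≤ 0, z x = w x := fun x hx => if_pos hx
  have hzr : ∀ x, 0 ≤ x → z x = v x := fun x hx => by
    rcases hx.eq_or_lt with rfl | hx
    · simp only [hz, hv, le_refl, if_true, neg_zero, hmatch]
    · exact if_neg (not_le.2 hx)
  have hvd : ∀ x, 0 ≤ x → HasDerivWithinAt v (profileField s lam a x (v x)) (Ici 0) x :=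
    fun x hx => by
      have hmaps : MapsTo (fun x : ℝ => -x) (Ici 0) (Iic 0) := fun x hx =>
        mem_Iic.2 (neg_nonpos.2 (mem_Ici.1 hx))
      have h1 := (hw' (-x) (neg_nonpos.2 hx)).scomp x (hasDerivAt_neg x).hasDerivWithinAt hmaps
      have hfst : HasDerivWithinAt (fun x => (w' (-x)).1) _ (Ici 0) x :=
        (ContinuousLinearMap.fst ℝ ℝ ℝ).hasFDerivAt.comp_hasDerivWithinAt x h1
      have hsnd : HasDerivWithinAt (fun x => (w' (-x)).2) _ (Ici 0) x :=
        (ContinuousLinearMap.snd ℝ ℝ ℝ).hasFDerivAt.comp_hasDerivWithinAt x h1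
      refine ((hfst.add_const (l * Real.pi)).prodMk hsnd.neg).congr_deriv ?_
      have h2 := profileAccel_reflect s lam a x ((w' (-x)).1 + l * Real.pi) (-(w' (-x)).2) l
      rw [add_sub_cancel_right, neg_neg] at h2
      simp [profileField, hv, h2]
  have hzd : ∀ x, HasDerivAt z (profileField s lam a x (z x)) x := by
    intro x
    have hl : x ≤ 0 → HasDerivWithinAt z (profileField s lam a x (z x)) (Iic 0) x := fun hx => by
      rw [hzl x hx]
      exact (hw x hx).congr hzl (hzl x hx)
    have hr : 0 ≤ x → HasDerivWithinAt z (profileField s lam a x (z x)) (Ici 0) x := fun hx => by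
      rw [hzr x hx]
      exact (hvd x hx).congr hzr (hzr x hx)
    rcases lt_trichotomy x 0 with hx | rfl | hx
    · exact (hl hx.le).hasDerivAt (Iic_mem_nhds hx)
    · have := (hl le_rfl).union (hr le_rfl)
      rwa [Iic_union_Ici, hasDerivWithinAt_univ] at this
    · exact (hr hx.le).hasDerivAt (Ici_mem_nhds hx)
  refine ⟨fun x => (z x).1, fun x => (z x).2,
    { IsTrajectory.of_hasDerivAt_prod hzd with
      tendsto_atBot := hlim.congr' ?_
      tendsto_atTop := ?_ }, fun x hx => congrArg Prod.fst (hzl x hx)⟩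
  · filter_upwards [eventually_le_atBot 0] with x hx
    rw [hzl x hx]
  · have h1 := (hlim'.comp tendsto_neg_atTop_atBot).add_const (l * Real.pi)
    rw [zero_add] at h1
    refine h1.congr' ?_
    filter_upwards [eventually_ge_atTop 0] with x hx
    rw [hzr x hx, Function.comp_apply]

namespace IsAdmissible

variable {n d : ℕ} {a : ℝ}

/-- The uniform asymptotics at both poles make the space of connections compact for pointwise
convergence. -/
theorem isCompact_leadingPairs (H : IsAdmissible n d a) (l : ℤ) :
    IsCompact (leadingPairs n d a l) := by
  have ha := H.pos.ne'
  have hs : (0 : ℝ) ≤ n := Nat.cast_nonneg n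
  have hlam : (0 : ℝ) ≤ d * (d + n) := by positivity
  obtain ⟨X, hX, K, hK⟩ := exists_uniform_asymptotics H.one_le_dim H.one_le_degree H.pos H.large
  set lam : ℝ := d * (d + n) with hlamdef
  set R := Real.pi + ((a ^ 2 + 1) / min (a ^ 2) 1 * lam + 1) with hR
  have hasym : ∀ {l y p c}, IsConnection n lam a l y p → HasLeadingCoeff d y c →
      ∀ x ≤ X, |y x - c * Real.exp (d * x)| ≤ K * Real.exp ((d + 5 / 4) * x) := fun h hc => by
    obtain ⟨-, c', h2⟩ := hK _ _ _ h
    obtain rfl := tendsto_nhds_unique (HasLeadingCoeff.of_abs_sub_le h2) hc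
    exact h2
  -- being a solution is a closed condition for pointwise convergence when it is expressed by
  -- Taylor's
  -- formula with a uniform remainder
  choose Q hQ using fun N : ℕ => exists_quadratic_remainder (n : ℝ) lam ha (-N) N R
  set C := (R + K * Real.exp ((d + 5 / 4) * X)) / Real.exp (d * X) with hC
  have hcb : ∀ {l y p c}, IsConnection n lam a l y p → HasLeadingCoeff d y c → |c| ≤ C := by
    intro l y p c h hc
    have h1 := hasym h hc X le_rfl
    have h2 : |y X| ≤ R := (norm_fst_le (y X, p X)).trans (h.norm_le ha hs hlam X)
    have h4 : |c| * Real.exp (d * X) = |c * Real.exp (d * X)| := by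
      rw [abs_mul, abs_of_pos (Real.exp_pos _)]
    rw [hC, le_div_iff₀ (Real.exp_pos _), h4]
    have h3 := abs_sub (y X) (y X - c * Real.exp (d * X))
    rw [sub_sub_cancel] at h3
    linarith
  -- the closed conditions on a curve and its two leading coefficients; with the uniform bounds they
  -- define a compact set, by Tychonoff's theorem
  set S : Set ((ℝ → ℝ × ℝ) × ℝ × ℝ) :=
    (⋂ (N : ℕ) (x ∈ Icc (-N : ℝ) N) (x' ∈ Icc (-N : ℝ) N),
      {q | ‖q.1 x' - q.1 x - (x' - x) • profileField n lam a x (q.1 x)‖ ≤ Q N * (x' - x) ^ 2}) ∩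
    ((⋂ (x) (_ : x ≤ X),
      {q | |(q.1 x).1 - q.2.1 * Real.exp (d * x)| ≤ K * Real.exp ((d + 5 / 4) * x)}) ∩
    ⋂ (x) (_ : x ≤ X), {q | |(q.1 (-x)).1 - l * Real.pi - q.2.2 * Real.exp (d * x)|
      ≤ K * Real.exp ((d + 5 / 4) * x)}) with hS
  have hF : ∀ x, Continuous (profileField n lam a x) := fun x =>
    (contDiff_profileField (n := 0) (n : ℝ) lam ha).continuous.comp
      (continuous_const.prodMk continuous_id)
  have hScl : IsClosed S := by
    have he : ∀ x : ℝ, Continuous fun q : (ℝ → ℝ × ℝ) × ℝ × ℝ => q.1 x := fun x =>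
      (continuous_apply x).comp continuous_fst
    refine IsClosed.inter ?_ (IsClosed.inter ?_ ?_)
    · refine isClosed_iInter fun N => isClosed_iInter fun x => isClosed_iInter fun _ =>
        isClosed_iInter fun x' => isClosed_iInter fun _ => isClosed_le ?_ continuous_const
      exact (((he x').sub (he x)).sub (((hF x).comp (he x)).const_smul (x' - x))).norm
    · refine isClosed_iInter fun x => isClosed_iInter fun _ => isClosed_le ?_ continuous_const
      exact ((he x).fst.sub (continuous_snd.fst.mul continuous_const)).abs
    · refine isClosed_iInter fun x => isClosed_iInter fun _ => isClosed_le ?_ continuous_const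
      exact (((he (-x)).fst.sub continuous_const).sub (continuous_snd.snd.mul continuous_const)).abs
  have hcomp : IsCompact (((univ.pi fun _ : ℝ => Metric.closedBall (0 : ℝ × ℝ) R) ×ˢ
      Metric.closedBall (0 : ℝ × ℝ) C) ∩ S) :=
    ((isCompact_univ_pi fun _ => isCompact_closedBall 0 R).prod
      (isCompact_closedBall 0 C)).inter_right hScl
  have himage : leadingPairs n d a l = Prod.snd '' (((univ.pi fun _ : ℝ =>
      Metric.closedBall (0 : ℝ × ℝ) R) ×ˢ Metric.closedBall (0 : ℝ × ℝ) C) ∩ S) := by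
    ext ⟨c, c'⟩
    constructor
    · rintro ⟨y, p, h, hc, hc'⟩
      refine ⟨(fun x => (y x, p x), (c, c')), ⟨⟨fun x _ => ?_, ?_⟩, ?_, ?_, ?_⟩, rfl⟩
      · exact mem_closedBall_zero_iff.2 (h.norm_le ha hs hlam x)
      · rw [mem_closedBall_zero_iff, Prod.norm_mk]
        exact max_le (hcb h hc) (hcb h.reflect hc')
      · simp only [mem_iInter]
        exact fun N x hx x' hx' => hQ N (fun x => (y x, p x)) h.hasDerivAt_prod
          (h.norm_le ha hs hlam) x hx x' hx'
      · simp only [mem_iInter]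
        exact fun x hx => hasym h hc x hx
      · simp only [mem_iInter]
        exact fun x hx => hasym h.reflect hc' x hx
    · rintro ⟨⟨z, q⟩, ⟨-, h1, h2, h3⟩, hq⟩
      simp only at hq
      subst hq
      simp only [mem_iInter] at h1 h2 h3
      have hd : ∀ x, HasDerivAt z (profileField n lam a x (z x)) x := fun x => by
        obtain ⟨N, hN⟩ := exists_nat_gt |x|
        have hx := abs_lt.1 hN
        refine hasDerivAt_of_quadratic_remainder (K := Q N) ?_
        filter_upwards [Icc_mem_nhds hx.1 hx.2] with x' hx'
        exact h1 N x ⟨hx.1.le, hx.2.le⟩ x' hx'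
      have hlim : ∀ {f : ℝ → ℝ} {c : ℝ}, HasLeadingCoeff d f c → Tendsto f atBot (𝓝 0) := by
        intro f c hf
        have hd0 : (0 : ℝ) < d := by exact_mod_cast H.one_le_degree
        have e1 : Tendsto (fun x : ℝ => (d : ℝ) * x) atBot atBot :=
          tendsto_id.const_mul_atBot hd0
        have e2 := (Real.tendsto_exp_atBot.comp e1).mul hf
        rw [zero_mul] at e2
        refine e2.congr fun x => ?_
        rw [← mul_assoc, Function.comp_apply, ← Real.exp_add]
        simp
      have hl : HasLeadingCoeff d (fun x => (z x).1) c := HasLeadingCoeff.of_abs_sub_le h2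
      have hr : HasLeadingCoeff d (fun x => (z (-x)).1 - l * Real.pi) c' :=
        HasLeadingCoeff.of_abs_sub_le h3
      refine ⟨fun x => (z x).1, fun x => (z x).2, { IsTrajectory.of_hasDerivAt_prod hd with
        tendsto_atBot := hlim hl
        tendsto_atTop := ?_ }, hl, hr⟩
      have e1 := ((hlim hr).comp tendsto_neg_atTop_atBot).add_const (l * Real.pi)
      rw [zero_add] at e1
      refine e1.congr fun x => ?_
      simp
  rw [himage]
  exact hcomp.image continuous_snd

/-- A leading coefficient that is an accumulation point of leading coefficients of connections is an
interior point of their set, by analyticity. -/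
lemma mem_nhds_of_accPt (H : IsAdmissible n d a) {l : ℤ} {c : ℝ}
    (hc : c ∈ Prod.fst '' leadingPairs n d a l)
    (hacc : AccPt c (𝓟 (Prod.fst '' leadingPairs n d a l))) :
    Prod.fst '' leadingPairs n d a l ∈ 𝓝 c := by
  obtain ⟨⟨c₀, c'⟩, ⟨y, p, h, hyc, hyc'⟩, hc₀⟩ := hc
  obtain rfl : c₀ = c := hc₀
  rename' c₀ => c
  simp only at hyc hyc'
  obtain ⟨δ, hδ, κ, hκ, w, hw, hw0, hwc, hwa, -, hwu⟩ := H.exists_analytic_family h hyc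
  obtain ⟨δ', hδ', κ', hκ', w', hw', hw0', -, hwa', hwl', hwu'⟩ :=
    H.exists_analytic_family h.reflect hyc'
  have hself := Metric.mem_ball_self (x := c) hδ
  have hself' := Metric.mem_ball_self (x := c') hδ'
  -- the data at the equator of the solutions that tend to `l π` at the opposite pole
  set σ : ℝ → ℝ × ℝ := fun u => ((w' u 0).1 + l * Real.pi, -(w' u 0).2) with hσ
  have hσa : AnalyticAt ℝ σ c' := by
    have e := hwa' c' hself'
    have e1 : AnalyticAt ℝ (fun u => (w' u 0).1) c' := analyticAt_fst.comp e
    have e2 : AnalyticAt ℝ (fun u => (w' u 0).2) c' := analyticAt_snd.comp e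
    exact (e1.add analyticAt_const).prod e2.neg
  have hσl : ∀ᶠ u in 𝓝 c', κ' * |u - c'| ≤ ‖σ u - σ c'‖ := by
    filter_upwards [Metric.ball_mem_nhds c' hδ'] with u hu
    refine (hwl' u hu c' hself').trans_eq ?_
    simp only [hσ, Prod.norm_def, Prod.fst_sub, Prod.snd_sub, add_sub_add_right_eq_sub,
      neg_sub_neg, Real.norm_eq_abs]
    rw [abs_sub_comm (w' u 0).2]
  have hpair : ∀ {q : ℝ × ℝ}, q ∈ leadingPairs n d a l → q.1 ∈ Metric.ball c δ →
      q.2 ∈ Metric.ball c' δ' → w q.1 0 = σ q.2 := by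
    rintro q ⟨y₁, p₁, h₁, e₁, e₂⟩ hq hq'
    rw [hwu _ hq l y₁ p₁ h₁ e₁]
    simp only [hσ]
    rw [hwu' _ hq' (-l) _ _ h₁.reflect e₂]
    simp
  have hts : w c 0 = σ c' := hpair (q := (c, c')) ⟨y, p, h, hyc, hyc'⟩ hself hself'
  have hfreq : ∃ᶠ q in 𝓝 (c, c'), q.1 ≠ c ∧ w q.1 0 = σ q.2 := by
    rw [Filter.frequently_iff]
    intro O hO
    obtain ⟨U, hU, W, hW, hUW⟩ := mem_nhds_prod_iff.1 (inter_mem hO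
      (prod_mem_nhds (Metric.ball_mem_nhds c hδ) (Metric.ball_mem_nhds c' hδ')))
    obtain ⟨W₀, hW₀, hW₀o, hW₀m⟩ := mem_nhds_iff.1 hW
    -- pairs whose second component stays away from `c'` have first components away from `c`
    have hK : IsCompact (Prod.fst '' (leadingPairs n d a l ∩ (univ ×ˢ W₀)ᶜ)) :=
      ((H.isCompact_leadingPairs l).inter_right
        (isOpen_univ.prod hW₀o).isClosed_compl).image continuous_fst
    have hcK : c ∉ Prod.fst '' (leadingPairs n d a l ∩ (univ ×ˢ W₀)ᶜ) := by
      rintro ⟨⟨_, c₁⟩, ⟨⟨y₁, p₁, h₁, e₁, e₂⟩, hn⟩, rfl⟩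
      obtain rfl := H.eq_of_hasLeadingCoeff h₁ h e₁ hyc
      obtain rfl : c₁ = c' := tendsto_nhds_unique e₂ hyc'
      exact hn ⟨mem_univ _, hW₀m⟩
    obtain ⟨_, ⟨⟨hc₁U, hc₁K⟩, ⟨⟨_, c₁'⟩, hq, rfl⟩⟩, hne⟩ := accPt_iff_nhds.1 hacc _
      (inter_mem hU (hK.isClosed.isOpen_compl.mem_nhds hcK))
    have hW₁ : c₁' ∈ W₀ := by
      by_contra hn
      exact hc₁K ⟨_, ⟨hq, fun hm => hn hm.2⟩, rfl⟩
    have hm := hUW (show (_, c₁') ∈ U ×ˢ W from ⟨hc₁U, hW₀ hW₁⟩)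
    exact ⟨_, hm.1, hne, hpair hq hm.2.1 hm.2.2⟩
  have key := eventually_exists_eq_of_frequently (γ := fun t => w t 0) (γ' := σ)
    (hwa c hself) hσa hκ' hσl hts hfreq (Metric.ball_mem_nhds c' hδ')
  filter_upwards [key, Metric.ball_mem_nhds c hδ] with t ht htδ
  obtain ⟨u, hu, heq⟩ := ht
  obtain ⟨y₁, p₁, h₁, e₁⟩ := isConnection_of_halves (hw t htδ) (hw' u hu) (hw0 t htδ) (hw0' u hu)
      heq
  have hlead : HasLeadingCoeff d y₁ t := by
    refine (hwc t htδ).congr' ?_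
    filter_upwards [eventually_le_atBot 0] with x hx
    rw [e₁ x hx]
  obtain ⟨-, c₁, hc₁⟩ := (exists_uniform_asymptotics H.one_le_dim H.one_le_degree H.pos
    H.large).choose_spec.2.choose_spec (-l) _ _ h₁.reflect
  exact ⟨(t, c₁), ⟨y₁, p₁, h₁, hlead, HasLeadingCoeff.of_abs_sub_le hc₁⟩, rfl⟩

/-- An infinite compact set of reals has a largest accumulation point; by analyticity it would be
interior to the set, hence exceeded by other accumulation points. -/
lemma finite_leadingCoeffs (H : IsAdmissible n d a) (l : ℤ) :
    (Prod.fst '' leadingPairs n d a l).Finite := by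
  set A := Prod.fst '' leadingPairs n d a l with hA
  have hcomp : IsCompact A := (H.isCompact_leadingPairs l).image continuous_fst
  by_contra hinf
  have hsub : derivedSet A ⊆ A := (isClosed_iff_derivedSet_subset A).1 hcomp.isClosed
  have hDc : IsCompact (derivedSet A) := hcomp.of_isClosed_subset (isClosed_derivedSet A) hsub
  obtain ⟨x, -, hx⟩ := Set.Infinite.exists_accPt_of_subset_isCompact hinf hcomp Subset.rfl
  obtain ⟨c, hc, hmax⟩ := hDc.exists_isGreatest ⟨x, hx⟩
  have hnhds := eventually_eventually_nhds.2 (H.mem_nhds_of_accPt (hsub hc) hc)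
  obtain ⟨t, ht, htc⟩ := ((Filter.Eventually.filter_mono (nhdsWithin_le_nhds (s := Ioi c))
      hnhds).and
    self_mem_nhdsWithin).exists
  refine absurd (hmax (a := t) ?_) (not_le.2 htc)
  have htA : A ∈ 𝓝 t := ht
  rw [mem_derivedSet, AccPt, inf_of_le_left (le_principal_iff.2 (mem_nhdsWithin_of_mem_nhds htA))]
  infer_instance

end IsAdmissible

/-- The Euler-Lagrange equation has only finitely many solutions that connect multiples of `π`. -/
theorem finite_connections {n d : ℕ} (hn : 1 ≤ n) {a : ℝ} (ha : 0 < a)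
    (hlarge : 4 * ((d : ℝ) * (d + n)) ≤ a ^ 2 * (n : ℝ) ^ 2) :
    {y : ℝ → ℝ | ∃ (l : ℤ) (p : ℝ → ℝ), IsConnection n (d * (d + n)) a l y p}.Finite := by
  rcases Nat.eq_zero_or_pos d with rfl | hd
  · refine (finite_singleton (0 : ℝ → ℝ)).subset ?_
    rintro y ⟨l, p, h⟩
    simp only [Nat.cast_zero, zero_mul] at h
    exact h.eq_zero_of_eigenvalue_eq_zero ha.ne' (Nat.cast_nonneg n)
  have H : IsAdmissible n d a := ⟨hn, hd, ha, hlarge⟩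
  have hlam : (0 : ℝ) ≤ d * (d + n) := by positivity
  obtain ⟨X, -, K, hK⟩ := exists_uniform_asymptotics hn hd ha hlarge
  have hfix : ∀ l : ℤ, {y : ℝ → ℝ | ∃ p, IsConnection n (d * (d + n)) a l y p}.Finite := by
    intro l
    choose! c hc using fun (y : ℝ → ℝ) (hy : ∃ p, IsConnection n (d * (d + n)) a l y p) =>
      (hy.elim fun p h => (hK l y p h).2.imp fun c hc => HasLeadingCoeff.of_abs_sub_le hc :
        ∃ c, HasLeadingCoeff d y c)
    refine Set.Finite.of_finite_image (f := c) ((H.finite_leadingCoeffs l).subset ?_) ?_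
    · rintro _ ⟨y, ⟨p, h⟩, rfl⟩
      obtain ⟨-, c', hc'⟩ := hK (-l) _ _ h.reflect
      exact ⟨(c y, c'), ⟨y, p, h, hc y ⟨p, h⟩, HasLeadingCoeff.of_abs_sub_le hc'⟩, rfl⟩
    · rintro y ⟨p, h⟩ y' ⟨p', h'⟩ he
      have e := hc y' ⟨p', h'⟩
      rw [← he] at e
      exact H.eq_of_hasLeadingCoeff h h' (hc y ⟨p, h⟩) e
  refine ((finite_Icc (-1 : ℤ) 1).biUnion fun l _ => hfix l).subset ?_
  rintro y ⟨l, p, h⟩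
  simp only [mem_iUnion, exists_prop]
  refine ⟨l, ?_, p, h⟩
  have hpi := Real.pi_pos
  have hb : ∀ x, |y x| ≤ Real.pi := fun x => by
    rcases h.trichotomy ha.ne' (Nat.cast_nonneg n) hlam with h0 | h0 | h0
    · simp [h0, hpi.le]
    · rw [abs_of_pos (h0 x).1]
      exact (h0 x).2.le
    · rw [← abs_neg, abs_of_pos (h0 x).1]
      exact (h0 x).2.le
  have h1 : |(l : ℝ) * Real.pi| ≤ Real.pi :=
    le_of_tendsto h.tendsto_atTop.abs (Eventually.of_forall hb)
  rw [abs_mul, abs_of_pos hpi] at h1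
  have h2 : |(l : ℝ)| ≤ 1 := le_of_mul_le_mul_right (by linarith) hpi
  have h3 : |l| ≤ 1 := by exact_mod_cast h2
  exact abs_le.1 h3

end Finiteness

/-! ### The boundary value problem on `(0, π)` -/

section Colatitude

/-- The colatitude `ψ ∈ (0, π)` with `log (tan (ψ / 2)) = x`. -/
noncomputable def colat (x : ℝ) : ℝ := 2 * Real.arctan (Real.exp x)

lemma colat_mem (x : ℝ) : colat x ∈ Ioo 0 Real.pi := by
  have h1 := Real.arctan_pos.2 (Real.exp_pos x)
  have h2 := Real.arctan_lt_pi_div_two (Real.exp x)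
  unfold colat
  constructor <;> linarith

lemma sin_colat (x : ℝ) : Real.sin (colat x) = colatSin x := by
  have h : 0 < 1 + Real.exp x ^ 2 := by positivity
  have hs := Real.sq_sqrt h.le
  have hp := Real.exp_pos x
  rw [colat, Real.sin_two_mul, Real.sin_arctan, Real.cos_arctan, colatSin, Real.cosh_eq,
    Real.exp_neg]
  have h0 : √(1 + Real.exp x ^ 2) ≠ 0 := (Real.sqrt_pos.2 h).ne'
  field_simp
  rw [hs]
  ring

lemma cos_colat (x : ℝ) : Real.cos (colat x) = colatCos x := by
  have h : 0 < 1 + Real.exp x ^ 2 := by positivity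
  have hp := Real.exp_pos x
  rw [colat, Real.cos_two_mul, Real.cos_sq_arctan, colatCos, Real.cosh_eq, Real.sinh_eq,
    Real.exp_neg]
  field_simp
  ring

lemma hasDerivAt_colat (x : ℝ) : HasDerivAt colat (colatSin x) x := by
  have h : 0 < 1 + Real.exp x ^ 2 := by positivity
  have hp := Real.exp_pos x
  refine ((Real.hasDerivAt_exp x).arctan.const_mul 2).congr_deriv ?_
  rw [colatSin, Real.cosh_eq, Real.exp_neg]
  field_simp
  ring

lemma colat_log_tan {t : ℝ} (ht : t ∈ Ioo 0 Real.pi) :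
    colat (Real.log (Real.tan (t / 2))) = t := by
  have h1 : 0 < t / 2 := by linarith [ht.1]
  have h2 : t / 2 < Real.pi / 2 := by linarith [ht.2]
  rw [colat, Real.exp_log (Real.tan_pos_of_pos_of_lt_pi_div_two h1 h2),
    Real.arctan_tan (by linarith) h2]
  ring

lemma tendsto_colat_atBot : Tendsto colat atBot (𝓝[>] 0) := by
  refine tendsto_nhdsWithin_iff.2 ⟨?_, Eventually.of_forall fun x => (colat_mem x).1⟩
  have := ((Real.continuous_arctan.tendsto 0).comp Real.tendsto_exp_atBot).const_mul 2
  rw [Real.arctan_zero, mul_zero] at this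
  exact this

lemma tendsto_colat_atTop : Tendsto colat atTop (𝓝[<] Real.pi) := by
  refine tendsto_nhdsWithin_iff.2 ⟨?_, Eventually.of_forall fun x => (colat_mem x).2⟩
  have := ((tendsto_nhds_of_tendsto_nhdsWithin Real.tendsto_arctan_atTop).comp
    Real.tendsto_exp_atTop).const_mul 2
  rw [mul_div_cancel₀ _ (two_ne_zero' ℝ)] at this
  exact this

end Colatitude

/-- In the logarithmic colatitude a solution of the boundary value problem is a connection. -/
lemma IsProfileSolution.isConnection {n d : ℕ} {a : ℝ} {f : ℝ → ℝ}
    (h : IsProfileSolution (n + 2) d a f) :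
    ∃ (l : ℤ) (p : ℝ → ℝ), IsConnection n (d * (d + n)) |a| l (f ∘ colat) p := by
  obtain ⟨hf, hode, h0, l, hl⟩ := h
  have hder : ∀ t ∈ Ioo 0 Real.pi, HasDerivAt f (deriv f t) t := fun t ht =>
    ((hf.differentiableOn (by norm_num)).differentiableAt (isOpen_Ioo.mem_nhds ht)).hasDerivAt
  have hder2 : ∀ t ∈ Ioo 0 Real.pi, HasDerivAt (deriv f) (deriv (deriv f) t) t := fun t ht =>
    (((hf.deriv_of_isOpen (m := 1) isOpen_Ioo (by norm_num)).differentiableOn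
      (by norm_num)).differentiableAt (isOpen_Ioo.mem_nhds ht)).hasDerivAt
  refine ⟨l, fun x => deriv f (colat x) * colatSin x, ⟨⟨fun x => ?_, fun x => ?_⟩, ?_, ?_⟩⟩
  · exact (hder _ (colat_mem x)).comp x (hasDerivAt_colat x)
  · refine (((hder2 _ (colat_mem x)).comp x (hasDerivAt_colat x)).mul
      (hasDerivAt_colatSin x)).congr_deriv ?_
    rw [hode _ (colat_mem x)]
    have hS := (colatSin_pos x).ne'
    simp only [profileAccel, baseCoeff, metricCoeff, sq_abs, Real.cot_eq_cos_div_sin,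
      Real.sin_two_mul, sin_colat, cos_colat, Function.comp]
    push_cast
    field_simp
    ring
  · exact h0.comp tendsto_colat_atBot
  · exact hl.comp tendsto_colat_atTop

theorem finite_isProfileSolution {n d : ℕ} (hn : 1 ≤ n) {a : ℝ} (ha : a ≠ 0)
    (hlarge : 4 * ((d : ℝ) * (d + n)) ≤ a ^ 2 * (n : ℝ) ^ 2) :
    ((Ioo 0 Real.pi).domRestrict '' {f : ℝ → ℝ | IsProfileSolution (n + 2) d a f}).Finite := by
  have hfin := finite_connections (d := d) hn (abs_pos.2 ha) (by rwa [sq_abs])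
  refine (hfin.image fun y => (Ioo 0 Real.pi).domRestrict
    fun t => y (Real.log (Real.tan (t / 2)))).subset ?_
  rintro _ ⟨f, hf, rfl⟩
  refine ⟨f ∘ colat, hf.isConnection, ?_⟩
  ext t
  simp [Function.comp, colat_log_tan t.2]

/-! ### Curves on the ellipsoid and on the sphere -/

section Curves

variable {k : ℕ} {a : ℝ}

/-- The derivative of `ellipsoidPoint a ψ z` in the direction `∂ψ`. -/
noncomputable def meridianVector (a t : ℝ) (z : EuclideanSpace ℝ (Fin k)) : AmbientSpace k :=
  WithLp.toLp 2 (-(a * Real.sin t), Real.cos t • z)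

lemma ellipsoidPoint_mem (a t : ℝ) {z : EuclideanSpace ℝ (Fin k)} (hz : ‖z‖ = 1) : ellipsoidPoint a
    t z ∈ ellipsoid k a := by
  have hc : Real.cos (Real.arccos (Real.cos t)) = Real.cos t :=
    Real.cos_arccos (Real.neg_one_le_cos t) (Real.cos_le_one t)
  have hs : Real.sin (Real.arccos (Real.cos t)) = |Real.sin t| := by
    rw [Real.sin_arccos, Real.abs_sin_eq_sqrt_one_sub_cos_sq]
  have hI : Real.arccos (Real.cos t) ∈ Icc 0 Real.pi :=
    ⟨Real.arccos_nonneg _, Real.arccos_le_pi _⟩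
  rcases le_total 0 (Real.sin t) with h | h
  · refine ⟨_, hI, z, by simpa using hz, ?_⟩
    rw [ellipsoidPoint, ellipsoidPoint, hc, hs, abs_of_nonneg h]
  · refine ⟨_, hI, -z, by simpa using hz, ?_⟩
    rw [ellipsoidPoint, ellipsoidPoint, hc, hs, abs_of_nonpos h, neg_smul_neg]

lemma sq_add_sq_of_mem_ellipsoid {x : AmbientSpace k} (hx : x ∈ ellipsoid k a) :
    x.fst ^ 2 + a ^ 2 * inner ℝ x.snd x.snd = a ^ 2 := by
  obtain ⟨t, -, z, hz, rfl⟩ := hx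
  have hz1 : ‖z‖ = 1 := by simpa using hz
  have h := Real.sin_sq_add_cos_sq t
  have : inner ℝ (Real.sin t • z) (Real.sin t • z) = Real.sin t ^ 2 := by
    rw [real_inner_smul_left, real_inner_smul_right, real_inner_self_eq_norm_sq, hz1]
    ring
  change (a * Real.cos t) ^ 2 + a ^ 2 * inner ℝ (Real.sin t • z) (Real.sin t • z) = a ^ 2
  rw [this]
  linear_combination a ^ 2 * h

lemma HasDerivAt.toLp_prodMk {u : ℝ → ℝ} {v : ℝ → EuclideanSpace ℝ (Fin k)} {u' : ℝ}
    {v' : EuclideanSpace ℝ (Fin k)} {t : ℝ}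
    (hu : HasDerivAt u u' t) (hv : HasDerivAt v v' t) :
    HasDerivAt (fun s => (WithLp.toLp 2 (u s, v s) : AmbientSpace k))
      (WithLp.toLp 2 (u', v')) t :=
  (WithLp.prodContinuousLinearEquiv 2 ℝ ℝ (EuclideanSpace ℝ
      (Fin k))).symm.hasFDerivAt.comp_hasDerivAt t (hu.prodMk hv)

lemma HasDerivAt.ellipsoidPoint {g : ℝ → ℝ} {ζ : ℝ → EuclideanSpace ℝ (Fin k)} {g' : ℝ}
    {ζ' : EuclideanSpace ℝ (Fin k)} {t : ℝ}
    (hg : HasDerivAt g g' t) (hζ : HasDerivAt ζ ζ' t) :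
    HasDerivAt (fun s => ellipsoidPoint a (g s) (ζ s))
      (WithLp.toLp 2 (-(a * Real.sin (g t) * g'),
        Real.sin (g t) • ζ' + (Real.cos (g t) * g') • ζ t)) t := by
  refine HasDerivAt.toLp_prodMk ((hg.cos.const_mul a).congr_deriv ?_) (hg.sin.smul hζ)
  ring

lemma ContDiff.ellipsoidPoint {g : ℝ → ℝ} {ζ : ℝ → EuclideanSpace ℝ (Fin k)} (hg : ContDiff ℝ ∞ g)
    (hζ : ContDiff ℝ ∞ ζ) : ContDiff ℝ ∞ fun s => ellipsoidPoint a (g s) (ζ s) :=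
  (WithLp.prodContinuousLinearEquiv 2 ℝ ℝ (EuclideanSpace ℝ (Fin k))).symm.contDiff.comp
    ((contDiff_const.mul hg.cos).prodMk (hg.sin.smul hζ))

/-- The second derivative of a curve on the ellipsoid in the coordinates `(ψ, z)`. -/
lemma deriv_deriv_ellipsoidPoint {g g₁ : ℝ → ℝ} {ζ ζ₁ : ℝ → EuclideanSpace ℝ (Fin k)} {g₂ : ℝ}
    {ζ₂ : EuclideanSpace ℝ (Fin k)} {t : ℝ}
    (hg : ∀ᶠ s in 𝓝 t, HasDerivAt g (g₁ s) s) (hg₁ : HasDerivAt g₁ g₂ t)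
    (hζ : ∀ᶠ s in 𝓝 t, HasDerivAt ζ (ζ₁ s) s) (hζ₁ : HasDerivAt ζ₁ ζ₂ t) :
    deriv (deriv fun s => ellipsoidPoint a (g s) (ζ s)) t =
      WithLp.toLp 2 (-(a * Real.cos (g t) * g₁ t ^ 2) - a * Real.sin (g t) * g₂,
        Real.sin (g t) • ζ₂ + (2 * Real.cos (g t) * g₁ t) • ζ₁ t
          + (Real.cos (g t) * g₂ - Real.sin (g t) * g₁ t ^ 2) • ζ t) := by
  have hev : (deriv fun s => ellipsoidPoint a (g s) (ζ s)) =ᶠ[𝓝 t] fun s =>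
      WithLp.toLp 2 (-(a * Real.sin (g s) * g₁ s),
        Real.sin (g s) • ζ₁ s + (Real.cos (g s) * g₁ s) • ζ s) := by
    filter_upwards [hg, hζ] with s h1 h2 using (h1.ellipsoidPoint h2).deriv
  rw [hev.deriv_eq]
  have h1 := hg.self_of_nhds
  have h2 := hζ.self_of_nhds
  refine (HasDerivAt.toLp_prodMk ((((h1.sin.const_mul a).mul hg₁).neg).congr_deriv ?_)
    (((h1.sin.smul hζ₁).add ((h1.cos.mul hg₁).smul h2)).congr_deriv ?_)).deriv
  · ring
  · simp only [Pi.mul_apply]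
    module

/-- Along a curve on the ellipsoid, the component of the acceleration in the direction of the
meridians. The last term is the centrifugal force of the motion on the sphere. -/
lemma inner_meridianVector_deriv_deriv {g g₁ : ℝ → ℝ} {ζ ζ₁ : ℝ → EuclideanSpace ℝ (Fin k)} {g₂ : ℝ}
    {ζ₂ : EuclideanSpace ℝ (Fin k)} {t : ℝ}
    (hg : ∀ᶠ s in 𝓝 t, HasDerivAt g (g₁ s) s) (hg₁ : HasDerivAt g₁ g₂ t)
    (hζ : ∀ s, HasDerivAt ζ (ζ₁ s) s) (hζ₁ : HasDerivAt ζ₁ ζ₂ t) (h1 : ∀ s, ‖ζ s‖ = 1) :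
    inner ℝ (meridianVector a (g t) (ζ t))
        (deriv (deriv fun s => ellipsoidPoint a (g s) (ζ s)) t) =
      metricCoeff a (g t) * g₂ + Real.sin (g t) * Real.cos (g t)
        * ((a ^ 2 - 1) * g₁ t ^ 2 - ‖ζ₁ t‖ ^ 2) := by
  have hz : ∀ s, inner ℝ (ζ s) (ζ s) = (1 : ℝ) := fun s => by
    rw [real_inner_self_eq_norm_sq, h1, one_pow]
  have e1 : ∀ s, inner ℝ (ζ s) (ζ₁ s) = (0 : ℝ) := by
    intro s
    have := ((hζ s).inner ℝ (hζ s)).unique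
      (((hasDerivAt_const s (1 : ℝ)).congr_of_eventuallyEq (Eventually.of_forall hz)))
    linarith [real_inner_comm (ζ s) (ζ₁ s)]
  have e2 : inner ℝ (ζ t) ζ₂ = -‖ζ₁ t‖ ^ 2 := by
    have := ((hζ t).inner ℝ hζ₁).unique
      ((hasDerivAt_const t (0 : ℝ)).congr_of_eventuallyEq (Eventually.of_forall e1))
    rw [real_inner_self_eq_norm_sq] at this
    linarith
  rw [deriv_deriv_ellipsoidPoint hg hg₁ (Eventually.of_forall hζ) hζ₁, WithLp.prod_inner_apply]
  simp only [meridianVector, inner_add_right, real_inner_smul_left, real_inner_smul_right, e1, e2,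
    hz, metricCoeff]
  simp
  ring

/-- A vector in the plane of the meridian through `z` is normal to the ellipsoid as soon as it is
orthogonal to the meridian. -/
lemma isNormalTo_ellipsoid (ha : a ≠ 0) {t : ℝ} {z : EuclideanSpace ℝ (Fin k)} (hz : ‖z‖ = 1)
    {b c : ℝ}
    (h : inner ℝ (meridianVector a t z) (WithLp.toLp 2 (b, c • z) : AmbientSpace k) = (0 : ℝ)) :
    IsNormalTo (ellipsoid k a) (ellipsoidPoint a t z) (WithLp.toLp 2 (b, c • z)) := by
  rintro γ ⟨hγ, hmem, h0⟩
  have hd : HasDerivAt γ (deriv γ 0) 0 := (hγ.differentiable (by simp)).differentiableAt.hasDerivAt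
  have hu : HasDerivAt (fun s => (γ s).fst) (deriv γ 0).fst 0 :=
    (WithLp.fstL 2 ℝ ℝ (EuclideanSpace ℝ (Fin k))).hasFDerivAt.comp_hasDerivAt 0 hd
  have hv : HasDerivAt (fun s => (γ s).snd) (deriv γ 0).snd 0 :=
    (WithLp.sndL 2 ℝ ℝ (EuclideanSpace ℝ (Fin k))).hasFDerivAt.comp_hasDerivAt 0 hd
  have he := ((hu.pow 2).add ((hv.inner ℝ hv).const_mul (a ^ 2))).unique
    ((hasDerivAt_const (0 : ℝ) (a ^ 2)).congr_of_eventuallyEq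
      (Eventually.of_forall fun s => sq_add_sq_of_mem_ellipsoid (hmem s)))
  rw [h0] at he
  have hz2 : inner ℝ z z = (1 : ℝ) := by rw [real_inner_self_eq_norm_sq, hz, one_pow]
  rw [WithLp.prod_inner_apply] at h ⊢
  simp only [meridianVector, ellipsoidPoint, real_inner_smul_left, real_inner_smul_right, hz2,
    WithLp.toLp_fst, WithLp.toLp_snd, RCLike.inner_apply, conj_trivial] at h he ⊢
  rw [real_inner_comm (deriv γ 0).snd z] at he
  have he' : Real.cos t * (deriv γ 0).fst + a * Real.sin t * inner ℝ (deriv γ 0).snd z = 0 := by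
    refine (mul_eq_zero.1 (?_ : 2 * a * _ = 0)).resolve_left (mul_ne_zero two_ne_zero ha)
    push_cast at he
    linear_combination he
  have hm := (metricCoeff_pos ha t).ne'
  refine (mul_eq_zero.1 (?_ : metricCoeff a t * _ = 0)).resolve_left hm
  change metricCoeff a t * (b * (deriv γ 0).fst + c * inner ℝ (deriv γ 0).snd z) = 0
  unfold metricCoeff
  linear_combination (Real.cos t * b + a * Real.sin t * c) * he'
    + (Real.cos t * inner ℝ (deriv γ 0).snd z - a * Real.sin t * (deriv γ 0).fst) * h

end Curves

/-! ### Geodesic frames -/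

section Frames

lemma Orthonormal.fin_cons {V : Type*} [NormedAddCommGroup V] [InnerProductSpace ℝ V] {m : ℕ}
    {v : V} {w : Fin m → V} (hw : Orthonormal ℝ w) (hv : ‖v‖ = 1) (h : ∀ i, inner ℝ v (w i) = 0) :
    Orthonormal ℝ (Fin.cons v w : Fin (m + 1) → V) := by
  refine ⟨fun i => ?_, fun i j hij => ?_⟩
  · induction i using Fin.cases with
    | zero => simpa using hv
    | succ i => simpa using hw.1 i
  · induction i using Fin.cases with
    | zero =>
      induction j using Fin.cases with
      | zero => exact absurd rfl hij
      | succ j => simpa using h j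
    | succ i =>
      induction j using Fin.cases with
      | zero => simpa [real_inner_comm] using h i
      | succ j => simpa using hw.2 (fun e => hij (by rw [e]))

lemma exists_orthonormal_orthogonal {m : ℕ} {z : EuclideanSpace ℝ (Fin (m + 1))} (hz : ‖z‖ = 1) :
    ∃ e : Fin m → EuclideanSpace ℝ (Fin (m + 1)), Orthonormal ℝ e ∧ ∀ i, inner ℝ z (e i) = 0 := by
  have : Fact (Module.finrank ℝ (EuclideanSpace ℝ (Fin (m + 1))) = m + 1) := ⟨by simp⟩
  have hz0 : z ≠ 0 := fun h => by simp [h] at hz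
  have hr := Submodule.finrank_orthogonal_span_singleton (𝕜 := ℝ) (n := m) hz0
  let b := (stdOrthonormalBasis ℝ (ℝ ∙ z)ᗮ).reindex (finCongr hr)
  refine ⟨fun i => b i, b.orthonormal.comp_linearIsometry (Submodule.subtypeₗᵢ _), fun i => ?_⟩
  exact Submodule.mem_orthogonal_singleton_iff_inner_right.1 (b i).2

section GreatCircle

variable {V : Type*} [NormedAddCommGroup V] [InnerProductSpace ℝ V]

/-- The great circle that passes through `z` with velocity `e`. -/
noncomputable def greatCircle (z e : V) (t : ℝ) : V := Real.cos t • z + Real.sin t • e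

@[simp] lemma greatCircle_zero (z e : V) : greatCircle z e 0 = z := by simp [greatCircle]

lemma contDiff_greatCircle {n : WithTop ℕ∞} (z e : V) : ContDiff ℝ n (greatCircle z e) :=
  (Real.contDiff_cos.smul contDiff_const).add (Real.contDiff_sin.smul contDiff_const)

lemma hasDerivAt_greatCircle (z e : V) (t : ℝ) :
    HasDerivAt (greatCircle z e) (greatCircle e (-z) t) t := by
  refine (((Real.hasDerivAt_cos t).smul_const z).add
    ((Real.hasDerivAt_sin t).smul_const e)).congr_deriv ?_
  simp [greatCircle, add_comm]

lemma norm_greatCircle {z e : V} (hz : ‖z‖ = 1) (he : ‖e‖ = 1) (h : inner ℝ z e = 0) (t : ℝ) :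
    ‖greatCircle z e t‖ = 1 := by
  have : ‖greatCircle z e t‖ ^ 2 = 1 := by
    rw [greatCircle, norm_add_sq_real, norm_smul, norm_smul, real_inner_smul_left,
      real_inner_smul_right, h, hz, he]
    simp [add_comm]
  nlinarith [norm_nonneg (greatCircle z e t)]

lemma IsCurveFrom.inner_deriv_eq_zero {z : V} {γ : ℝ → V}
    (h : IsCurveFrom (Metric.sphere 0 1) z γ) : inner ℝ (deriv γ 0) z = 0 := by
  obtain ⟨hγ, hmem, h0⟩ := h
  have hd : HasDerivAt γ (deriv γ 0) 0 := (hγ.differentiable (by simp)).differentiableAt.hasDerivAt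
  have h1 : ∀ s, inner ℝ (γ s) (γ s) = (1 : ℝ) := fun s => by
    have : ‖γ s‖ = 1 := by simpa using hmem s
    rw [real_inner_self_eq_norm_sq, this, one_pow]
  have := (hd.inner ℝ hd).unique
    ((hasDerivAt_const (0 : ℝ) (1 : ℝ)).congr_of_eventuallyEq (Eventually.of_forall h1))
  rw [h0] at this
  linarith [real_inner_comm (deriv γ 0) z]

lemma isGeodesicFrame_greatCircle {m : ℕ} {z : V} {e : Fin m → V} (hz : ‖z‖ = 1)
    (he : Orthonormal ℝ e) (h : ∀ i, inner ℝ z (e i) = 0) :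
    IsGeodesicFrame m (Metric.sphere 0 1) z fun i => greatCircle z (e i) := by
  have hd : ∀ u v : V, deriv (greatCircle u v) = greatCircle v (-u) := fun u v =>
    funext fun t => (hasDerivAt_greatCircle u v t).deriv
  refine ⟨fun i => ⟨contDiff_greatCircle _ _, fun t => ?_, greatCircle_zero _ _⟩, ?_,
    fun i γ hγ => ?_⟩
  · simpa using norm_greatCircle hz (he.1 i) (h i) t
  · simpa [hd] using he
  · rw [hd, hd, greatCircle_zero, inner_neg_right, hγ.inner_deriv_eq_zero, neg_zero]

end GreatCircle

section Ellipsoid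

variable {k : ℕ} {a : ℝ}

/-- A criterion for a vanishing tangential acceleration, for curves along a meridian or with
`ψ`-velocity zero. -/
lemma isNormalTo_deriv_deriv_ellipsoidPoint (ha : a ≠ 0) {g g₁ : ℝ → ℝ}
    {ζ ζ₁ : ℝ → EuclideanSpace ℝ (Fin k)} {g₂ r : ℝ}
    (hg : ∀ s, HasDerivAt g (g₁ s) s) (hg₁ : HasDerivAt g₁ g₂ 0)
    (hζ : ∀ s, HasDerivAt ζ (ζ₁ s) s) (hζ₁ : HasDerivAt ζ₁ (r • ζ 0) 0) (h1 : ∀ s, ‖ζ s‖ = 1)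
    (hcross : g₁ 0 • ζ₁ 0 = 0)
    (h : metricCoeff a (g 0) * g₂ + Real.sin (g 0) * Real.cos (g 0)
        * ((a ^ 2 - 1) * g₁ 0 ^ 2 - ‖ζ₁ 0‖ ^ 2) = 0) :
    IsNormalTo (ellipsoid k a) (ellipsoidPoint a (g 0) (ζ 0))
      (deriv (deriv fun s => ellipsoidPoint a (g s) (ζ s)) 0) := by
  rw [← inner_meridianVector_deriv_deriv (Eventually.of_forall hg) hg₁ hζ hζ₁ h1] at h
  rw [deriv_deriv_ellipsoidPoint (Eventually.of_forall hg) hg₁ (Eventually.of_forall hζ) hζ₁]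
    at h ⊢
  rw [mul_smul, hcross, smul_zero, add_zero, smul_smul, ← add_smul] at h ⊢
  exact isNormalTo_ellipsoid ha (h1 0) h

lemma hasDerivAt_quadratic (t α β s : ℝ) :
    HasDerivAt (fun s => t + α * s + β / 2 * s ^ 2) (α + β * s) s := by
  refine ((((hasDerivAt_id s).const_mul α).const_add t).add
    (((hasDerivAt_id s).pow 2).const_mul (β / 2))).congr_deriv ?_
  simp
  ring

lemma hasDerivAt_affine (α β s : ℝ) : HasDerivAt (fun s => α + β * s) β s := by
  simpa using ((hasDerivAt_id s).const_mul β).const_add α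

lemma contDiff_quadratic {n : WithTop ℕ∞} (t α β : ℝ) :
    ContDiff ℝ n fun s : ℝ => t + α * s + β / 2 * s ^ 2 := by
  fun_prop

/-- The meridian through `ellipsoidPoint a t z`, parametrized so that at time `0` it has unit speed
and no tangential acceleration. -/
noncomputable def meridianCurve (a t : ℝ) (z : EuclideanSpace ℝ (Fin k)) (s : ℝ) :
    AmbientSpace k :=
  ellipsoidPoint a (t + (√(metricCoeff a t))⁻¹ * s
    + (-((a ^ 2 - 1) * (Real.sin t * Real.cos t) / metricCoeff a t ^ 2)) / 2 * s ^ 2) z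

/-- The parallel through `ellipsoidPoint a t z` in the direction `e`, bent along the meridians so
that its tangential acceleration vanishes at time `0`. -/
noncomputable def parallelCurve (a t : ℝ) (z e : EuclideanSpace ℝ (Fin k)) (s : ℝ) :
    AmbientSpace k :=
  ellipsoidPoint a (t + 0 * s + (Real.cos t / (Real.sin t * metricCoeff a t)) / 2 * s ^ 2)
    (greatCircle z e ((Real.sin t)⁻¹ * s))

lemma hasDerivAt_greatCircle_mul {V : Type*} [NormedAddCommGroup V] [InnerProductSpace ℝ V]
    (z e : V) (c s : ℝ) :
    HasDerivAt (fun s => greatCircle z e (c * s)) (c • greatCircle e (-z) (c * s)) s := by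
  have := (hasDerivAt_greatCircle z e (c * s)).scomp s ((hasDerivAt_id s).const_mul c)
  rw [mul_one] at this
  exact this

/-- The meridian and the parallels in orthonormal directions form a geodesic frame away from the
poles. -/
lemma isGeodesicFrame_ellipsoid {m : ℕ} (ha : a ≠ 0) {t : ℝ} (ht : Real.sin t ≠ 0)
    {z : EuclideanSpace ℝ (Fin (m + 1))} {e : Fin m → EuclideanSpace ℝ (Fin (m + 1))}
    (hz : ‖z‖ = 1) (he : Orthonormal ℝ e) (h : ∀ i, inner ℝ z (e i) = 0) :
    IsGeodesicFrame (m + 1) (ellipsoid (m + 1) a) (ellipsoidPoint a t z)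
      (Fin.cons (meridianCurve a t z) fun i => parallelCurve a t z (e i) :
        Fin (m + 1) → ℝ → AmbientSpace (m + 1)) := by
  have hm := metricCoeff_pos ha t
  have hsq := Real.sq_sqrt hm.le
  have hs0 := (Real.sqrt_pos.2 hm).ne'
  have hd0 : deriv (meridianCurve a t z) 0 = (√(metricCoeff a t))⁻¹ • meridianVector a t z := by
    have := ((hasDerivAt_quadratic t (√(metricCoeff a t))⁻¹
      (-((a ^ 2 - 1) * (Real.sin t * Real.cos t) / metricCoeff a t ^ 2)) 0).ellipsoidPoint (a := a)
      (hasDerivAt_const (0 : ℝ) z)).deriv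
    refine this.trans (?_ : _ = (WithLp.toLp 2 ((√(metricCoeff a t))⁻¹ * -(a * Real.sin t),
      (√(metricCoeff a t))⁻¹ • Real.cos t • z) : AmbientSpace (m + 1)))
    simp only [mul_zero, add_zero, ne_eq, OfNat.ofNat_ne_zero, not_false_eq_true, zero_pow,
      smul_zero, zero_add, smul_smul]
    ring_nf
  have hd1 : ∀ i, deriv (parallelCurve a t z (e i)) 0 =
      (WithLp.toLp 2 (0, e i) : AmbientSpace (m + 1)) := by
    intro i
    have := ((hasDerivAt_quadratic t 0
      (Real.cos t / (Real.sin t * metricCoeff a t)) 0).ellipsoidPoint (a := a)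
      (hasDerivAt_greatCircle_mul z (e i) (Real.sin t)⁻¹ 0)).deriv
    refine this.trans ?_
    simp [smul_smul, ht]
  have hzz : inner ℝ z z = (1 : ℝ) := by rw [real_inner_self_eq_norm_sq, hz, one_pow]
  refine ⟨fun i => ?_, ?_, fun i => ?_⟩
  · induction i using Fin.cases with
    | zero =>
      refine ⟨(contDiff_quadratic _ _ _).ellipsoidPoint contDiff_const,
        fun s => ellipsoidPoint_mem _ _ hz, ?_⟩
      simp [meridianCurve]
    | succ i =>
      refine ⟨(contDiff_quadratic _ _ _).ellipsoidPoint
        ((contDiff_greatCircle z (e i)).comp (contDiff_const.mul contDiff_id)),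
        fun s => ellipsoidPoint_mem _ _ (norm_greatCircle hz (he.1 i) (h i) _), ?_⟩
      simp [parallelCurve]
  · have e1 : (fun i => deriv ((Fin.cons (meridianCurve a t z) fun i => parallelCurve a t z (e i) :
        Fin (m + 1) → ℝ → AmbientSpace (m + 1)) i) 0) =
        (Fin.cons ((√(metricCoeff a t))⁻¹ • meridianVector a t z)
          fun i => (WithLp.toLp 2 (0, e i) : AmbientSpace (m + 1))) := by
      funext i
      induction i using Fin.cases with
      | zero => simpa using hd0
      | succ i => simpa using hd1 i
    rw [e1]
    refine Orthonormal.fin_cons ⟨fun i => ?_, fun i j hij => ?_⟩ ?_ fun i => ?_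
    · have := WithLp.prod_norm_sq_eq_of_L2 (WithLp.toLp 2 (0, e i) : AmbientSpace (m + 1))
      have h2 := he.1 i
      simp only [WithLp.toLp_fst, WithLp.toLp_snd, h2, norm_zero] at this
      nlinarith [norm_nonneg (WithLp.toLp 2 (0, e i) : AmbientSpace (m + 1))]
    · simpa [WithLp.prod_inner_apply] using he.2 hij
    · have h1 : ‖meridianVector a t z‖ ^ 2 = metricCoeff a t := by
        rw [WithLp.prod_norm_sq_eq_of_L2]
        simp [meridianVector, norm_smul, hz, mul_pow, metricCoeff]
      have h2 : ‖meridianVector a t z‖ = √(metricCoeff a t) := by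
        rw [← h1, Real.sqrt_sq (norm_nonneg _)]
      rw [norm_smul, h2, norm_inv, Real.norm_of_nonneg (Real.sqrt_nonneg _), inv_mul_cancel₀ hs0]
    · simp [WithLp.prod_inner_apply, meridianVector, real_inner_smul_left, h]
  · induction i using Fin.cases with
    | zero =>
      have := isNormalTo_deriv_deriv_ellipsoidPoint (r := 0) ha
        (hasDerivAt_quadratic t (√(metricCoeff a t))⁻¹
          (-((a ^ 2 - 1) * (Real.sin t * Real.cos t) / metricCoeff a t ^ 2)))
        (hasDerivAt_affine _ _ 0) (fun s => hasDerivAt_const s z)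
        ((hasDerivAt_const (0 : ℝ) (0 : EuclideanSpace ℝ (Fin (m + 1)))).congr_deriv (by simp))
        (fun _ => hz) (by simp) (by
          simp [hsq]
          field_simp
          ring)
      simp only [mul_zero, add_zero, ne_eq, OfNat.ofNat_ne_zero, not_false_eq_true,
        zero_pow] at this
      exact this
    | succ i =>
      have := isNormalTo_deriv_deriv_ellipsoidPoint (r := -((Real.sin t)⁻¹ ^ 2)) ha
        (hasDerivAt_quadratic t 0 (Real.cos t / (Real.sin t * metricCoeff a t)))
        (hasDerivAt_affine _ _ 0) (fun s => hasDerivAt_greatCircle_mul z (e i) (Real.sin t)⁻¹ s)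
        (((hasDerivAt_greatCircle_mul (e i) (-z) (Real.sin t)⁻¹ 0).const_smul
          (Real.sin t)⁻¹).congr_deriv (by simp [smul_smul, sq]))
        (fun s => norm_greatCircle hz (he.1 i) (h i) _) (by simp) (by
          simp [norm_smul, he.1 i]
          field_simp
          ring)
      simp only [mul_zero, add_zero, ne_eq, OfNat.ofNat_ne_zero, not_false_eq_true, zero_pow,
        greatCircle_zero] at this
      exact this

end Ellipsoid

end Frames

/-! ### The profile of a harmonic map solves the boundary value problem -/

section Reduction

/-- A continuous lift of a smooth angle is smooth. -/
lemma ContinuousAt.contDiffAt_of_cos_sin {n : WithTop ℕ∞} {f : ℝ → ℝ} {t : ℝ}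
    (hf : ContinuousAt f t) (hc : ContDiffAt ℝ n (fun s => Real.cos (f s)) t)
    (hs : ContDiffAt ℝ n (fun s => Real.sin (f s)) t) : ContDiffAt ℝ n f t := by
  have hpi := Real.pi_pos
  have h1 : ContDiffAt ℝ n (fun s => Real.arcsin (Real.sin (f s) * Real.cos (f t)
      - Real.cos (f s) * Real.sin (f t)) + f t) t := by
    refine ContDiffAt.add (ContDiffAt.comp t (g := Real.arcsin) ?_
      ((hs.mul contDiffAt_const).sub (hc.mul contDiffAt_const))) contDiffAt_const
    refine Real.contDiffAt_arcsin ?_ ?_ <;> simp [mul_comm]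
  refine h1.congr_of_eventuallyEq ?_
  have h2 : Tendsto (fun s => f s - f t) (𝓝 t) (𝓝 0) := by simpa using hf.tendsto.sub_const (f t)
  filter_upwards [h2.eventually (Ioo_mem_nhds (by linarith : -(Real.pi / 2) < 0)
    (by linarith : 0 < Real.pi / 2))] with s hs
  rw [← Real.sin_sub, Real.arcsin_sin hs.1.le hs.2.le, sub_add_cancel]

lemma eventually_hasDerivAt_deriv {E : Type*} [NormedAddCommGroup E] [NormedSpace ℝ E]
    {f : ℝ → E} {t : ℝ} (hf : ContDiffAt ℝ ∞ f t) :
    ∀ᶠ s in 𝓝 t, HasDerivAt f (deriv f s) s := by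
  filter_upwards [(hf.of_le (m := 1) (by exact_mod_cast le_top)).eventually (by simp)] with s hs
  exact (hs.differentiableAt (by simp)).hasDerivAt

lemma hasDerivAt_deriv_of_contDiffAt {E : Type*} [NormedAddCommGroup E] [NormedSpace ℝ E]
    {f : ℝ → E} {t : ℝ} (hf : ContDiffAt ℝ ∞ f t) :
    HasDerivAt (deriv f) (deriv (deriv f) t) t :=
  ((hf.derivWithin (m := ∞) (by simp)).differentiableAt (by simp)).hasDerivAt

variable {k : ℕ} {a : ℝ}
  {χ : EuclideanSpace ℝ (Fin k) → EuclideanSpace ℝ (Fin k)} {φ : AmbientSpace k → AmbientSpace k}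
  {f : ℝ → ℝ}

lemma contDiffOn_profile (ha : a ≠ 0) (hφ : ContDiffOn ℝ ∞ φ (ellipsoid k a))
    (hf : ContinuousOn f (Icc 0 Real.pi)) {z : EuclideanSpace ℝ (Fin k)} (hz : ‖z‖ = 1)
    (hχz : ‖χ z‖ = 1)
    (hform : ∀ t ∈ Icc 0 Real.pi, φ (ellipsoidPoint a t z) = ellipsoidPoint a (f t) (χ z)) :
    ContDiffOn ℝ ∞ f (Ioo 0 Real.pi) := by
  intro t ht
  have hnhds : Icc 0 Real.pi ∈ 𝓝 t := Icc_mem_nhds ht.1 ht.2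
  have hγ : ContDiff ℝ ∞ fun s => φ (ellipsoidPoint a s z) :=
    hφ.comp_contDiff (contDiff_id.ellipsoidPoint contDiff_const) fun s => ellipsoidPoint_mem a s hz
  have hzz : inner ℝ (χ z) (χ z) = (1 : ℝ) := by rw [real_inner_self_eq_norm_sq, hχz, one_pow]
  have h1 : ContDiff ℝ ∞ fun s => a⁻¹ * (φ (ellipsoidPoint a s z)).fst :=
    contDiff_const.mul ((WithLp.fstL 2 ℝ ℝ (EuclideanSpace ℝ (Fin k))).contDiff.comp hγ)
  have h2 : ContDiff ℝ ∞ fun s => inner ℝ (χ z) (φ (ellipsoidPoint a s z)).snd :=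
    contDiff_const.inner ℝ ((WithLp.sndL 2 ℝ ℝ (EuclideanSpace ℝ (Fin k))).contDiff.comp hγ)
  refine (ContinuousAt.contDiffAt_of_cos_sin (hf.continuousAt hnhds)
    (h1.contDiffAt.congr_of_eventuallyEq ?_)
    (h2.contDiffAt.congr_of_eventuallyEq ?_)).contDiffWithinAt
  · filter_upwards [hnhds] with s hs
    rw [hform s hs]
    simp [ellipsoidPoint, ha]
  · filter_upwards [hnhds] with s hs
    rw [hform s hs]
    simp only [ellipsoidPoint, WithLp.toLp_snd, real_inner_smul_right, hzz, mul_one]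

/-- The contribution of a curve `(σ, ζ)` to the tension field of `(ψ, z) ↦ (f ψ, χ z)`, in the
direction of the meridians. -/
lemma inner_meridianVector_deriv_deriv_comp (hf : ContDiffOn ℝ ∞ f (Ioo 0 Real.pi))
    (hχ : ContDiffOn ℝ ∞ χ (Metric.sphere 0 1))
    (hχm : MapsTo χ (Metric.sphere 0 1) (Metric.sphere 0 1))
    (hform : ∀ t ∈ Icc 0 Real.pi, ∀ z ∈ Metric.sphere (0 : EuclideanSpace ℝ (Fin k)) 1,
      φ (ellipsoidPoint a t z) = ellipsoidPoint a (f t) (χ z))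
    {t : ℝ} (ht : t ∈ Ioo 0 Real.pi) (α β : ℝ) {ζ : ℝ → EuclideanSpace ℝ (Fin k)}
    (hζ : ContDiff ℝ ∞ ζ) (h1 : ∀ s, ‖ζ s‖ = 1) :
    inner ℝ (meridianVector a (f t) (χ (ζ 0)))
        (deriv (deriv fun s => φ (ellipsoidPoint a (t + α * s + β / 2 * s ^ 2) (ζ s))) 0) =
      metricCoeff a (f t) * (deriv (deriv f) t * α ^ 2 + deriv f t * β)
        + Real.sin (f t) * Real.cos (f t) * ((a ^ 2 - 1) * (deriv f t * α) ^ 2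
          - ‖deriv (fun s => χ (ζ s)) 0‖ ^ 2) := by
  set σ : ℝ → ℝ := fun s => t + α * s + β / 2 * s ^ 2 with hσ
  have hσ0 : σ 0 = t := by simp [hσ]
  have hσc : Tendsto σ (𝓝 0) (𝓝 t) := by
    have := (contDiff_quadratic (n := 0) t α β).continuous.tendsto 0
    rwa [show t + α * 0 + β / 2 * 0 ^ 2 = t by ring] at this
  have hft : ContDiffAt ℝ ∞ f t := hf.contDiffAt (isOpen_Ioo.mem_nhds ht)
  have hev : (fun s => φ (ellipsoidPoint a (σ s) (ζ s))) =ᶠ[𝓝 0]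
      fun s => ellipsoidPoint a ((f ∘ σ) s) ((χ ∘ ζ) s) := by
    filter_upwards [hσc (Icc_mem_nhds ht.1 ht.2)] with s hs
    exact hform _ hs _ (by simpa using h1 s)
  have hχζ : ContDiff ℝ ∞ (χ ∘ ζ) := hχ.comp_contDiff hζ fun s => by simpa using h1 s
  have hg : ∀ᶠ s in 𝓝 0, HasDerivAt (f ∘ σ) (deriv f (σ s) * (α + β * s)) s := by
    filter_upwards [hσc.eventually (eventually_hasDerivAt_deriv hft)] with s hs
    exact hs.comp s (hasDerivAt_quadratic t α β s)
  have hg1 : HasDerivAt (fun s => deriv f (σ s) * (α + β * s))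
      (deriv (deriv f) t * α ^ 2 + deriv f t * β) 0 := by
    have h3 : HasDerivAt (deriv f) (deriv (deriv f) t) (σ 0) := by
      rw [hσ0]
      exact hasDerivAt_deriv_of_contDiffAt hft
    refine ((h3.comp 0 (hasDerivAt_quadratic t α β 0)).mul (hasDerivAt_affine α β 0)).congr_deriv ?_
    simp only [Function.comp, hσ0]
    ring
  have key := inner_meridianVector_deriv_deriv (a := a) hg hg1
    (fun s => ((hχζ.differentiable (by simp)) s).hasDerivAt)
    (hasDerivAt_deriv_of_contDiffAt hχζ.contDiffAt)
    (fun s => by simpa using hχm (show ζ s ∈ Metric.sphere 0 1 by simpa using h1 s))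
  rw [hev.deriv.deriv_eq]
  simp only [Function.comp, hσ0, mul_zero, add_zero] at key ⊢
  exact key

end Reduction

/-- The profile of a harmonic map of the form `(ψ, z) ↦ (f ψ, χ z)` solves the Euler-Lagrange
equation: the component of the tension field in the direction of the meridians vanishes. -/
lemma IsHarmonicMap.isProfileSolution {m d : ℕ} {a : ℝ} (ha : a ≠ 0)
    {χ : EuclideanSpace ℝ (Fin (m + 1)) → EuclideanSpace ℝ (Fin (m + 1))}
    {φ : AmbientSpace (m + 1) → AmbientSpace (m + 1)} {f : ℝ → ℝ}
    (hχ : IsEigenmap (m + 1) d χ)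
    (hφ : IsHarmonicMap (m + 1) (ellipsoid (m + 1) a) (ellipsoid (m + 1) a) φ)
    (hf : ContinuousOn f (Icc 0 Real.pi)) (hf0 : f 0 = 0) {l : ℤ} (hfl : f Real.pi = l * Real.pi)
    (hform : ∀ t ∈ Icc 0 Real.pi, ∀ z ∈ Metric.sphere (0 : EuclideanSpace ℝ (Fin (m + 1))) 1,
      φ (ellipsoidPoint a t z) = ellipsoidPoint a (f t) (χ z)) :
    IsProfileSolution (m + 1) d a f := by
  obtain ⟨⟨hχm, hχs, -⟩, henergy⟩ := hχ
  obtain ⟨-, hφs, htension⟩ := hφ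
  set z : EuclideanSpace ℝ (Fin (m + 1)) := EuclideanSpace.single 0 1 with hzdef
  have hz : ‖z‖ = 1 := by simp [hzdef]
  have hzm : z ∈ Metric.sphere 0 1 := by simpa using hz
  have hχz : ‖χ z‖ = 1 := by simpa using hχm hzm
  have hsm := contDiffOn_profile ha hφs hf hz hχz fun t ht => hform t ht z hzm
  have hpi := Real.pi_pos
  refine ⟨hsm.of_le (show ((2 : ℕ∞) : WithTop ℕ∞) ≤ ∞ by exact_mod_cast le_top), fun t ht => ?_, ?_,
      l, ?_⟩
  · obtain ⟨e, he, hze⟩ := exists_orthonormal_orthogonal hz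
    have hS := (Real.sin_pos_of_mem_Ioo ht).ne'
    have hM := (metricCoeff_pos ha t).ne'
    have hN := (metricCoeff_pos ha (f t)).ne'
    have hpt := hform t (Ioo_subset_Icc_self ht) z hzm
    have hframe := isGeodesicFrame_ellipsoid ha hS hz he hze
    have hT := htension _ (ellipsoidPoint_mem a t hz) _ hframe
        (fun s => ellipsoidPoint a (f t + s) (χ z))
      ⟨(contDiff_const.add contDiff_id).ellipsoidPoint contDiff_const,
        fun s => ellipsoidPoint_mem _ _ hχz, by simp [hpt]⟩
    have hd : deriv (fun s => ellipsoidPoint a (f t + s) (χ z)) 0 = meridianVector a (f t)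
        (χ z) := by
      have := (((hasDerivAt_id (0 : ℝ)).const_add (f t)).ellipsoidPoint (a := a)
        (hasDerivAt_const (0 : ℝ) (χ z))).deriv
      refine this.trans ?_
      simp [meridianVector]
    -- the meridian and the parallels contribute separately to the tension field
    rw [hd, inner_sum, Fin.sum_univ_succ] at hT
    simp only [Fin.cons_zero, Fin.cons_succ] at hT
    have h0 := inner_meridianVector_deriv_deriv_comp hsm hχs hχm hform ht (√(metricCoeff a t))⁻¹
      (-((a ^ 2 - 1) * (Real.sin t * Real.cos t) / metricCoeff a t ^ 2))
      (contDiff_const (c := z)) fun _ => hz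
    have h1 := fun i => inner_meridianVector_deriv_deriv_comp hsm hχs hχm hform ht 0
      (Real.cos t / (Real.sin t * metricCoeff a t))
      ((contDiff_greatCircle z (e i)).comp
        (contDiff_const.mul contDiff_id : ContDiff ℝ ∞ fun s : ℝ => (Real.sin t)⁻¹ * s))
      fun s => norm_greatCircle hz (he.1 i) (hze i) _
    -- the parallels contribute the energy density of `χ`, by the great circles of the sphere
    have hE := henergy z hzm _ (isGeodesicFrame_greatCircle hz he hze)
    have hdχ : ∀ i, deriv (fun s => χ (greatCircle z (e i) ((Real.sin t)⁻¹ * s))) 0 =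
        (Real.sin t)⁻¹ • deriv (fun s => χ (greatCircle z (e i) s)) 0 := by
      intro i
      rw [deriv_comp_mul_left (Real.sin t)⁻¹ (fun s => χ (greatCircle z (e i) s)) 0, mul_zero]
    have hsum : ∑ i, inner ℝ (meridianVector a (f t) (χ z))
        (deriv (deriv fun s => φ (parallelCurve a t z (e i) s)) 0) =
        m * (metricCoeff a (f t) * (deriv f t * (Real.cos t / (Real.sin t * metricCoeff a t))))
          - Real.sin (f t) * Real.cos (f t) * ((Real.sin t)⁻¹ ^ 2
            * (d * (d + ((m + 1 : ℕ) : ℝ) - 2))) := by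
      rw [← hE, Finset.mul_sum, Finset.mul_sum]
      trans ∑ i, (metricCoeff a (f t) * (deriv f t * (Real.cos t / (Real.sin t * metricCoeff a t)))
        - Real.sin (f t) * Real.cos (f t)
          * ((Real.sin t)⁻¹ ^ 2 * ‖deriv (fun s => χ (greatCircle z (e i) s)) 0‖ ^ 2))
      · refine Finset.sum_congr rfl fun i _ => ?_
        have := h1 i
        simp only [Function.comp, mul_zero, greatCircle_zero, hdχ, norm_smul, mul_pow, norm_inv,
          Real.norm_eq_abs, inv_pow, sq_abs] at this
        refine this.trans ?_
        ring
      · rw [Finset.sum_sub_distrib, Finset.sum_const, Finset.card_univ, Fintype.card_fin,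
          nsmul_eq_mul]
        rfl
    have h0' : inner ℝ (meridianVector a (f t) (χ z))
        (deriv (deriv fun s => φ (meridianCurve a t z s)) 0) = _ := h0
    rw [hsum, h0', inv_pow, mul_pow, inv_pow, Real.sq_sqrt (metricCoeff_pos ha t).le] at hT
    simp only [deriv_const, norm_zero, Real.sin_two_mul, Real.cot_eq_cos_div_sin] at hT ⊢
    push_cast at hT ⊢
    field_simp at hT ⊢
    linear_combination hT
  · have := (hf 0 ⟨le_rfl, hpi.le⟩).mono_left (nhdsWithin_mono _ Ioc_subset_Icc_self)
    rw [nhdsWithin_Ioc_eq_nhdsGT hpi, hf0] at this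
    exact this
  · have := (hf Real.pi ⟨hpi.le, le_rfl⟩).mono_left (nhdsWithin_mono _ Ico_subset_Icc_self)
    rw [nhdsWithin_Ico_eq_nhdsLT hpi, hfl] at this
    exact this

/-- A map of the form `(ψ, z) ↦ (f ψ, χ z)` is determined by the values of `f` on `(0, π)`, so
finiteness passes from the profiles to the maps. -/
theorem finite_harmonicMaps {m d : ℕ} {a : ℝ} (ha : a ≠ 0)
    {χ : EuclideanSpace ℝ (Fin (m + 1)) → EuclideanSpace ℝ (Fin (m + 1))}
    (hχ : IsEigenmap (m + 1) d χ)
    (hfin : ((Ioo 0 Real.pi).domRestrict ''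
      {f : ℝ → ℝ | IsProfileSolution (m + 1) d a f}).Finite) :
    ((ellipsoid (m + 1) a).domRestrict ''
      {φ : AmbientSpace (m + 1) → AmbientSpace (m + 1) |
        IsHarmonicMap (m + 1) (ellipsoid (m + 1) a) (ellipsoid (m + 1) a) φ ∧
          HasProfileForm a χ φ}).Finite := by
  choose! f hf hf0 hfl hform using
    fun (φ : AmbientSpace (m + 1) → AmbientSpace (m + 1)) (h : HasProfileForm a χ φ) => h
  set S := {φ : AmbientSpace (m + 1) → AmbientSpace (m + 1) |
    IsHarmonicMap (m + 1) (ellipsoid (m + 1) a) (ellipsoid (m + 1) a) φ ∧ HasProfileForm a χ φ}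
  have key : ∀ r : ellipsoid (m + 1) a → AmbientSpace (m + 1),
      r ∈ (ellipsoid (m + 1) a).domRestrict '' S →
        ∃ φ ∈ S, (ellipsoid (m + 1) a).domRestrict φ = r := fun r h => h
  choose! Φ hΦ hr using key
  refine Set.Finite.of_finite_image
    (f := fun r => (Ioo 0 Real.pi).domRestrict (f (Φ r))) (hfin.subset ?_) ?_
  · rintro _ ⟨r, h, rfl⟩
    obtain ⟨h1, h2⟩ := hΦ r h
    obtain ⟨l, hl⟩ := hfl _ h2
    exact ⟨f (Φ r), h1.isProfileSolution ha hχ (hf _ h2) (hf0 _ h2) hl (hform _ h2), rfl⟩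
  · intro r h r' h' he
    obtain ⟨-, h2⟩ := hΦ r h
    obtain ⟨-, h2'⟩ := hΦ r' h'
    have heq : EqOn (f (Φ r)) (f (Φ r')) (Icc 0 Real.pi) := by
      refine EqOn.of_subset_closure (fun t ht => congrFun he ⟨t, ht⟩) (hf _ h2) (hf _ h2')
        Ioo_subset_Icc_self ?_
      rw [closure_Ioo Real.pi_pos.ne]
    rw [← hr r h, ← hr r' h']
    ext1 ⟨x, t, ht, z, hz, hx⟩
    simp only [domRestrict_apply, hx]
    rw [hform _ h2 t ht z hz, hform _ h2' t ht z hz, heq ht]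

theorem theorem2 (k : ℕ) (hk : 3 ≤ k) (d : ℕ) (a : ℝ) (ha : a ≠ 0)
    (hlarge : 4 * (d : ℝ) * ((d : ℝ) + (k : ℝ) - 2) / ((k : ℝ) - 2) ^ 2 ≤ a ^ 2) :
    (∀ χ : EuclideanSpace ℝ (Fin k) → EuclideanSpace ℝ (Fin k), IsEigenmap k d χ →
      ((ellipsoid k a).domRestrict ''
        {φ : AmbientSpace k → AmbientSpace k |
          IsHarmonicMap k (ellipsoid k a) (ellipsoid k a) φ ∧ HasProfileForm a χ φ}).Finite) ∧
    ((Ioo 0 Real.pi).domRestrict '' {f : ℝ → ℝ | IsProfileSolution k d a f}).Finite := by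
  obtain ⟨n, rfl⟩ : ∃ n, k = n + 2 := ⟨k - 2, by omega⟩
  have hn : 1 ≤ n := by omega
  have hn0 : (0 : ℝ) < n := by exact_mod_cast hn
  have hlarge' : 4 * ((d : ℝ) * (d + n)) ≤ a ^ 2 * (n : ℝ) ^ 2 := by
    rw [Nat.cast_add, Nat.cast_two, add_sub_cancel_right, div_le_iff₀ (by positivity)] at hlarge
    linarith
  have hfin := finite_isProfileSolution hn ha hlarge'
  exact ⟨fun χ hχ => finite_harmonicMaps ha hχ hfin, hfin⟩
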